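/- Setting. Let $\{\Omega(t)\}_{t\in\mathbb R}$ be bounded domains in $\mathbb R^3$ with smooth boundary, let $Q_\infty=\bigcup_{t}\Omega(t)\times\{t\}$, and let $\Phi(x,t)=(\phi(x,t),t)$ be a level-preserving $C^\infty$ diffeomorphism of $\overline{Q_\infty}$ onto $\overline{\widetilde\Omega\times\mathbb R}$, with $\widetilde\Omega\subset\mathbb R^3$ open and $\phi(\cdot,t)$ mapping $\Omega(t)$ onto $\widetilde\Omega$ for every $t$, such that $\det\big(\partial\phi^i/\partial x^j(x,t)\big)=J(t)^{-1}>0$ depends only on $t$. Write $y=\phi(x,t)$ and $x=\phi^{-1}(y,t)$, and let $$g_{ij}=\sum_k\frac{\partial x^k}{\partial y^i}\frac{\partial x^k}{\partial y^j},\qquad g^{ij}=\sum_k\frac{\partial y^i}{\partial x^k}\frac{\partial y^j}{\partial x^k},\qquad \Gamma^k_{ij}=\frac12\sum_\ell g^{k\ell}\Big(\frac{\partial g_{i\ell}}{\partial y^j}+\frac{\partial g_{j\ell}}{\partial y^i}-\frac{\partial g_{ij}}{\partial y^\ell}\Big),$$ all as functions of $(y,t)$. For vector fields on $\widetilde\Omega$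 put $N[\widetilde u,\widetilde v]^i=\sum_j\widetilde u^j\big(\frac{\partial\widetilde v^i}{\partial y^j}+\sum_k\Gamma^i_{jk}\widetilde v^k\big)$ and $\langle \widetilde a,\widetilde b\rangle_t=\int_{\widetilde\Omega}\sum_{i,j}g_{ij}(y,t)\widetilde a^i\widetilde b^j J(t)\,dy$. For a function $\widetilde\theta$ put, with indices $j+1,j+2$ taken cyclically in $\{1,2,3\}$, $$\big[\mathrm{Rot}(t)[\widetilde\theta,\widetilde w]\big]^i=\sum_{j,k,\ell}\frac{\partial y^i}{\partial x^j}\Big(\frac{\partial y^k}{\partial x^{j+1}}\frac{\partial^2x^{j+2}}{\partial y^k\partial y^\ell}-\frac{\partial y^k}{\partial x^{j+2}}\frac{\partial^2x^{j+1}}{\partial y^k\partial y^\ell}\Big)\widetilde\theta\,\widetilde w^\ell+\sum_{j,k,\ell}\frac{\partial y^i}{\partial x^j}\Big(\frac{\partial y^k}{\partial x^{j+1}}\frac{\partial x^{j+2}}{\partial y^\ell}-\frac{\partial y^k}{\partial x^{j+2}}\frac{\partial x^{j+1}}{\partial y^\ell}\Big)\Big(\frac{\partial\widetilde\theta}{\partial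 y^k}\widetilde w^\ell+\widetilde\theta\,\frac{\partial\widetilde w^\ell}{\partial y^k}\Big),$$ the transform to $\widetilde\Omega$ of $\mathrm{rot}(\theta w)$ on $\Omega(t)$. Let $d(y)=\mathrm{dist}(y,\partial\widetilde\Omega)$, and let $H^1_{0,\sigma}(\widetilde\Omega)$ be the $H^1$-closure of the smooth divergence-free vector fields with compact support in $\widetilde\Omega$. Statement. Let $T>0$, $\widetilde w\in C([0,T];H^2(\widetilde\Omega))$, $\varepsilon>0$ and $\rho_0>0$. Then there are $\rho\in(0,\rho_0)$ and a cut-off function $\widetilde\theta\in C^\infty(\overline{\widetilde\Omega})$ with values in $[0,1]$ such that $$\widetilde\theta(y)=1\ \text{ if } d(y)<\tfrac12e^{-2/\rho},\qquad \widetilde\theta(y)=0\ \text{ if } d(y)>2e^{-1/\rho},\qquad |\nabla\widetilde\theta(y)|\le\frac{2\sqrt3\,\rho}{d(y)}\ \text{ in }\widetilde\Omega,$$ and such that, for all $t\in[0,T]$ and all $\widetilde u\in H^1_{0,\sigma}(\widetilde\Omega)$, the integrand of $\langle N[\widetilde u,\widetilde u],\mathrm{Rot}(t)[\widetilde\theta,\widetilde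 w(t)]\rangle_t$ is integrable on $\widetilde\Omega$ and, if $\widetilde u\neq0$, $$\big\langle N[\widetilde u,\widetilde u],\mathrm{Rot}(t)[\widetilde\theta,\widetilde w(t)]\big\rangle_t<\varepsilon\,\|\nabla_y\widetilde u\|_{L^2(\widetilde\Omega)}^2 .$$ -/

import Mathlib

open Set MeasureTheory
open scoped ContDiff ENNReal

noncomputable section

namespace MovingDomain

/-- Three-dimensional Euclidean space. -/
abbrev E3 : Type := EuclideanSpace ℝ (Fin 3)

/-- The classical partial derivative `∂f/∂y^j`. -/
def pd (j : Fin 3) (f : E3 → ℝ) (y : E3) : ℝ :=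
  fderiv ℝ f y (EuclideanSpace.single j 1)

/-! ### Domains and the moving family -/

/-- The boundary of `U` is smooth and `U` lies locally on one side of it: near every boundary point
a smooth change of coordinates turns `U` into a half space. -/
def HasSmoothBoundary (U : Set E3) : Prop :=
  ∀ x ∈ frontier U, ∃ e : OpenPartialHomeomorph E3 E3,
    x ∈ e.source ∧ ContDiffOn ℝ ∞ e e.source ∧ ContDiffOn ℝ ∞ e.symm e.target ∧
      ∀ z ∈ e.source, z ∈ U ↔ 0 < e z 0

/-- A bounded domain (nonempty connected open set) with smooth boundary. -/
structure IsBoundedSmoothDomain (U : Set E3) : Prop where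
  isOpen : IsOpen U
  isConnected : IsConnected U
  isBounded : Bornology.IsBounded U
  smoothBoundary : HasSmoothBoundary U

/-- The noncylindrical domain `Q_∞ = ⋃ₜ Ω(t) × {t}`. -/
def spaceTime (Ω : ℝ → Set E3) : Set (E3 × ℝ) := {p | p.1 ∈ Ω p.2}

/-- A family `Ω(t)`, `t ∈ ℝ`, of bounded smooth domains together with a level-preserving smooth
diffeomorphism `Φ(x,t) = (φ(x,t),t)` of the closure of `Q_∞` onto the closure of `Ω̃ × ℝ`, with
inverse `(y,s) ↦ (ψ(y,s),s)`, carrying each `Ω(t)` onto `Ω̃`, whose spatial Jacobian determinant is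
positive and depends on time only, being equal to `J(t)⁻¹`. -/
structure Family where
  /-- the moving domain `Ω(t)` -/
  Ω : ℝ → Set E3
  /-- the reference domain `Ω̃` -/
  Ωref : Set E3
  /-- `y = φ(x,t)` -/
  φ : E3 → ℝ → E3
  /-- `x = φ⁻¹(y,t)` -/
  ψ : E3 → ℝ → E3
  /-- the inverse Jacobian determinant -/
  J : ℝ → ℝ
  domain : ∀ t, IsBoundedSmoothDomain (Ω t)
  isOpen_ref : IsOpen Ωref
  φ_smooth : ContDiffOn ℝ ∞ (fun p : E3 × ℝ => φ p.1 p.2) (closure (spaceTime Ω))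
  ψ_smooth : ContDiffOn ℝ ∞ (fun p : E3 × ℝ => ψ p.1 p.2) (closure (Ωref ×ˢ (univ : Set ℝ)))
  φ_mapsTo : ∀ x t, (x, t) ∈ closure (spaceTime Ω) →
    (φ x t, t) ∈ closure (Ωref ×ˢ (univ : Set ℝ))
  ψ_mapsTo : ∀ y t, (y, t) ∈ closure (Ωref ×ˢ (univ : Set ℝ)) →
    (ψ y t, t) ∈ closure (spaceTime Ω)
  ψ_φ : ∀ x t, (x, t) ∈ closure (spaceTime Ω) → ψ (φ x t) t = x
  φ_ψ : ∀ y t, (y, t) ∈ closure (Ωref ×ˢ (univ : Set ℝ)) → φ (ψ y t) t = y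
  φ_image : ∀ t, (fun x => φ x t) '' Ω t = Ωref
  J_pos : ∀ t, 0 < J t
  det_eq : ∀ t, ∀ x ∈ Ω t,
    Matrix.det (Matrix.of fun i j : Fin 3 => pd j (fun z => φ z t i) x) = (J t)⁻¹

namespace Family

variable (D : Family)

/-- `∂x^k/∂y^i (y,t)`. -/
def dx (t : ℝ) (k i : Fin 3) (y : E3) : ℝ := pd i (fun z => D.ψ z t k) y

/-- `∂²x^k/∂y^i∂y^j (y,t)`. -/
def ddx (t : ℝ) (k i j : Fin 3) (y : E3) : ℝ := pd i (fun z => D.dx t k j z) y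

/-- `∂y^i/∂x^k`, evaluated at `x = φ⁻¹(y,t)` and regarded as a function of `y`. -/
def dy (t : ℝ) (i k : Fin 3) (y : E3) : ℝ := pd k (fun x => D.φ x t i) (D.ψ y t)

/-- `g^{ij}(y,t)`. -/
def gUp (t : ℝ) (i j : Fin 3) (y : E3) : ℝ := ∑ k, D.dy t i k y * D.dy t j k y

/-- `g_{ij}(y,t)`. -/
def gLow (t : ℝ) (i j : Fin 3) (y : E3) : ℝ := ∑ k, D.dx t k i y * D.dx t k j y

/-- The Christoffel symbol `Γ^k_{ij}(y,t)` of the metric `g_{ij}(·,t)`. -/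
def Γ (t : ℝ) (k i j : Fin 3) (y : E3) : ℝ :=
  1 / 2 * ∑ l, D.gUp t k l y *
    (pd j (D.gLow t i l) y + pd i (D.gLow t j l) y - pd l (D.gLow t i j) y)

/-- The coefficient `R^{i,1}_{j,k,l}(y,t)`; addition in `Fin 3` is the cyclic shift of indices. -/
def R1 (t : ℝ) (i j k l : Fin 3) (y : E3) : ℝ :=
  D.dy t i j y * (D.dy t k (j + 1) y * D.ddx t (j + 2) k l y
    - D.dy t k (j + 2) y * D.ddx t (j + 1) k l y)

/-- The coefficient `R^{i,2}_{j,k,l}(y,t)`. -/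
def R2 (t : ℝ) (i j k l : Fin 3) (y : E3) : ℝ :=
  D.dy t i j y * (D.dy t k (j + 1) y * D.dx t (j + 2) l y
    - D.dy t k (j + 2) y * D.dx t (j + 1) l y)

end Family

/-! ### Sobolev spaces -/

/-- The scalar space `L²(U)`. -/
abbrev L2 (U : Set E3) : Type := Lp ℝ 2 (volume.restrict U)

/-- `g` is the weak partial derivative `∂f/∂y^j` in `U`. -/
def IsWeakPartial (U : Set E3) (j : Fin 3) (f g : L2 U) : Prop :=
  ∀ η : E3 → ℝ, ContDiff ℝ ∞ η → HasCompactSupport η → tsupport η ⊆ U →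
    ∫ y in U, f y * pd j η y = - ∫ y in U, g y * η y

theorem memLp_test {U : Set E3} {η : E3 → ℝ} (h : Continuous η) (hc : HasCompactSupport η) :
    MemLp η 2 (volume.restrict U) :=
  (h.memLp_of_hasCompactSupport hc).restrict U

theorem memLp_pd_test {U : Set E3} {η : E3 → ℝ} (j : Fin 3) (h : ContDiff ℝ ∞ η)
    (hc : HasCompactSupport η) : MemLp (pd j η) 2 (volume.restrict U) := by
  refine memLp_test ?_ ?_
  · exact (h.continuous_fderiv (by simp)).clm_apply continuous_const
  · exact (hc.fderiv ℝ).comp_left (g := fun L : E3 →L[ℝ] ℝ => L (EuclideanSpace.single j 1)) rfl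

theorem isWeakPartial_zero (U : Set E3) (j : Fin 3) : IsWeakPartial U j 0 0 := by
  intro η _ _ _
  have h0 := Lp.coeFn_zero ℝ 2 (volume.restrict U)
  have h1 : ∫ y in U, (0 : L2 U) y * pd j η y = 0 := by
    rw [integral_eq_zero_of_ae]
    filter_upwards [h0] with y hy
    rw [hy, Pi.zero_apply, zero_mul]
  have h2 : ∫ y in U, (0 : L2 U) y * η y = 0 := by
    rw [integral_eq_zero_of_ae]
    filter_upwards [h0] with y hy
    rw [hy, Pi.zero_apply, zero_mul]
  rw [h1, h2, neg_zero]

theorem integral_add_mul {U : Set E3} (f g : L2 U) {η : E3 → ℝ}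
    (h : MemLp η 2 (volume.restrict U)) :
    ∫ y in U, (f + g) y * η y = (∫ y in U, f y * η y) + ∫ y in U, g y * η y := by
  have hf : Integrable (fun y => f y * η y) (volume.restrict U) := (Lp.memLp f).integrable_mul h
  have hg : Integrable (fun y => g y * η y) (volume.restrict U) := (Lp.memLp g).integrable_mul h
  rw [← integral_add hf hg]
  refine integral_congr_ae ?_
  filter_upwards [Lp.coeFn_add f g] with y hy
  rw [hy, Pi.add_apply, add_mul]

theorem integral_smul_mul {U : Set E3} (c : ℝ) (f : L2 U) (η : E3 → ℝ) :
    ∫ y in U, (c • f) y * η y = c * ∫ y in U, f y * η y := by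
  rw [← integral_const_mul]
  refine integral_congr_ae ?_
  filter_upwards [Lp.coeFn_smul c f] with y hy
  rw [hy, Pi.smul_apply, smul_eq_mul, mul_assoc]

theorem IsWeakPartial.add {U : Set E3} {j : Fin 3} {f g f' g' : L2 U}
    (h : IsWeakPartial U j f g) (h' : IsWeakPartial U j f' g') :
    IsWeakPartial U j (f + f') (g + g') := by
  intro η h1 h2 h3
  rw [integral_add_mul _ _ (memLp_pd_test j h1 h2),
    integral_add_mul _ _ (memLp_test h1.continuous h2), h η h1 h2 h3, h' η h1 h2 h3, neg_add]

theorem IsWeakPartial.smul {U : Set E3} {j : Fin 3} {f g : L2 U} (c : ℝ)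
    (h : IsWeakPartial U j f g) : IsWeakPartial U j (c • f) (c • g) := by
  intro η h1 h2 h3
  rw [integral_smul_mul, integral_smul_mul, h η h1 h2 h3, mul_neg]

/-- The scalar Sobolev space `H¹(U)`: an element is `f ∈ L²(U)` together with its (unique) weak
partial derivatives in `L²(U)`; the norm is equivalent to the usual one. -/
def H1 (U : Set E3) : Submodule ℝ (L2 U × (Fin 3 → L2 U)) where
  carrier := {F | ∀ j, IsWeakPartial U j F.1 (F.2 j)}
  zero_mem' := fun j => isWeakPartial_zero U j
  add_mem' := fun h h' j => (h j).add (h' j)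
  smul_mem' := fun c _ h j => (h j).smul c

/-- The scalar Sobolev space `H²(U)`: an element is `f ∈ L²(U)` together with its (unique) weak
partial derivatives of first and second order in `L²(U)`; the norm is equivalent to the usual
one. -/
def H2 (U : Set E3) : Submodule ℝ (L2 U × (Fin 3 → L2 U) × (Fin 3 → Fin 3 → L2 U)) where
  carrier := {F | (∀ j, IsWeakPartial U j F.1 (F.2.1 j)) ∧
    ∀ j k, IsWeakPartial U k (F.2.1 j) (F.2.2 j k)}
  zero_mem' := ⟨fun j => isWeakPartial_zero U j, fun _ k => isWeakPartial_zero U k⟩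
  add_mem' := fun h h' => ⟨fun j => (h.1 j).add (h'.1 j), fun j k => (h.2 j k).add (h'.2 j k)⟩
  smul_mem' := fun c _ h => ⟨fun j => (h.1 j).smul c, fun j k => (h.2 j k).smul c⟩

/-- Vector fields of class `H¹`. -/
abbrev VH1 (U : Set E3) : Type := Fin 3 → H1 U

/-- Vector fields of class `H²`. -/
abbrev VH2 (U : Set E3) : Type := Fin 3 → H2 U

/-- The inclusion of `H²` into `H¹`. -/
def VH2.toVH1 {U : Set E3} (w : VH2 U) : VH1 U :=
  fun i => ⟨((w i).1.1, (w i).1.2.1), (w i).2.1⟩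

/-- The value `u^i(y)` of (a representative of) the `i`-th component. -/
def VH1.val {U : Set E3} (u : VH1 U) (i : Fin 3) (y : E3) : ℝ := (u i).1.1 y

/-- The weak derivative `∂u^i/∂y^j (y)`. -/
def VH1.wd {U : Set E3} (u : VH1 U) (i j : Fin 3) (y : E3) : ℝ := (u i).1.2 j y

/-- `‖∇_y u‖²` in `L²(U)`. -/
def VH1.gradNormSq {U : Set E3} (u : VH1 U) : ℝ := ∑ i, ∑ j, ‖(u i).1.2 j‖ ^ 2

/-- `C_{0,σ}^∞(U)`, viewed inside `H¹(U)`. -/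
def testSolenoidal (U : Set E3) : Set (VH1 U) :=
  {u | ∃ v : E3 → E3, ContDiff ℝ ∞ v ∧ HasCompactSupport v ∧ tsupport v ⊆ U ∧
    (∀ y, ∑ i, pd i (fun z => v z i) y = 0) ∧
    ∀ i, u.val i =ᵐ[volume.restrict U] fun y => v y i}

/-- `H¹_{0,σ}(U)`: the closure of `C_{0,σ}^∞(U)` in the `H¹`-norm. -/
def H10σ (U : Set E3) : Set (VH1 U) := closure (testSolenoidal U)

/-! ### The transformed operators -/

namespace Family

variable (D : Family)

/-- The covariant derivative `∇_j v^i`. -/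
def cov (t : ℝ) (v : VH1 D.Ωref) (j i : Fin 3) (y : E3) : ℝ :=
  v.wd i j y + ∑ k, D.Γ t i j k y * v.val k y

/-- `N[u,v]^i = ∑_j u^j ∇_j v^i`. -/
def N (t : ℝ) (u v : VH1 D.Ωref) (y : E3) (i : Fin 3) : ℝ :=
  ∑ j, u.val j y * D.cov t v j i y

/-- `Rot(t)[θ,w]`, the transform of `rot (θ w)`. -/
def Rot (t : ℝ) (θ : E3 → ℝ) (w : VH1 D.Ωref) (y : E3) (i : Fin 3) : ℝ :=
  (∑ j, ∑ k, ∑ l, D.R1 t i j k l y * (θ y * w.val l y)) +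
    ∑ j, ∑ k, ∑ l, D.R2 t i j k l y * (pd k θ y * w.val l y + θ y * w.wd l k y)

/-- The integrand of `⟨a,b⟩_t`. -/
def pairingDensity (t : ℝ) (a b : E3 → Fin 3 → ℝ) (y : E3) : ℝ :=
  (∑ i, ∑ j, D.gLow t i j y * a y i * b y j) * D.J t

/-- `⟨a,b⟩_t = ∫_Ω̃ ∑ g_{ij}(y,t) a^i b^j J(t) dy`. -/
def pairing (t : ℝ) (a b : E3 → Fin 3 → ℝ) : ℝ := ∫ y in D.Ωref, D.pairingDensity t a b y

end Family

/-- Smooth boundary cut-off function of Hopf–Temam type with parameter `ρ` for the set `U`, where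
`d(y)` is the distance to the boundary of `U`. -/
structure IsBoundaryCutoff (U : Set E3) (ρ : ℝ) (θ : E3 → ℝ) : Prop where
  smooth : ContDiff ℝ ∞ θ
  mem_Icc : ∀ y, θ y ∈ Icc (0 : ℝ) 1
  eq_one : ∀ y ∈ closure U,
    Metric.infDist y (frontier U) < 1 / 2 * Real.exp (-2 / ρ) → θ y = 1
  eq_zero : ∀ y ∈ closure U,
    2 * Real.exp (-1 / ρ) < Metric.infDist y (frontier U) → θ y = 0
  grad_le : ∀ y ∈ U,
    ‖fderiv ℝ θ y‖ ≤ 2 * Real.sqrt 3 * ρ / Metric.infDist y (frontier U)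

end MovingDomain

end

/-!
Expanding `Rot(t)[θ, w]` and using `|∇θ| ≤ C ρ / d`, the integrand is at most
`C (|∇u| + |u|) |u| (ρ d⁻¹ |w| + θ |∇w|)`, where `C` bounds the coefficients on the compact set
`closure Ω̃ × K`. In the first term Hardy's inequality puts `|u| / d` in `L²`, and `w` is bounded
by Sobolev embedding of `H²`. In the second term Hölder leaves `‖θ u‖_{L⁴}`. Since `θ` vanishes
where `d > 2 e^{-1/ρ}` and `e^{-1/ρ} ≤ ρ`, one has `θ |u| ≤ 2 ρ |u| / d`, so that
`‖θ u‖₄⁴ ≤ 2 ρ ‖u / d‖₂ ‖u‖₆³`, which Hardy and Sobolev bound by `C ρ ‖∇u‖₂⁴`. Altogether the form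
is at most `C (ρ + ρ^{1/4}) ‖∇u‖₂²`, uniformly for `w` in a ball of `H²`.
-/

noncomputable section

namespace MovingDomain

open Metric Filter Topology
open scoped NNReal Convolution

/-! ### The boundary cut-off function -/

section Mollification

variable {E F : Type*} [NormedAddCommGroup E] [NormedSpace ℝ E] [FiniteDimensional ℝ E]
  [HasContDiffBump E] [MeasurableSpace E] [BorelSpace E] {μ : Measure E} [μ.IsAddHaarMeasure]
  [NormedAddCommGroup F] [NormedSpace ℝ F] {κ : ContDiffBump (0 : E)} {f : E → F} {y : E}

theorem norm_fderiv_normed_convolution_le [CompleteSpace F] (hf : Continuous f) {s : ℝ}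
    (hs : κ.rOut < s) {K : ℝ≥0} (hK : LipschitzOnWith K f (ball y s)) :
    ‖fderiv ℝ (κ.normed μ ⋆[ContinuousLinearMap.lsmul ℝ ℝ, μ] f) y‖ ≤ K := by
  have hInt (x : E) : Integrable (fun t => κ.normed μ t • f (x - t)) μ :=
    (κ.continuous_normed.smul (by fun_prop)).integrable_of_hasCompactSupport
      κ.hasCompactSupport_normed.smul_right
  refine norm_fderiv_le_of_lip' ℝ K.2 ?_
  filter_upwards [ball_mem_nhds y (sub_pos.2 hs)] with x hx
  have hdiff : (κ.normed μ ⋆[ContinuousLinearMap.lsmul ℝ ℝ, μ] f) x -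
      (κ.normed μ ⋆[ContinuousLinearMap.lsmul ℝ ℝ, μ] f) y =
      (κ.normed μ ⋆[ContinuousLinearMap.lsmul ℝ ℝ, μ] fun z => f (z + (x - y)) - f z) y := by
    simp only [convolution_def, ContinuousLinearMap.lsmul_apply, smul_sub]
    rw [← integral_sub (hInt x) (hInt y)]
    simp only [add_sub_cancel, sub_add_eq_add_sub]
  rw [hdiff, ← dist_zero_right]
  refine dist_convolution_le (by positivity) κ.support_normed_eq.subset κ.nonneg_normed
    κ.integral_normed (by fun_prop) fun z hz => ?_
  rw [dist_zero_right]
  have hz' : z ∈ ball y s := ball_subset_ball hs.le hz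
  have hzx : z + (x - y) ∈ ball y s := by
    rw [mem_ball, dist_eq_norm] at hx hz ⊢
    calc ‖z + (x - y) - y‖ = ‖(z - y) + (x - y)‖ := by congr 1; abel
      _ < s := (norm_add_le _ _).trans_lt (by linarith)
  simpa using hK.norm_sub_le hzx hz'

theorem normed_convolution_mem_Icc {f : E → ℝ} (hf : Continuous f) {a b : ℝ}
    (h : ∀ x ∈ ball y κ.rOut, f x ∈ Icc a b) :
    (κ.normed μ ⋆[ContinuousLinearMap.lsmul ℝ ℝ, μ] f) y ∈ Icc a b := by
  rw [Real.Icc_eq_closedBall] at h ⊢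
  exact dist_convolution_le (dist_nonneg.trans (h y (mem_ball_self κ.rOut_pos)))
    κ.support_normed_eq.subset κ.nonneg_normed κ.integral_normed hf.aestronglyMeasurable h

end Mollification

theorem lipschitzOnWith_log_Ici {m : ℝ≥0} (hm : 0 < m) :
    LipschitzOnWith m⁻¹ Real.log (Ici (m : ℝ)) := by
  refine (convex_Ici _).lipschitzOnWith_of_nnnorm_hasDerivWithin_le (f' := fun x => x⁻¹)
    (fun x hx => ?_) fun x hx => ?_
  · exact (Real.hasDerivAt_log ((NNReal.coe_pos.2 hm).trans_le hx).ne').hasDerivWithinAt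
  · rw [nnnorm_inv]
    gcongr
    exact (le_abs_self x).trans' hx

/-- The Hopf–Temam profile: the truncation to `[0, 1]` of `-1 - ρ log s`, as a function of the
distance `s` to the boundary. The maximum with `e^{-2/ρ}` keeps the logarithm away from its
singularity at `0` without changing the truncation. -/
def hopfProfile (ρ s : ℝ) : ℝ :=
  max 0 (min 1 (-1 - ρ * Real.log (max s (Real.exp (-2 / ρ)))))

theorem hopfProfile_mem_Icc (ρ s : ℝ) : hopfProfile ρ s ∈ Icc (0 : ℝ) 1 :=
  ⟨le_max_left _ _, max_le zero_le_one (min_le_left _ _)⟩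

theorem hopfProfile_eq_one {ρ s : ℝ} (hρ : 0 < ρ) (hs : s ≤ Real.exp (-2 / ρ)) :
    hopfProfile ρ s = 1 := by
  rw [hopfProfile, max_eq_right hs, Real.log_exp, mul_div_cancel₀ _ hρ.ne']
  norm_num

theorem exp_neg_two_div_le_exp_neg_one_div {ρ : ℝ} (hρ : 0 < ρ) :
    Real.exp (-2 / ρ) ≤ Real.exp (-1 / ρ) := by
  gcongr
  norm_num

theorem hopfProfile_eq_zero {ρ s : ℝ} (hρ : 0 < ρ) (hs : Real.exp (-1 / ρ) ≤ s) :
    hopfProfile ρ s = 0 := by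
  have hlog : -1 / ρ ≤ Real.log s := by
    rwa [Real.le_log_iff_exp_le ((Real.exp_pos _).trans_le hs)]
  rw [div_le_iff₀ hρ] at hlog
  rw [hopfProfile, max_eq_left ((exp_neg_two_div_le_exp_neg_one_div hρ).trans hs)]
  exact max_eq_left ((min_le_right _ _).trans (by linarith))

theorem lipschitzOnWith_hopfProfile {ρ m : ℝ≥0} (hm : 0 < m) :
    LipschitzOnWith (ρ / m) (hopfProfile ρ) {s | (m : ℝ) ≤ max s (Real.exp (-2 / ρ))} := by
  have hlog := (lipschitzOnWith_log_Ici hm).comp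
    (LipschitzWith.id.max_const (Real.exp (-2 / ρ))).lipschitzOnWith fun s hs => hs
  have htrunc : LipschitzWith ρ fun x : ℝ => max 0 (min 1 (-1 - ρ * x)) := by
    refine LipschitzWith.const_max (LipschitzWith.const_min (.of_dist_le_mul fun x x' => ?_) 1) 0
    rw [dist_sub_left, Real.dist_eq, Real.dist_eq, ← mul_sub, abs_mul, NNReal.abs_eq]
  have hcomp := htrunc.comp_lipschitzOnWith hlog
  rwa [mul_one, ← div_eq_mul_inv] at hcomp

theorem continuous_hopfProfile (ρ : ℝ) : Continuous (hopfProfile ρ) := by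
  unfold hopfProfile
  have hlog : Continuous fun s => Real.log (max s (Real.exp (-2 / ρ))) :=
    (continuous_id.max continuous_const).log fun s =>
      ((Real.exp_pos _).trans_le (le_max_right _ _)).ne'
  fun_prop

theorem lipschitzOnWith_hopfProfile_infDist (S : Set E3) {ρ : ℝ≥0} {y : E3}
    (hd : 3 / 4 * Real.exp (-2 / ρ) ≤ infDist y S) :
    LipschitzOnWith (ρ / (4 / 5 * (infDist y S).toNNReal)) (fun x => hopfProfile ρ (infDist x S))
      (ball y (Real.exp (-2 / ρ) / 4)) := by
  have hd0 : 0 < infDist y S := lt_of_lt_of_le (by positivity) hd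
  have hcomp := (lipschitzOnWith_hopfProfile (ρ := ρ) (m := 4 / 5 * (infDist y S).toNNReal)
    (by simpa using hd0)).comp ((lipschitz_infDist_pt S).lipschitzOnWith
      (s := ball y (Real.exp (-2 / ρ) / 4))) fun x hx => ?_
  · rwa [mul_one] at hcomp
  · have hx' := infDist_le_infDist_add_dist (s := S) (x := y) (y := x)
    rw [mem_ball, dist_comm] at hx
    simp only [mem_ofPred_eq, NNReal.coe_mul, NNReal.coe_div, NNReal.coe_ofNat,
      Real.coe_toNNReal _ hd0.le]
    rcases le_total (infDist y S) (5 / 4 * Real.exp (-2 / ρ)) with h | h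
    · exact le_max_of_le_right (by linarith)
    · exact le_max_of_le_left (by linarith)

theorem exists_isBoundaryCutoff (U : Set E3) {ρ : ℝ} (hρ : 0 < ρ) :
    ∃ θ, IsBoundaryCutoff U ρ θ := by
  lift ρ to ℝ≥0 using hρ.le
  set m := Real.exp (-2 / ρ)
  have hm0 : 0 < m := Real.exp_pos _
  have hmle : m ≤ Real.exp (-1 / ρ) := exp_neg_two_div_le_exp_neg_one_div hρ
  set d : E3 → ℝ := fun y => infDist y (frontier U)
  have hpc : Continuous fun y => hopfProfile ρ (d y) :=
    (continuous_hopfProfile ρ).comp (continuous_infDist_pt _)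
  have hdist {x y : E3} (hx : x ∈ ball y (m / 8)) : |d x - d y| < m / 8 := by
    have hlip := (lipschitz_infDist_pt (frontier U)).dist_le_mul x y
    rw [NNReal.coe_one, one_mul, Real.dist_eq] at hlip
    exact hlip.trans_lt hx
  let κ : ContDiffBump (0 : E3) := ⟨m / 16, m / 8, by positivity, by linarith⟩
  set θ : E3 → ℝ :=
    κ.normed volume ⋆[ContinuousLinearMap.lsmul ℝ ℝ, volume] fun y => hopfProfile ρ (d y)
  have hconst {y : E3} {c : ℝ} (h : ∀ x ∈ ball y (m / 8), hopfProfile ρ (d x) = c) : θ y = c := by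
    simpa using normed_convolution_mem_Icc hpc (a := c) (b := c) fun x hx => by simp [h x hx]
  have hone {y : E3} (hy : d y < 3 / 4 * m) : θ y = 1 :=
    hconst fun x hx => hopfProfile_eq_one hρ (by linarith [(abs_lt.1 (hdist hx)).2])
  refine ⟨θ, κ.hasCompactSupport_normed.contDiff_convolution_left _ κ.contDiff_normed
    hpc.locallyIntegrable,
    fun y => normed_convolution_mem_Icc hpc fun x _ => hopfProfile_mem_Icc _ _,
    fun y _ hy => hone (by linarith), fun y _ hy => hconst fun x hx =>
      hopfProfile_eq_zero hρ (by linarith [(abs_lt.1 (hdist hx)).1]), fun y _ => ?_⟩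
  by_cases hdy : d y < 3 / 4 * m
  · have hev : θ =ᶠ[𝓝 y] fun _ => 1 := by
      filter_upwards [(isOpen_lt (continuous_infDist_pt _) continuous_const).mem_nhds hdy]
        with x hx using hone hx
    rw [hev.fderiv_eq, fderiv_const_apply, norm_zero]
    exact div_nonneg (by positivity) infDist_nonneg
  · push Not at hdy
    have hgrad := norm_fderiv_normed_convolution_le (μ := volume) (κ := κ) hpc
      (show m / 8 < m / 4 by linarith) (lipschitzOnWith_hopfProfile_infDist _ hdy)
    have hd0 : 0 ≤ d y := infDist_nonneg
    have hsqrt : (1 : ℝ) ≤ Real.sqrt 3 := by rw [Real.one_le_sqrt]; norm_num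
    simp only [NNReal.coe_div, NNReal.coe_mul, NNReal.coe_ofNat,
      Real.coe_toNNReal _ infDist_nonneg] at hgrad
    calc _ ≤ ρ / (4 / 5 * d y) := hgrad
      _ = 5 / 4 * ρ / d y := by field_simp
      _ ≤ 2 * Real.sqrt 3 * ρ / d y := by gcongr; linarith

/-! ### Weak derivatives along segments -/

section Segment

variable {E : Type*} [NormedAddCommGroup E] [NormedSpace ℝ E]

theorem setIntegral_fderiv_sub_smul {η : E → ℝ} (hη : ContDiff ℝ 1 η) (x z : E) :
    ∫ s in Ioc (0 : ℝ) 1, fderiv ℝ η (x - s • z) z = η x - η (x - z) := by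
  have hderiv (s : ℝ) :
      HasDerivAt (fun s : ℝ => η (x - s • z)) (-(fderiv ℝ η (x - s • z) z)) s := by
    have hline : HasDerivAt (fun s : ℝ => x - s • z) (-z) s := by
      simpa using ((hasDerivAt_id s).smul_const z).const_sub x
    rw [← map_neg]
    exact ((hη.differentiable one_ne_zero) (x - s • z)).hasFDerivAt.comp_hasDerivAt s hline
  have hcont : Continuous fun s : ℝ => -(fderiv ℝ η (x - s • z) z) :=
    (((hη.continuous_fderiv one_ne_zero).comp (by fun_prop)).clm_apply continuous_const).neg
  have hftc := intervalIntegral.integral_eq_sub_of_hasDerivAt (a := 0) (b := 1)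
    (fun s _ => hderiv s) (hcont.intervalIntegrable _ _)
  rw [intervalIntegral.integral_of_le zero_le_one, integral_neg] at hftc
  simp only [one_smul, zero_smul, sub_zero] at hftc
  linarith

variable [MeasurableSpace E]

/-- `G` is the weak derivative of `F` in the direction `z` in the open set `U`, with respect to
the Haar measure `μ`. -/
def IsWeakLineDeriv (μ : Measure E) (U : Set E) (z : E) (F G : E → ℝ) : Prop :=
  ∀ η : E → ℝ, ContDiff ℝ ∞ η → HasCompactSupport η → tsupport η ⊆ U →
    ∫ x, F x * fderiv ℝ η x z ∂μ = - ∫ x, G x * η x ∂μ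

variable [BorelSpace E] {μ : Measure E} [μ.IsAddHaarMeasure] {U W : Set E} {z : E}
  {F G η : E → ℝ}

theorem IsWeakLineDeriv.integral_mul_fderiv_sub (h : IsWeakLineDeriv μ U z F G)
    (hη : ContDiff ℝ ∞ η) (hc : HasCompactSupport η) {v : E} (hs : ∀ x ∈ tsupport η, x + v ∈ U) :
    ∫ x, F x * fderiv ℝ η (x - v) z ∂μ = - ∫ x, η x * G (x + v) ∂μ := by
  have hsupp : tsupport (fun x => η (x - v)) ⊆ U := fun x hx => by
    have heq : tsupport (η ∘ Homeomorph.subRight v) = Homeomorph.subRight v ⁻¹' tsupport η :=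
      tsupport_comp_eq_preimage _ _
    simpa using hs _ (heq.subset hx)
  have hweak := h _ (hη.comp (by fun_prop : ContDiff ℝ ∞ fun x => x - v))
    (hc.comp_homeomorph (Homeomorph.subRight v)) hsupp
  have hfd (x : E) : fderiv ℝ (fun x => η (x - v)) x = fderiv ℝ η (x - v) := by
    simpa only [sub_eq_add_neg] using fderiv_comp_add_right (-v)
  have hshift := integral_add_right_eq_self (μ := μ) (fun x => G x * η (x - v)) v
  simp only [add_sub_cancel_right, mul_comm (G _)] at hshift
  simp only [Function.comp_def, hfd, mul_comm (G _)] at hweak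
  rw [hweak, hshift]

variable [FiniteDimensional ℝ E]

theorem integrable_comp_add_smul_prod {G : E → ℝ} (hG : Integrable G μ)
    (hGm : StronglyMeasurable G) (ν : Measure ℝ) [IsFiniteMeasure ν] (z : E) :
    Integrable (fun p : E × ℝ => G (p.1 + p.2 • z)) (μ.prod ν) := by
  have hm : AEStronglyMeasurable (fun p : E × ℝ => G (p.1 + p.2 • z)) (μ.prod ν) :=
    (hGm.comp_measurable (by fun_prop)).aestronglyMeasurable
  refine (integrable_prod_iff' hm).2 ⟨ae_of_all _ fun s => hG.comp_add_right (s • z), ?_⟩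
  have hconst (s : ℝ) : ∫ x, ‖G (x + s • z)‖ ∂μ = ∫ x, ‖G x‖ ∂μ :=
    integral_add_right_eq_self (fun x => ‖G x‖) (s • z)
  simp only [hconst]
  exact integrable_const _

theorem IsWeakLineDeriv.integral_mul_sub_comp (h : IsWeakLineDeriv μ U z F G)
    (hF : Integrable F μ) (hG : Integrable G μ) (hGm : StronglyMeasurable G)
    (hη : ContDiff ℝ ∞ η) (hc : HasCompactSupport η)
    (hs : ∀ x ∈ tsupport η, ∀ s ∈ Icc (0 : ℝ) 1, x + s • z ∈ U) :
    ∫ x, F x * (η (x - z) - η x) ∂μ =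
      ∫ x, η x * ∫ s in Ioc (0 : ℝ) 1, G (x + s • z) ∂volume ∂μ := by
  set ν : Measure ℝ := volume.restrict (Ioc 0 1)
  have hdc : Continuous fun x => fderiv ℝ η x z :=
    (hη.continuous_fderiv (by simp)).clm_apply continuous_const
  obtain ⟨M, hM⟩ := hη.continuous.bounded_above_of_compact_support hc
  obtain ⟨M', hM'⟩ := hdc.bounded_above_of_compact_support
    ((hc.fderiv ℝ).comp_left (g := fun L : E →L[ℝ] ℝ => L z) rfl)
  have hFD : Integrable (fun p : E × ℝ => F p.1 * fderiv ℝ η (p.1 - p.2 • z) z) (μ.prod ν) :=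
    (hF.comp_fst ν).mul_bdd (c := M')
      (hdc.comp (f := fun p : E × ℝ => p.1 - p.2 • z) (by fun_prop)).aestronglyMeasurable
      (ae_of_all _ fun p => hM' _)
  have hGη : Integrable (fun p : E × ℝ => η p.1 * G (p.1 + p.2 • z)) (μ.prod ν) :=
    (integrable_comp_add_smul_prod hG hGm ν z).bdd_mul
      (hη.continuous.comp continuous_fst).aestronglyMeasurable (ae_of_all _ fun p => hM p.1)
  calc ∫ x, F x * (η (x - z) - η x) ∂μ
      = ∫ x, - ∫ s, F x * fderiv ℝ η (x - s • z) z ∂ν ∂μ := by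
        congr 1 with x
        rw [integral_const_mul, setIntegral_fderiv_sub_smul (hη.of_le (by simp))]
        ring
    _ = - ∫ s, (∫ x, F x * fderiv ℝ η (x - s • z) z ∂μ) ∂ν := by
        rw [integral_neg, integral_integral_swap hFD]
    _ = - ∫ s, (- ∫ x, η x * G (x + s • z) ∂μ) ∂ν := by
        congr 1
        exact setIntegral_congr_fun measurableSet_Ioc fun s hs' =>
          h.integral_mul_fderiv_sub hη hc fun x hx => hs x hx s ⟨hs'.1.le, hs'.2⟩
    _ = ∫ x, η x * ∫ s, G (x + s • z) ∂ν ∂μ := by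
        rw [integral_neg, neg_neg, ← integral_integral_swap hGη]
        simp only [integral_const_mul]

theorem IsWeakLineDeriv.ae_sub_eq_setIntegral (h : IsWeakLineDeriv μ U z F G)
    (hF : Integrable F μ) (hG : Integrable G μ) (hGm : StronglyMeasurable G) (hW : IsOpen W)
    (hz : ∀ x ∈ W, ∀ s ∈ Icc (0 : ℝ) 1, x + s • z ∈ U) :
    ∀ᵐ x ∂μ, x ∈ W → F (x + z) - F x = ∫ s in Ioc (0 : ℝ) 1, G (x + s • z) := by
  have hI : Integrable (fun x => ∫ s in Ioc (0 : ℝ) 1, G (x + s • z)) μ :=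
    (integrable_comp_add_smul_prod hG hGm _ z).integral_prod_left
  have hFz : Integrable (fun x => F (x + z)) μ := hF.comp_add_right z
  have hzero := hW.ae_eq_zero_of_integral_contDiff_smul_eq_zero
    (f := fun x => F (x + z) - F x - ∫ s in Ioc (0 : ℝ) 1, G (x + s • z)) (μ := μ)
    (((hFz.sub hF).sub hI).locallyIntegrable.locallyIntegrableOn _) fun η hη hc hs => ?_
  · filter_upwards [hzero] with x hx hxW using sub_eq_zero.1 (hx hxW)
  obtain ⟨M, hM⟩ := hη.continuous.bounded_above_of_compact_support hc
  have hbdd {f : E → ℝ} (hf : Integrable f μ) : Integrable (fun x => η x * f x) μ :=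
    hf.bdd_mul hη.continuous.aestronglyMeasurable (ae_of_all _ hM)
  have hηz : Integrable (fun x => η (x - z) * F x) μ :=
    hF.bdd_mul (hη.continuous.comp (by fun_prop)).aestronglyMeasurable (ae_of_all _ fun x => hM _)
  have hshift : ∫ x, η x * F (x + z) ∂μ = ∫ x, η (x - z) * F x ∂μ := by
    simpa using integral_add_right_eq_self (μ := μ) (fun x => η (x - z) * F x) z
  have hswap := h.integral_mul_sub_comp hF hG hGm hη hc fun x hx => hz x (hs hx)
  simp only [smul_eq_mul, mul_sub]
  rw [integral_sub ((hbdd hFz).sub' (hbdd hF)) (hbdd hI), integral_sub (hbdd hFz) (hbdd hF),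
    hshift, ← integral_sub hηz (hbdd hF), ← hswap, sub_eq_zero]
  congr 1 with x
  ring

end Segment

/-! ### Averages over cones -/

section Holder

variable {α : Type*} [MeasurableSpace α] {μ : Measure α} {f w : α → ℝ≥0∞} {p : ℝ}

theorem lintegral_rpow_le (hf : AEMeasurable f μ) (hp : 1 < p) :
    (∫⁻ x, f x ∂μ) ^ p ≤ (∫⁻ x, f x ^ p ∂μ) * μ univ ^ (p - 1) := by
  have hpq := Real.HolderConjugate.conjExponent hp
  have hp0 : 0 < p := by linarith
  have hexp : 1 / p.conjExponent * p = p - 1 := by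
    have hinv : p.conjExponent⁻¹ = 1 - p⁻¹ := by linarith [hpq.inv_add_inv_eq_one]
    rw [one_div, hinv, sub_mul, inv_mul_cancel₀ hp0.ne', one_mul]
  have hholder := ENNReal.lintegral_mul_le_Lp_mul_Lq μ hpq hf (g := fun _ => 1) aemeasurable_const
  simp only [Pi.mul_apply, mul_one, ENNReal.one_rpow, lintegral_const, one_mul] at hholder
  have hpow := ENNReal.rpow_le_rpow hholder hp0.le
  rwa [ENNReal.mul_rpow_of_nonneg _ _ hp0.le, ← ENNReal.rpow_mul, ← ENNReal.rpow_mul,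
    one_div_mul_cancel hp0.ne', ENNReal.rpow_one, hexp] at hpow

theorem lintegral_rpow_le_of_weight (hf : Measurable f) (hw : Measurable w)
    (hw0 : ∀ᵐ x ∂μ, w x ≠ 0) (hwt : ∀ᵐ x ∂μ, w x ≠ ⊤) (hp : 1 < p) :
    (∫⁻ x, f x ∂μ) ^ p ≤ (∫⁻ x, w x ^ (1 - p) * f x ^ p ∂μ) * (∫⁻ x, w x ∂μ) ^ (p - 1) := by
  have hholder := lintegral_rpow_le (μ := μ.withDensity w) (hf.div hw).aemeasurable hp
  rw [withDensity_apply _ MeasurableSet.univ, Measure.restrict_univ,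
    lintegral_withDensity_eq_lintegral_mul _ hw (hf.div hw),
    lintegral_withDensity_eq_lintegral_mul _ hw ((hf.div hw).pow_const p)] at hholder
  convert hholder using 2
  · refine lintegral_congr_ae ?_
    filter_upwards [hw0, hwt] with x h0 ht
    exact (ENNReal.mul_div_cancel h0 ht).symm
  · refine lintegral_congr_ae ?_
    filter_upwards [hw0, hwt] with x h0 ht
    simp only [Pi.mul_apply, Pi.div_apply]
    rw [ENNReal.div_rpow_of_nonneg _ _ (by linarith), ENNReal.rpow_sub _ _ h0 ht,
      ENNReal.rpow_one, div_eq_mul_inv, div_eq_mul_inv]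
    ring

end Holder

section Cone

variable {E : Type*} [NormedAddCommGroup E] [NormedSpace ℝ E]

/-- From every point of `W ∩ U` a fixed cone of height one with base `ball z₀ r` stays in `U`. -/
def ConeOn (U W : Set E) (z₀ : E) (r : ℝ) : Prop :=
  ∀ x ∈ W ∩ U, ∀ z ∈ ball z₀ r, ∀ s ∈ Icc (0 : ℝ) 1, x + s • z ∈ U

/-- The uniform interior cone property, in local form. -/
def HasCone (U : Set E) : Prop :=
  ∀ x ∈ closure U, ∃ W, IsOpen W ∧ x ∈ W ∧ ∃ z₀ r, 0 < r ∧ ConeOn U W z₀ r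

variable [MeasurableSpace E]

/-- The integral of `H` over the section at height `s` of the cone with vertex `x` and base `B`,
the section being parametrized by the base. -/
def coneSection (μ : Measure E) (B : Set E) (H : E → ℝ≥0∞) (s : ℝ) (x : E) : ℝ≥0∞ :=
  ∫⁻ z in B, H (x + s • z) ∂μ

variable [BorelSpace E] {μ : Measure E} {B : Set E} {H : E → ℝ≥0∞} {p : ℝ}

theorem coneSection_rpow_le (hH : Measurable H) (hp : 1 < p) (s : ℝ) (x : E) :
    coneSection μ B H s x ^ p ≤ (∫⁻ z in B, H (x + s • z) ^ p ∂μ) * μ B ^ (p - 1) := by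
  rw [← Measure.restrict_apply_univ B]
  exact lintegral_rpow_le (hH.comp (by fun_prop)).aemeasurable hp

variable [FiniteDimensional ℝ E] [μ.IsAddHaarMeasure]

theorem measurable_coneSection (B : Set E) (hH : Measurable H) :
    Measurable fun q : ℝ × E => coneSection μ B H q.1 q.2 :=
  Measurable.lintegral_prod_right' (f := fun q : (ℝ × E) × E => H (q.1.2 + q.1.1 • q.2))
    (hH.comp (by fun_prop))

theorem lintegral_comp_add_smul (hH : Measurable H) {s : ℝ} (hs : 0 < s) (x : E) :
    ∫⁻ z, H (x + s • z) ∂μ =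
      ENNReal.ofReal (s⁻¹ ^ Module.finrank ℝ E) * ∫⁻ z, H z ∂μ := by
  rw [← lintegral_map (f := fun z => H (x + z)) (hH.comp (by fun_prop)) (by fun_prop),
    Measure.map_addHaar_smul _ hs.ne', lintegral_smul_measure, lintegral_add_left_eq_self H x]
  simp [abs_of_pos hs]

theorem coneSection_rpow_le_lintegral (hH : Measurable H) (hp : 1 < p) {s : ℝ} (hs : 0 < s)
    (x : E) :
    coneSection μ B H s x ^ p ≤
      ENNReal.ofReal (s⁻¹ ^ Module.finrank ℝ E) * (∫⁻ z, H z ^ p ∂μ) * μ B ^ (p - 1) := by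
  refine (coneSection_rpow_le hH hp s x).trans ?_
  gcongr
  rw [← lintegral_comp_add_smul (hH.pow_const p) hs x]
  exact setLIntegral_le_lintegral _ _

theorem lintegral_coneSection_rpow_le (hH : Measurable H) (hp : 1 < p) (s : ℝ) :
    ∫⁻ x, coneSection μ B H s x ^ p ∂μ ≤ μ B ^ p * ∫⁻ z, H z ^ p ∂μ := by
  have hm : Measurable fun q : E × E => H (q.1 + s • q.2) ^ p :=
    (hH.comp (by fun_prop)).pow_const p
  have hshift (z : E) : ∫⁻ x, H (x + s • z) ^ p ∂μ = ∫⁻ x, H x ^ p ∂μ :=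
    lintegral_add_right_eq_self (fun x => H x ^ p) (s • z)
  have hpow : μ B * μ B ^ (p - 1) = μ B ^ p := by
    rw [show p = 1 + (p - 1) by ring, ENNReal.rpow_add_of_nonneg _ _ zero_le_one (by linarith),
      ENNReal.rpow_one, add_sub_cancel_left]
  calc ∫⁻ x, coneSection μ B H s x ^ p ∂μ
      ≤ ∫⁻ x, (∫⁻ z in B, H (x + s • z) ^ p ∂μ) * μ B ^ (p - 1) ∂μ :=
        lintegral_mono fun x => coneSection_rpow_le hH hp s x
    _ = (∫⁻ z in B, ∫⁻ x, H (x + s • z) ^ p ∂μ ∂μ) * μ B ^ (p - 1) := by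
        rw [lintegral_mul_const _ (Measurable.lintegral_prod_right' hm),
          lintegral_lintegral_swap hm.aemeasurable]
    _ = μ B ^ p * ∫⁻ z, H z ^ p ∂μ := by
        simp only [hshift, lintegral_const, Measure.restrict_apply_univ]
        rw [mul_assoc, hpow, mul_comm]

theorem lintegral_coneSection_four_le (hH : Measurable H) {s : ℝ} (hs : 0 < s) :
    ∫⁻ x, coneSection μ B H s x ^ (4 : ℝ) ∂μ ≤
      ENNReal.ofReal (s⁻¹ ^ Module.finrank ℝ E) *
        (μ B ^ (3 : ℝ) * (∫⁻ z, H z ^ (2 : ℝ) ∂μ) ^ (2 : ℝ)) := by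
  set c := ENNReal.ofReal (s⁻¹ ^ Module.finrank ℝ E)
  set N := ∫⁻ z, H z ^ (2 : ℝ) ∂μ
  have hm : Measurable fun x => coneSection μ B H s x :=
    (measurable_coneSection B hH).comp (measurable_const.prodMk measurable_id)
  calc ∫⁻ x, coneSection μ B H s x ^ (4 : ℝ) ∂μ
      ≤ ∫⁻ x, (c * N * μ B ^ ((2 : ℝ) - 1)) * coneSection μ B H s x ^ (2 : ℝ) ∂μ := by
        refine lintegral_mono fun x => ?_
        rw [show (4 : ℝ) = 2 + 2 by norm_num,
          ENNReal.rpow_add_of_nonneg _ _ zero_le_two zero_le_two]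
        gcongr
        exact coneSection_rpow_le_lintegral hH one_lt_two hs x
    _ ≤ (c * N * μ B ^ ((2 : ℝ) - 1)) * (μ B ^ (2 : ℝ) * N) := by
        rw [lintegral_const_mul _ (hm.pow_const _)]
        gcongr
        exact lintegral_coneSection_rpow_le hH one_lt_two s
    _ = c * (μ B ^ (3 : ℝ) * N ^ (2 : ℝ)) := by
        rw [show (3 : ℝ) = (2 - 1) + 2 by norm_num,
          ENNReal.rpow_add_of_nonneg _ _ (by norm_num) zero_le_two, ENNReal.rpow_two N]
        ring

theorem measure_mul_le_coneSection_of_ae_le_segment {V B : Set E} (hV : MeasurableSet V)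
    (hB : MeasurableSet B) {f : E → ℝ≥0∞} (hf : Measurable f) (hH : Measurable H) {c : ℝ≥0∞}
    (hseg : ∀ z ∈ B, ∀ᵐ x ∂μ, x ∈ V →
      f x ≤ H (x + z) + c * ∫⁻ s in Ioc (0 : ℝ) 1, H (x + s • z)) :
    ∀ᵐ x ∂μ, x ∈ V →
      μ B * f x ≤ coneSection μ B H 1 x + c * ∫⁻ s in Ioc (0 : ℝ) 1, coneSection μ B H s x := by
  have hSm : Measurable fun q : E × E => ∫⁻ s in Ioc (0 : ℝ) 1, H (q.2 + s • q.1) :=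
    Measurable.lintegral_prod_right' (f := fun q : (E × E) × ℝ => H (q.1.2 + q.2 • q.1.1))
      (hH.comp (by fun_prop))
  have hmeas : MeasurableSet {q : E × E | q.1 ∈ B → q.2 ∈ V →
      f q.2 ≤ H (q.2 + q.1) + c * ∫⁻ s in Ioc (0 : ℝ) 1, H (q.2 + s • q.1)} :=
    (measurable_fst hB).imp ((measurable_snd hV).imp (measurableSet_le (hf.comp measurable_snd)
      ((hH.comp (measurable_snd.add measurable_fst)).add (hSm.const_mul _))))
  have hae : ∀ᵐ z ∂μ, ∀ᵐ x ∂μ, z ∈ B → x ∈ V →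
      f x ≤ H (x + z) + c * ∫⁻ s in Ioc (0 : ℝ) 1, H (x + s • z) := ae_of_all _ fun z => by
    by_cases hz : z ∈ B
    · filter_upwards [hseg z hz] with x hx _ using hx
    · exact ae_of_all _ fun x hz' => absurd hz' hz
  rw [Measure.ae_ae_comm hmeas] at hae
  filter_upwards [hae] with x hx hxV
  have hm1 : Measurable fun z => H (x + z) := hH.comp (by fun_prop)
  have hm2 : Measurable fun z => ∫⁻ s in Ioc (0 : ℝ) 1, H (x + s • z) :=
    hSm.comp (measurable_id.prodMk measurable_const)
  have hm3 : Measurable fun q : E × ℝ => H (x + q.2 • q.1) := hH.comp (by fun_prop)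
  calc μ B * f x = ∫⁻ _ in B, f x ∂μ := by
        rw [lintegral_const, Measure.restrict_apply_univ, mul_comm]
    _ ≤ ∫⁻ z in B, (H (x + z) + c * ∫⁻ s in Ioc (0 : ℝ) 1, H (x + s • z)) ∂μ := by
        refine lintegral_mono_ae ((ae_restrict_iff' hB).2 ?_)
        filter_upwards [hx] with z hz hzB using hz hzB hxV
    _ = _ := by
        rw [lintegral_add_left hm1, lintegral_const_mul _ hm2,
          lintegral_lintegral_swap hm3.aemeasurable]
        simp [coneSection]

end Cone

theorem clm_apply_eq_sum_single (L : E3 →L[ℝ] ℝ) (z : E3) :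
    L z = ∑ j, z j * L (EuclideanSpace.single j 1) := by
  conv_lhs => rw [← (EuclideanSpace.basisFun (Fin 3) ℝ).sum_repr z]
  simp

/-- The size of a function and its weak derivatives, extended by zero. -/
def h1Density (U : Set E3) (f : L2 U) (g : Fin 3 → L2 U) : E3 → ℝ≥0∞ :=
  U.indicator fun x => ‖f x‖ₑ + ∑ j, ‖g j x‖ₑ

section H1Density

variable {U : Set E3} {f : L2 U} {g : Fin 3 → L2 U}

theorem measurable_h1Density (hU : MeasurableSet U) (f : L2 U) (g : Fin 3 → L2 U) :
    Measurable (h1Density U f g) :=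
  ((Lp.stronglyMeasurable f).enorm.add <| Finset.measurable_fun_sum _ fun j _ =>
    (Lp.stronglyMeasurable (g j)).enorm).indicator hU

theorem enorm_indicator_le_h1Density (y : E3) : ‖U.indicator f y‖ₑ ≤ h1Density U f g y := by
  rw [enorm_indicator_eq_indicator_enorm]
  exact indicator_le_indicator le_self_add

theorem enorm_sum_mul_indicator_le_h1Density (z y : E3) :
    ‖∑ j, z j * U.indicator (g j) y‖ₑ ≤ ‖z‖ₑ * h1Density U f g y := by
  by_cases hy : y ∈ U
  · simp only [h1Density, indicator_of_mem hy]
    calc ‖∑ j, z j * g j y‖ₑ ≤ ∑ j, ‖z j‖ₑ * ‖g j y‖ₑ :=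
          (enorm_sum_le _ _).trans_eq (by simp only [enorm_mul])
      _ ≤ ∑ j, ‖z‖ₑ * ‖g j y‖ₑ := by
          gcongr with j
          exact enorm_le_iff_norm_le.2 (PiLp.norm_apply_le z j)
      _ ≤ ‖z‖ₑ * (‖f y‖ₑ + ∑ j, ‖g j y‖ₑ) := by
          rw [← Finset.mul_sum]
          gcongr
          exact le_add_self
  · simp [indicator_of_notMem hy]

theorem integrable_indicator_L2 (hU : MeasurableSet U) (hfin : volume U ≠ ⊤) (f : L2 U) :
    Integrable (U.indicator f) := by
  have : IsFiniteMeasure (volume.restrict U) := isFiniteMeasure_restrict.2 hfin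
  exact (integrable_indicator_iff hU).2 ((Lp.memLp f).integrable one_le_two)

theorem isWeakLineDeriv_indicator (hU : MeasurableSet U) (h : ∀ j, IsWeakPartial U j f (g j))
    (z : E3) :
    IsWeakLineDeriv volume U z (U.indicator f) fun x => ∑ j, z j * U.indicator (g j) x := by
  intro η hη hc hs
  have hfη (j : Fin 3) : Integrable (fun x => f x * pd j η x) (volume.restrict U) :=
    (Lp.memLp f).integrable_mul (memLp_pd_test j hη hc)
  have hgη (j : Fin 3) : Integrable (fun x => g j x * η x) (volume.restrict U) :=
    (Lp.memLp (g j)).integrable_mul (memLp_test hη.continuous hc)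
  have hleft : (fun x => U.indicator f x * fderiv ℝ η x z) =
      U.indicator fun x => ∑ j, z j * (f x * pd j η x) := by
    ext x
    by_cases hx : x ∈ U
    · simp only [indicator_of_mem hx, clm_apply_eq_sum_single _ z, Finset.mul_sum,
        mul_left_comm (f x), pd]
    · simp [indicator_of_notMem hx]
  have hright : (fun x => (∑ j, z j * U.indicator (g j) x) * η x) =
      U.indicator fun x => ∑ j, z j * (g j x * η x) := by
    ext x
    by_cases hx : x ∈ U
    · simp only [indicator_of_mem hx, Finset.sum_mul, mul_assoc]
    · simp [indicator_of_notMem hx]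
  rw [hleft, hright, integral_indicator hU, integral_indicator hU,
    integral_finsetSum _ fun j _ => (hfη j).const_mul _,
    integral_finsetSum _ fun j _ => (hgη j).const_mul _, ← Finset.sum_neg_distrib]
  simp only [integral_const_mul, h _ η hη hc hs, mul_neg]

variable {W : Set E3} {z₀ : E3} {r : ℝ}

theorem ConeOn.enorm_le_segment (hcone : ConeOn U W z₀ r) (hU : IsOpen U) (hfin : volume U ≠ ⊤)
    (hW : IsOpen W) (h : ∀ j, IsWeakPartial U j f (g j)) {z : E3} (hz : z ∈ ball z₀ r) :
    ∀ᵐ x, x ∈ W ∩ U → ‖f x‖ₑ ≤ h1Density U f g (x + z) +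
      ‖z‖ₑ * ∫⁻ s in Ioc (0 : ℝ) 1, h1Density U f g (x + s • z) := by
  have hUm := hU.measurableSet
  have hseg := (isWeakLineDeriv_indicator hUm h z).ae_sub_eq_setIntegral
    (integrable_indicator_L2 hUm hfin f)
    (integrable_finsetSum _ fun j _ => (integrable_indicator_L2 hUm hfin (g j)).const_mul _)
    (Finset.stronglyMeasurable_fun_sum _ fun j _ =>
      ((Lp.stronglyMeasurable (g j)).indicator hUm).const_mul _)
    (hW.inter hU) fun x hx s hs => hcone x hx z hz s hs
  filter_upwards [hseg] with x hx hxW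
  have hfx : f x = U.indicator f (x + z) -
      ∫ s in Ioc (0 : ℝ) 1, ∑ j, z j * U.indicator (g j) (x + s • z) := by
    rw [← hx hxW, indicator_of_mem hxW.2, sub_sub_cancel]
  have hmeas : Measurable fun s : ℝ => h1Density U f g (x + s • z) :=
    (measurable_h1Density hUm f g).comp (by fun_prop)
  rw [hfx, ← lintegral_const_mul _ hmeas]
  refine enorm_sub_le.trans (add_le_add (enorm_indicator_le_h1Density _) ?_)
  exact (enorm_integral_le_lintegral_enorm _).trans
    (lintegral_mono fun s => enorm_sum_mul_indicator_le_h1Density _ _)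

theorem ConeOn.volume_mul_enorm_le (hcone : ConeOn U W z₀ r) (hU : IsOpen U)
    (hfin : volume U ≠ ⊤) (hW : IsOpen W) (h : ∀ j, IsWeakPartial U j f (g j)) :
    ∀ᵐ x, x ∈ W ∩ U → volume (ball z₀ r) * ‖f x‖ₑ ≤
      coneSection volume (ball z₀ r) (h1Density U f g) 1 x + ENNReal.ofReal (‖z₀‖ + r) *
        ∫⁻ s in Ioc (0 : ℝ) 1, coneSection volume (ball z₀ r) (h1Density U f g) s x := by
  refine measure_mul_le_coneSection_of_ae_le_segment (hW.inter hU).measurableSet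
    measurableSet_ball (Lp.stronglyMeasurable f).enorm (measurable_h1Density hU.measurableSet f g)
    fun z hz => ?_
  have hzn : ‖z‖ₑ ≤ ENNReal.ofReal (‖z₀‖ + r) := by
    rw [← ofReal_norm]
    refine ENNReal.ofReal_le_ofReal ((norm_le_norm_add_norm_sub z₀ z).trans ?_)
    rw [mem_ball_iff_norm'] at hz
    gcongr
  filter_upwards [hcone.enorm_le_segment hU hfin hW h hz] with x hx hxW
  exact (hx hxW).trans (by gcongr)

end H1Density

/-! ### Sobolev inequalities on domains with the cone property -/

theorem lintegral_rpow_Ioc_lt_top {a : ℝ} (ha : -1 < a) :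
    ∫⁻ s in Ioc (0 : ℝ) 1, ENNReal.ofReal (s ^ a) < ⊤ := by
  have hInt := (intervalIntegrable_iff_integrableOn_Ioc_of_le zero_le_one).1
    (intervalIntegral.intervalIntegrable_rpow' (a := 0) (b := 1) ha)
  exact (lintegral_mono fun s => Real.ofReal_le_enorm _).trans_lt
    (hasFiniteIntegral_iff_enorm.1 hInt.2)

/-- The constant `∫₀¹ s^{-3/4} ds` of the cone estimates below. -/
def coneConst : ℝ≥0∞ := ∫⁻ s in Ioc (0 : ℝ) 1, ENNReal.ofReal (s ^ (-3 / 4 : ℝ))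

theorem coneConst_ne_top : coneConst ≠ ⊤ := (lintegral_rpow_Ioc_lt_top (by norm_num)).ne

section ConeEstimates

variable {B : Set E3} {H : E3 → ℝ≥0∞}

theorem lintegral_lintegral_coneSection_four_le (hH : Measurable H) :
    ∫⁻ x, (∫⁻ s in Ioc (0 : ℝ) 1, coneSection volume B H s x) ^ (4 : ℝ) ≤
      coneConst ^ (4 : ℝ) * (volume B ^ (3 : ℝ) * (∫⁻ z, H z ^ (2 : ℝ)) ^ (2 : ℝ)) := by
  set N := volume B ^ (3 : ℝ) * (∫⁻ z, H z ^ (2 : ℝ)) ^ (2 : ℝ)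
  set w : ℝ → ℝ≥0∞ := fun s => ENNReal.ofReal (s ^ (-3 / 4 : ℝ))
  have hw : Measurable w := by fun_prop
  have hw0 {s : ℝ} (hs : s ∈ Ioc (0 : ℝ) 1) : w s ≠ 0 := by
    simpa [w] using Real.rpow_pos_of_pos hs.1 _
  have hm : Measurable fun p : E3 × ℝ => coneSection volume B H p.2 p.1 :=
    (measurable_coneSection B hH).comp measurable_swap
  have hm' : Measurable fun p : E3 × ℝ =>
      w p.2 ^ (1 - 4 : ℝ) * coneSection volume B H p.2 p.1 ^ (4 : ℝ) :=
    ((hw.comp measurable_snd).pow_const _).mul (hm.pow_const _)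
  calc ∫⁻ x, (∫⁻ s in Ioc (0 : ℝ) 1, coneSection volume B H s x) ^ (4 : ℝ)
      ≤ ∫⁻ x, (∫⁻ s in Ioc (0 : ℝ) 1, w s ^ (1 - 4 : ℝ) *
          coneSection volume B H s x ^ (4 : ℝ)) * coneConst ^ (4 - 1 : ℝ) :=
        lintegral_mono fun x => lintegral_rpow_le_of_weight
          (hm.comp (measurable_const.prodMk measurable_id)) hw
          (ae_restrict_of_forall_mem measurableSet_Ioc fun s hs => hw0 hs)
          (ae_of_all _ fun s => ENNReal.ofReal_ne_top) (by norm_num)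
    _ = (∫⁻ s in Ioc (0 : ℝ) 1, ∫⁻ x, w s ^ (1 - 4 : ℝ) *
          coneSection volume B H s x ^ (4 : ℝ)) * coneConst ^ (4 - 1 : ℝ) := by
        rw [lintegral_mul_const _ (Measurable.lintegral_prod_right' hm'),
          lintegral_lintegral_swap hm'.aemeasurable]
    _ ≤ (∫⁻ s in Ioc (0 : ℝ) 1, w s * N) * coneConst ^ (4 - 1 : ℝ) := by
        gcongr ?_ * _
        refine setLIntegral_mono' measurableSet_Ioc fun s hs => ?_
        have hpow : ENNReal.ofReal (s⁻¹ ^ Module.finrank ℝ E3) = w s ^ (4 : ℝ) := by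
          rw [finrank_euclideanSpace_fin, ENNReal.ofReal_rpow_of_nonneg
            (Real.rpow_nonneg hs.1.le _) (by norm_num), ← Real.rpow_mul hs.1.le,
            ← Real.rpow_natCast, Real.inv_rpow hs.1.le,
            ← Real.rpow_neg hs.1.le]
          norm_num
        have hms : Measurable fun x => coneSection volume B H s x :=
          hm.comp (measurable_id.prodMk measurable_const)
        rw [lintegral_const_mul _ (hms.pow_const _)]
        refine (mul_le_mul_right (lintegral_coneSection_four_le hH hs.1) _).trans_eq ?_
        rw [hpow, ← mul_assoc, ← ENNReal.rpow_add _ _ (hw0 hs) ENNReal.ofReal_ne_top,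
          sub_add_cancel, ENNReal.rpow_one]
    _ = coneConst ^ (4 : ℝ) * N := by
        have hadd : coneConst ^ (4 : ℝ) = coneConst * coneConst ^ (4 - 1 : ℝ) := by
          nth_rw 2 [← ENNReal.rpow_one coneConst]
          rw [← ENNReal.rpow_add_of_nonneg _ _ zero_le_one (by norm_num), add_sub_cancel]
        rw [lintegral_mul_const _ hw, hadd, mul_right_comm]
        rfl

theorem coneSection_le_lintegral_four (hH : Measurable H) {s : ℝ} (hs : 0 < s) (x : E3) :
    coneSection volume B H s x ≤ ENNReal.ofReal (s ^ (-3 / 4 : ℝ)) *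
      ((∫⁻ z, H z ^ (4 : ℝ)) ^ (1 / 4 : ℝ) * volume B ^ (3 / 4 : ℝ)) := by
  have hpow := ENNReal.rpow_le_rpow (z := 1 / 4)
    (coneSection_rpow_le_lintegral (μ := volume) (B := B) hH (p := 4) (by norm_num) hs x)
    (by norm_num)
  have hs4 : (s⁻¹ ^ 3) ^ (1 / 4 : ℝ) = s ^ (-3 / 4 : ℝ) := by
    rw [← Real.rpow_natCast, ← Real.rpow_mul (by positivity), Real.inv_rpow hs.le,
      ← Real.rpow_neg hs.le]
    norm_num
  rw [← ENNReal.rpow_mul, ENNReal.mul_rpow_of_nonneg _ _ (by norm_num),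
    ENNReal.mul_rpow_of_nonneg _ _ (by norm_num), ← ENNReal.rpow_mul, finrank_euclideanSpace_fin,
    ENNReal.ofReal_rpow_of_nonneg (by positivity) (by norm_num), hs4,
    mul_one_div_cancel (by norm_num), ENNReal.rpow_one, mul_assoc] at hpow
  convert hpow using 4
  norm_num

end ConeEstimates

theorem lintegral_add_rpow_le {α : Type*} [MeasurableSpace α] {μ : Measure α} {f g : α → ℝ≥0∞}
    (hf : Measurable f) {p : ℝ} (hp : 1 ≤ p) :
    ∫⁻ x, (f x + g x) ^ p ∂μ ≤ 2 ^ (p - 1) * (∫⁻ x, f x ^ p ∂μ + ∫⁻ x, g x ^ p ∂μ) := by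
  rw [← lintegral_add_left (hf.pow_const p), ← lintegral_const_mul' _ _ (by finiteness)]
  exact lintegral_mono fun x => ENNReal.rpow_add_le_mul_rpow_add_rpow _ _ hp

section ConeSobolev

variable {U W : Set E3} {z₀ : E3} {r : ℝ}

theorem ConeOn.lintegral_four_le (hcone : ConeOn U W z₀ r) (hr : 0 < r) (hU : IsOpen U)
    (hfin : volume U ≠ ⊤) (hW : IsOpen W) :
    ∃ C : ℝ≥0∞, C ≠ ⊤ ∧ ∀ (f : L2 U) (g : Fin 3 → L2 U), (∀ j, IsWeakPartial U j f (g j)) →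
      ∫⁻ x in W ∩ U, ‖f x‖ₑ ^ (4 : ℝ) ≤ C * (∫⁻ z, h1Density U f g z ^ (2 : ℝ)) ^ (2 : ℝ) := by
  set V := volume (ball z₀ r)
  have hVt : V ≠ ⊤ := measure_ball_lt_top.ne
  have hV4 : V ^ (4 : ℝ) ≠ 0 :=
    (ENNReal.rpow_pos (measure_ball_pos volume z₀ hr) hVt).ne'
  have hV4t : V ^ (4 : ℝ) ≠ ⊤ := by finiteness
  set K := ENNReal.ofReal (‖z₀‖ + r)
  have hc := coneConst_ne_top
  refine ⟨(V ^ (4 : ℝ))⁻¹ * ((2 : ℝ≥0∞) ^ (4 - 1 : ℝ) *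
    (V ^ (3 : ℝ) + K ^ (4 : ℝ) * (coneConst ^ (4 : ℝ) * V ^ (3 : ℝ)))),
    by finiteness, fun f g h => ?_⟩
  set S := coneSection volume (ball z₀ r) (h1Density U f g)
  set N := ∫⁻ z, h1Density U f g z ^ (2 : ℝ)
  have hH := measurable_h1Density hU.measurableSet f g
  have hS : Measurable fun p : ℝ × E3 => S p.1 p.2 := measurable_coneSection _ hH
  have hS1 : ∫⁻ x, S 1 x ^ (4 : ℝ) ≤ V ^ (3 : ℝ) * N ^ (2 : ℝ) := by
    have := lintegral_coneSection_four_le (μ := volume) (B := ball z₀ r) hH one_pos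
    rwa [inv_one, one_pow, ENNReal.ofReal_one, one_mul] at this
  rw [mul_assoc, ← ENNReal.mul_le_iff_le_inv hV4 hV4t,
    ← lintegral_const_mul _ ((Lp.stronglyMeasurable f).enorm.pow_const _)]
  calc ∫⁻ x in W ∩ U, V ^ (4 : ℝ) * ‖f x‖ₑ ^ (4 : ℝ)
      ≤ ∫⁻ x in W ∩ U, (S 1 x + K * ∫⁻ s in Ioc (0 : ℝ) 1, S s x) ^ (4 : ℝ) := by
        refine lintegral_mono_ae ((ae_restrict_iff' (hW.inter hU).measurableSet).2 ?_)
        filter_upwards [hcone.volume_mul_enorm_le hU hfin hW h] with x hx hxW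
        rw [← ENNReal.mul_rpow_of_nonneg _ _ (by norm_num)]
        exact ENNReal.rpow_le_rpow (hx hxW) (by norm_num)
    _ ≤ ∫⁻ x, (S 1 x + K * ∫⁻ s in Ioc (0 : ℝ) 1, S s x) ^ (4 : ℝ) :=
        setLIntegral_le_lintegral _ _
    _ ≤ 2 ^ (4 - 1 : ℝ) * ((∫⁻ x, S 1 x ^ (4 : ℝ)) +
          ∫⁻ x, (K * ∫⁻ s in Ioc (0 : ℝ) 1, S s x) ^ (4 : ℝ)) :=
        lintegral_add_rpow_le (f := S 1) (hS.comp (measurable_const.prodMk measurable_id))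
          (by norm_num)
    _ ≤ 2 ^ (4 - 1 : ℝ) * (V ^ (3 : ℝ) * N ^ (2 : ℝ) +
          K ^ (4 : ℝ) * (coneConst ^ (4 : ℝ) * (V ^ (3 : ℝ) * N ^ (2 : ℝ)))) := by
        simp only [ENNReal.mul_rpow_of_nonneg _ _ (show (0 : ℝ) ≤ 4 by norm_num)]
        rw [lintegral_const_mul' _ _ (by finiteness)]
        exact mul_le_mul' le_rfl (add_le_add hS1
          (mul_le_mul' le_rfl (lintegral_lintegral_coneSection_four_le hH)))
    _ = _ := by ring

theorem ConeOn.enorm_le (hcone : ConeOn U W z₀ r) (hr : 0 < r) (hU : IsOpen U)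
    (hfin : volume U ≠ ⊤) (hW : IsOpen W) :
    ∃ C : ℝ≥0∞, C ≠ ⊤ ∧ ∀ (f : L2 U) (g : Fin 3 → L2 U), (∀ j, IsWeakPartial U j f (g j)) →
      ∀ᵐ x, x ∈ W ∩ U → ‖f x‖ₑ ≤ C * (∫⁻ z, h1Density U f g z ^ (4 : ℝ)) ^ (1 / 4 : ℝ) := by
  set V := volume (ball z₀ r)
  have hV0 : V ≠ 0 := (measure_ball_pos volume z₀ hr).ne'
  have hVt : V ≠ ⊤ := measure_ball_lt_top.ne
  set K := ENNReal.ofReal (‖z₀‖ + r)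
  have hc := coneConst_ne_top
  refine ⟨V⁻¹ * (V ^ (3 / 4 : ℝ) * (1 + K * coneConst)), by finiteness, fun f g h => ?_⟩
  have hH := measurable_h1Density hU.measurableSet f g
  set N := (∫⁻ z, h1Density U f g z ^ (4 : ℝ)) ^ (1 / 4 : ℝ)
  filter_upwards [hcone.volume_mul_enorm_le hU hfin hW h] with x hx hxW
  have hbase : coneSection volume (ball z₀ r) (h1Density U f g) 1 x ≤ N * V ^ (3 / 4 : ℝ) := by
    have := coneSection_le_lintegral_four (B := ball z₀ r) hH one_pos x
    rwa [Real.one_rpow, ENNReal.ofReal_one, one_mul] at this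
  have hInt : ∫⁻ s in Ioc (0 : ℝ) 1, coneSection volume (ball z₀ r) (h1Density U f g) s x ≤
      coneConst * (N * V ^ (3 / 4 : ℝ)) := by
    rw [coneConst, ← lintegral_mul_const _ (by fun_prop)]
    exact setLIntegral_mono' measurableSet_Ioc fun s hs => coneSection_le_lintegral_four hH hs.1 x
  rw [mul_assoc, ← ENNReal.mul_le_iff_le_inv hV0 hVt]
  calc V * ‖f x‖ₑ ≤ N * V ^ (3 / 4 : ℝ) + K * (coneConst * (N * V ^ (3 / 4 : ℝ))) :=
        (hx hxW).trans (by gcongr)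
    _ = _ := by ring

theorem HasCone.lintegral_four_le (hc : HasCone U) (hU : IsOpen U) (hb : Bornology.IsBounded U) :
    ∃ C : ℝ≥0∞, C ≠ ⊤ ∧ ∀ (f : L2 U) (g : Fin 3 → L2 U), (∀ j, IsWeakPartial U j f (g j)) →
      ∫⁻ x in U, ‖f x‖ₑ ^ (4 : ℝ) ≤ C * (∫⁻ z, h1Density U f g z ^ (2 : ℝ)) ^ (2 : ℝ) := by
  suffices h : ∃ C : ℝ≥0∞, C ≠ ⊤ ∧ ∀ (f : L2 U) (g : Fin 3 → L2 U),
      (∀ j, IsWeakPartial U j f (g j)) → ∫⁻ x in closure U ∩ U, ‖f x‖ₑ ^ (4 : ℝ) ≤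
        C * (∫⁻ z, h1Density U f g z ^ (2 : ℝ)) ^ (2 : ℝ) by
    rwa [inter_eq_right.2 subset_closure] at h
  refine hb.isCompact_closure.induction_on (p := fun S => ∃ C : ℝ≥0∞, C ≠ ⊤ ∧
    ∀ (f : L2 U) (g : Fin 3 → L2 U), (∀ j, IsWeakPartial U j f (g j)) →
    ∫⁻ x in S ∩ U, ‖f x‖ₑ ^ (4 : ℝ) ≤ C * (∫⁻ z, h1Density U f g z ^ (2 : ℝ)) ^ (2 : ℝ))
    ⟨0, by simp, by simp⟩ ?_ ?_ ?_
  · rintro s t hst ⟨C, hC, h⟩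
    exact ⟨C, hC, fun f g hfg => (lintegral_mono_set (inter_subset_inter_left U hst)).trans
      (h f g hfg)⟩
  · rintro s t ⟨C, hC, h⟩ ⟨C', hC', h'⟩
    refine ⟨C + C', by finiteness, fun f g hfg => ?_⟩
    rw [union_inter_distrib_right, add_mul]
    exact (lintegral_union_le _ _ _).trans (add_le_add (h f g hfg) (h' f g hfg))
  · intro x hx
    obtain ⟨W, hW, hxW, z₀, r, hr, hcone⟩ := hc x hx
    exact ⟨W, mem_nhdsWithin_of_mem_nhds (hW.mem_nhds hxW),
      hcone.lintegral_four_le hr hU hb.measure_lt_top.ne hW⟩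

theorem HasCone.enorm_le (hc : HasCone U) (hU : IsOpen U) (hb : Bornology.IsBounded U) :
    ∃ C : ℝ≥0∞, C ≠ ⊤ ∧ ∀ (f : L2 U) (g : Fin 3 → L2 U), (∀ j, IsWeakPartial U j f (g j)) →
      ∀ᵐ x, x ∈ U → ‖f x‖ₑ ≤ C * (∫⁻ z, h1Density U f g z ^ (4 : ℝ)) ^ (1 / 4 : ℝ) := by
  suffices h : ∃ C : ℝ≥0∞, C ≠ ⊤ ∧ ∀ (f : L2 U) (g : Fin 3 → L2 U),
      (∀ j, IsWeakPartial U j f (g j)) → ∀ᵐ x, x ∈ closure U ∩ U → ‖f x‖ₑ ≤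
        C * (∫⁻ z, h1Density U f g z ^ (4 : ℝ)) ^ (1 / 4 : ℝ) by
    rwa [inter_eq_right.2 subset_closure] at h
  refine hb.isCompact_closure.induction_on (p := fun S => ∃ C : ℝ≥0∞, C ≠ ⊤ ∧
    ∀ (f : L2 U) (g : Fin 3 → L2 U), (∀ j, IsWeakPartial U j f (g j)) →
    ∀ᵐ x, x ∈ S ∩ U → ‖f x‖ₑ ≤ C * (∫⁻ z, h1Density U f g z ^ (4 : ℝ)) ^ (1 / 4 : ℝ))
    ⟨0, by simp, by simp⟩ ?_ ?_ ?_
  · rintro s t hst ⟨C, hC, h⟩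
    refine ⟨C, hC, fun f g hfg => ?_⟩
    filter_upwards [h f g hfg] with x hx hxs using hx ⟨hst hxs.1, hxs.2⟩
  · rintro s t ⟨C, hC, h⟩ ⟨C', hC', h'⟩
    refine ⟨C + C', by finiteness, fun f g hfg => ?_⟩
    filter_upwards [h f g hfg, h' f g hfg] with x hx hx' hxs
    rw [add_mul]
    rcases hxs.1 with hs | ht
    · exact (hx ⟨hs, hxs.2⟩).trans le_self_add
    · exact (hx' ⟨ht, hxs.2⟩).trans le_add_self
  · intro x hx
    obtain ⟨W, hW, hxW, z₀, r, hr, hcone⟩ := hc x hx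
    exact ⟨W, mem_nhdsWithin_of_mem_nhds (hW.mem_nhds hxW),
      hcone.enorm_le hr hU hb.measure_lt_top.ne hW⟩

end ConeSobolev

/-! ### Local defining functions of the boundary -/

theorem exists_first_exit {E : Type*} [AddCommGroup E] [TopologicalSpace E]
    [ContinuousAdd E] [Module ℝ E] [ContinuousSMul ℝ E] {U : Set E} (hU : IsOpen U) {x v : E}
    (hx : x ∈ U) (hv : x + v ∉ U) :
    ∃ s ∈ Ioc (0 : ℝ) 1, x + s • v ∈ frontier U ∧ ∀ s' ∈ Ico 0 s, x + s' • v ∈ U := by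
  have hexits : IsCompact (Icc (0 : ℝ) 1 ∩ (fun s : ℝ => x + s • v) ⁻¹' Uᶜ) :=
    isCompact_Icc.inter_right (hU.isClosed_compl.preimage (by fun_prop))
  obtain ⟨s, ⟨hs, hsU⟩, hleast⟩ := hexits.exists_isLeast ⟨1, by simp, by simpa using hv⟩
  have hs0 : 0 < s := hs.1.lt_of_ne fun h0 => hsU (by simpa [← h0] using hx)
  have hin : ∀ s' ∈ Ico 0 s, x + s' • v ∈ U := fun s' hs' => by
    by_contra hout
    exact hs'.2.not_ge (hleast ⟨⟨hs'.1, hs'.2.le.trans hs.2⟩, hout⟩)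
  refine ⟨s, ⟨hs0, hs.2⟩, ?_, hin⟩
  have hmem : s ∈ closure (Ico 0 s) := by
    rw [closure_Ico hs0.ne]
    exact right_mem_Icc.2 hs0.le
  rw [hU.frontier_eq]
  exact ⟨ContinuousWithinAt.mem_closure (f := fun s : ℝ => x + s • v) (by fun_prop) hmem hin, hsU⟩

section LocalDefining

variable {E : Type*} [NormedAddCommGroup E] [NormedSpace ℝ E] {U : Set E} {y₀ : E}

theorem norm_smul_le_of_mem_Icc {s : ℝ} (hs : s ∈ Icc (0 : ℝ) 1) (z : E) : ‖s • z‖ ≤ ‖z‖ := by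
  rw [norm_smul, Real.norm_of_nonneg hs.1]
  exact mul_le_of_le_one_left (norm_nonneg z) hs.2

theorem add_smul_mem_ball {x z : E} {r r' s : ℝ} (hx : x ∈ ball y₀ r) (hz : ‖z‖ ≤ r')
    (hs : s ∈ Icc (0 : ℝ) 1) : x + s • z ∈ ball y₀ (r + r') := by
  rw [mem_ball_iff_norm] at hx ⊢
  calc ‖x + s • z - y₀‖ ≤ ‖x - y₀‖ + ‖s • z‖ := by
        rw [add_sub_right_comm]
        exact norm_add_le _ _
    _ < r + r' := add_lt_add_of_lt_of_le hx ((norm_smul_le_of_mem_Icc hs z).trans hz)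

variable (U y₀) in
/-- A local defining function `h` of `U` near `y₀`, normalized so that it grows at least at unit
rate in the direction `z₀`. It is required to be differentiable in the interior only. -/
structure LocalDefining where
  R : ℝ
  R_pos : 0 < R
  h : E → ℝ
  z₀ : E
  C : ℝ≥0
  continuousOn : ContinuousOn h (closure U ∩ ball y₀ R)
  contDiffAt : ∀ y ∈ U ∩ ball y₀ R, ContDiffAt ℝ 1 h y
  pos : ∀ y ∈ U ∩ ball y₀ R, 0 < h y
  eq_zero : ∀ y ∈ frontier U ∩ ball y₀ R, h y = 0
  norm_fderiv_le : ∀ y ∈ U ∩ ball y₀ R, ‖fderiv ℝ h y‖ ≤ C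
  one_le_fderiv : ∀ y ∈ U ∩ ball y₀ R, 1 ≤ fderiv ℝ h y z₀

namespace LocalDefining

variable (P : LocalDefining U y₀)

theorem le_of_exit (hU : IsOpen U) {x v : E} (hx : x ∈ U) (hv : x + v ∉ U)
    (hball : ∀ s ∈ Icc (0 : ℝ) 1, x + s • v ∈ ball y₀ P.R) {a : ℝ} (ha : 0 ≤ a)
    (hder : ∀ y ∈ U ∩ ball y₀ P.R, -a ≤ fderiv ℝ P.h y v) : P.h x ≤ a := by
  obtain ⟨s, hs, hexit, hin⟩ := exists_first_exit hU hx hv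
  have hmem : ∀ s' ∈ Icc 0 s, x + s' • v ∈ ball y₀ P.R := fun s' hs' =>
    hball s' ⟨hs'.1, hs'.2.trans hs.2⟩
  have hderiv : ∀ s' ∈ Ico 0 s, HasDerivAt (fun s : ℝ => P.h (x + s • v))
      (fderiv ℝ P.h (x + s' • v) v) s' := fun s' hs' => by
    have hline : HasDerivAt (fun s : ℝ => x + s • v) v s' := by
      simpa using ((hasDerivAt_id s').smul_const v).const_add x
    exact ((P.contDiffAt _ ⟨hin s' hs', hmem s' ⟨hs'.1, hs'.2.le⟩⟩).differentiableAt
      one_ne_zero).hasFDerivAt.comp_hasDerivAt s' hline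
  have hcont : ContinuousOn (fun s : ℝ => P.h (x + s • v)) (Icc 0 s) :=
    P.continuousOn.comp (by fun_prop) fun s' hs' => ⟨hs'.2.eq_or_lt.elim
      (fun h => h ▸ frontier_subset_closure hexit)
      (fun h => subset_closure (hin s' ⟨hs'.1, h⟩)), hmem s' hs'⟩
  have hmvt := (convex_Icc 0 s).mul_sub_le_image_sub_of_le_deriv hcont (C := -a)
    (fun s' hs' => by
      rw [interior_Icc] at hs'
      exact (hderiv s' (Ioo_subset_Ico_self hs')).differentiableAt.differentiableWithinAt)
    (fun s' hs' => by
      rw [interior_Icc] at hs'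
      have hs'' := Ioo_subset_Ico_self hs'
      rw [(hderiv s' hs'').deriv]
      exact hder _ ⟨hin s' hs'', hmem s' (Ico_subset_Icc_self hs'')⟩)
    0 (left_mem_Icc.2 hs.1.le) s (right_mem_Icc.2 hs.1.le) hs.1.le
  rw [P.eq_zero _ ⟨hexit, hmem s (right_mem_Icc.2 hs.1.le)⟩, zero_smul, add_zero] at hmvt
  linarith [mul_le_of_le_one_right ha hs.2]

theorem fderiv_nonneg {y : E} (hy : y ∈ U ∩ ball y₀ P.R) {l : ℝ} (hl : 0 ≤ l) {z : E}
    (hz : P.C * ‖z - l • P.z₀‖ ≤ l) : 0 ≤ fderiv ℝ P.h y z := by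
  have hsplit : fderiv ℝ P.h y z = l * fderiv ℝ P.h y P.z₀ + fderiv ℝ P.h y (z - l • P.z₀) := by
    rw [map_sub, map_smul, smul_eq_mul, add_sub_cancel]
  have herr := ((fderiv ℝ P.h y).le_of_opNorm_le (P.norm_fderiv_le y hy) _).trans hz
  rw [hsplit]
  linarith [neg_le_of_abs_le herr, mul_le_mul_of_nonneg_left (P.one_le_fderiv y hy) hl]

theorem exists_coneOn (hU : IsOpen U) :
    ∃ z₀ r, 0 < r ∧ ConeOn U (ball y₀ (P.R / 2)) z₀ r := by
  have hR := P.R_pos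
  set r : ℝ := 1 / (P.C + 1)
  have hr0 : 0 < r := by positivity
  have hrC : P.C * r ≤ 1 := by
    rw [mul_one_div, div_le_one (by positivity)]
    linarith
  set l : ℝ := P.R / 2 / (‖P.z₀‖ + r)
  have hl0 : 0 < l := by positivity
  have hl : l * ‖P.z₀‖ + l * r = P.R / 2 := by
    rw [← mul_add, div_mul_cancel₀]
    positivity
  refine ⟨l • P.z₀, l * r, mul_pos hl0 hr0, fun x hx z hz s hs => ?_⟩
  rw [mem_ball_iff_norm] at hz
  have hzR : ‖z‖ ≤ P.R / 2 := by
    have := norm_le_norm_add_norm_sub' z (l • P.z₀)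
    rw [norm_smul, Real.norm_of_nonneg hl0.le] at this
    linarith
  have hzC : P.C * ‖z - l • P.z₀‖ ≤ l := by
    calc P.C * ‖z - l • P.z₀‖ ≤ P.C * (l * r) := by gcongr
      _ = l * (P.C * r) := mul_left_comm _ _ _
      _ ≤ l := mul_le_of_le_one_right hl0.le hrC
  by_contra hout
  refine (P.pos x ⟨hx.2, ball_subset_ball (by linarith) hx.1⟩).not_ge
    (P.le_of_exit hU hx.2 hout (fun s' hs' => ?_) le_rfl fun y hy => ?_)
  · rw [← add_halves P.R]
    exact add_smul_mem_ball hx.1 ((norm_smul_le_of_mem_Icc hs z).trans hzR) hs'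
  · rw [map_smul, neg_zero]
    exact mul_nonneg hs.1 (P.fderiv_nonneg hy hl0.le hzC)

theorem le_mul_infDist [ProperSpace E] (hU : IsOpen U) (hy₀ : y₀ ∈ frontier U) {y : E}
    (hy : y ∈ U ∩ ball y₀ (P.R / 2)) : P.h y ≤ P.C * infDist y (frontier U) := by
  obtain ⟨y', hy', hd⟩ := isClosed_frontier.exists_infDist_eq_dist ⟨y₀, hy₀⟩ y
  have hy'U : y' ∉ U := by
    rw [hU.frontier_eq] at hy'
    exact hy'.2
  have hdist : ‖y' - y‖ = infDist y (frontier U) := by rw [hd, dist_eq_norm_sub']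
  rw [← hdist]
  refine P.le_of_exit hU hy.1 (by simpa using hy'U) (fun s hs => ?_) (by positivity) fun z hz =>
    neg_le_of_abs_le ((fderiv ℝ P.h z).le_of_opNorm_le (P.norm_fderiv_le z hz) _)
  rw [← add_halves P.R]
  exact add_smul_mem_ball hy.2 (hdist.trans_le ((infDist_le_dist_of_mem hy₀).trans hy.2.le)) hs

end LocalDefining

theorem coneOn_zero_of_ball_subset {x : E} {r : ℝ} (h : ball x r ⊆ U) :
    ConeOn U (ball x (r / 2)) 0 (r / 2) := fun _ hy _ hz _ hs =>
  h (add_halves r ▸ add_smul_mem_ball hy.1 (mem_ball_zero_iff.1 hz).le hs)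

theorem hasCone_of_localDefining (hU : IsOpen U)
    (hP : ∀ y ∈ frontier U, Nonempty (LocalDefining U y)) : HasCone U := by
  intro x hx
  by_cases hxU : x ∈ U
  · obtain ⟨r, hr, hball⟩ := Metric.isOpen_iff.1 hU x hxU
    exact ⟨ball x (r / 2), isOpen_ball, mem_ball_self (by positivity), 0, r / 2, by positivity,
      coneOn_zero_of_ball_subset hball⟩
  · obtain ⟨P⟩ := hP x (hU.frontier_eq ▸ ⟨hx, hxU⟩)
    obtain ⟨z₀, r, hr, hcone⟩ := P.exists_coneOn hU
    exact ⟨ball x (P.R / 2), isOpen_ball, mem_ball_self (half_pos P.R_pos), z₀, r, hr, hcone⟩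

end LocalDefining

/-! ### Hardy's inequality -/

section IntegrableSq

variable {X F : Type*} [TopologicalSpace X] [MeasurableSpace X] [OpensMeasurableSpace X]
  {μ : Measure X} [IsFiniteMeasureOnCompacts μ] [NormedAddCommGroup F] {f : X → F}

theorem integrable_norm_sq_of_hasCompactSupport (hf : Continuous f) (hc : HasCompactSupport f) :
    Integrable (fun y => ‖f y‖ ^ 2) μ :=
  Continuous.integrable_of_hasCompactSupport (by fun_prop)
    (hc.comp_left (g := fun x => ‖x‖ ^ 2) (by simp))

theorem lintegral_enorm_rpow_two_eq (hf : Continuous f) (hc : HasCompactSupport f) :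
    ∫⁻ y, ‖f y‖ₑ ^ (2 : ℝ) ∂μ = ENNReal.ofReal (∫ y, ‖f y‖ ^ 2 ∂μ) := by
  rw [ofReal_integral_eq_lintegral_ofReal (integrable_norm_sq_of_hasCompactSupport hf hc)
    (ae_of_all _ fun y => by positivity)]
  refine lintegral_congr fun y => ?_
  rw [ENNReal.rpow_two, ENNReal.ofReal_pow (norm_nonneg _), ofReal_norm]

end IntegrableSq

theorem infDist_frontier_pos {X : Type*} [PseudoMetricSpace X] {U : Set X} (hU : IsOpen U)
    (hfr : (frontier U).Nonempty) {y : X} (hy : y ∈ U) : 0 < infDist y (frontier U) :=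
  (isClosed_frontier.notMem_iff_infDist_pos hfr).1 fun h => (hU.frontier_eq ▸ h).2 hy

theorem setLIntegral_div_rpow_two_le {X : Type*} [MeasurableSpace X] {μ : Measure X} {S : Set X}
    (hS : MeasurableSet S) {u v d h : X → ℝ} {C : ℝ≥0}
    (huv : ∀ y ∈ S, u y = v y) (hpos : ∀ y ∈ S, 0 < h y) (hle : ∀ y ∈ S, h y ≤ C * d y) :
    ∫⁻ y in S, ‖u y / d y‖ₑ ^ (2 : ℝ) ∂μ ≤ C ^ (2 : ℝ) * ∫⁻ y, ‖v y / h y‖ₑ ^ (2 : ℝ) ∂μ := by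
  rw [← lintegral_const_mul' _ _ (by finiteness)]
  refine (setLIntegral_mono' hS fun y hy => ?_).trans (setLIntegral_le_lintegral S _)
  rw [← ENNReal.mul_rpow_of_nonneg _ _ zero_le_two, huv y hy]
  gcongr
  have hd : 0 < d y := pos_of_mul_pos_right ((hpos y hy).trans_le (hle y hy)) C.2
  have hnorm : ‖v y / d y‖ ≤ C * ‖v y / h y‖ := by
    rw [norm_div, norm_div, Real.norm_of_nonneg hd.le, Real.norm_of_nonneg (hpos y hy).le,
      mul_div_assoc', div_le_div_iff₀ hd (hpos y hy), mul_comm (C : ℝ), mul_assoc]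
    exact mul_le_mul_of_nonneg_left (hle y hy) (norm_nonneg _)
  simp only [enorm_eq_nnnorm]
  exact_mod_cast hnorm

section Hardy

variable {E : Type*} [NormedAddCommGroup E] [NormedSpace ℝ E] {U : Set E} {y₀ : E}

theorem contDiff_of_contDiffAt_tsupport {F : Type*} [NormedAddCommGroup F] [NormedSpace ℝ F]
    {f : E → F} {n : WithTop ℕ∞} (h : ∀ y ∈ tsupport f, ContDiffAt ℝ n f y) : ContDiff ℝ n f := by
  refine contDiff_iff_contDiffAt.2 fun y => ?_
  by_cases hy : y ∈ tsupport f
  · exact h y hy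
  · exact contDiffAt_const.congr_of_eventuallyEq (notMem_tsupport_iff_eventuallyEq.1 hy)

theorem contDiff_div_of_tsupport {v h : E → ℝ} {n : WithTop ℕ∞} (hv : ContDiff ℝ n v)
    (hh : ∀ y ∈ tsupport v, ContDiffAt ℝ n h y) (h0 : ∀ y ∈ tsupport v, h y ≠ 0) :
    ContDiff ℝ n fun y => v y / h y :=
  contDiff_of_contDiffAt_tsupport fun y hy =>
    have hy' : y ∈ tsupport v := by
      simp only [div_eq_mul_inv] at hy
      exact tsupport_mul_subset_left hy
    hv.contDiffAt.div (hh y hy') (h0 y hy')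

theorem fderiv_sq_div_apply {v h : E → ℝ} {y : E} (hv : DifferentiableAt ℝ v y)
    (hh : DifferentiableAt ℝ h y) (h0 : h y ≠ 0) (z : E) :
    fderiv ℝ (fun y => v y ^ 2 / h y) y z =
      2 * (v y / h y) * fderiv ℝ v y z - (v y / h y) ^ 2 * fderiv ℝ h y z := by
  have hdiv : HasLineDerivAt ℝ (fun y => v y ^ 2 / h y) _ y z :=
    (HasDerivAt.fun_pow (hv.hasFDerivAt.hasLineDerivAt z) 2).fun_div
      (hh.hasFDerivAt.hasLineDerivAt z) (by simpa using h0)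
  have hdiff : DifferentiableAt ℝ (fun y => v y ^ 2 / h y) y := by
    simpa only [div_eq_mul_inv] using (hv.fun_pow 2).fun_mul (hh.fun_inv h0)
  rw [← hdiff.lineDeriv_eq_fderiv, hdiv.lineDeriv]
  simp only [zero_smul, add_zero]
  field_simp
  push_cast
  ring

theorem LocalDefining.sq_div_le (P : LocalDefining U y₀) {v : E → ℝ} (hv : ContDiff ℝ 1 v)
    (hs : tsupport v ⊆ U ∩ ball y₀ P.R) (y : E) :
    ‖v y / P.h y‖ ^ 2 ≤
      4 * ‖fderiv ℝ v y P.z₀‖ ^ 2 - 2 * fderiv ℝ (fun y => v y ^ 2 / P.h y) y P.z₀ := by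
  simp only [Real.norm_eq_abs, sq_abs]
  by_cases hy : y ∈ tsupport v
  · rw [fderiv_sq_div_apply (hv.differentiable one_ne_zero y)
      ((P.contDiffAt y (hs hy)).differentiableAt one_ne_zero) (P.pos y (hs hy)).ne']
    nlinarith [sq_nonneg (v y / P.h y - 2 * fderiv ℝ v y P.z₀),
      mul_le_mul_of_nonneg_left (P.one_le_fderiv y (hs hy)) (sq_nonneg (v y / P.h y))]
  · have hv0 := notMem_tsupport_iff_eventuallyEq.1 hy
    have hq0 : (fun y => v y ^ 2 / P.h y) =ᶠ[𝓝 y] 0 := by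
      filter_upwards [hv0] with x hx
      simp [hx]
    simp [hq0.fderiv_eq, hv0.self_of_nhds, sq_nonneg]

theorem exists_bump_fderiv_bound [FiniteDimensional ℝ E] (y₀ : E) {r : ℝ} (hr : 0 < r) :
    ∃ (χ : E → ℝ) (M : ℝ≥0), ContDiff ℝ 1 χ ∧ tsupport χ ⊆ ball y₀ r ∧
      (∀ y ∈ ball y₀ (r / 2), χ y = 1) ∧ (∀ y, ‖χ y‖ ≤ 1) ∧ ∀ y, ‖fderiv ℝ χ y‖ ≤ M := by
  let χ : ContDiffBump y₀ := ⟨r / 2, 3 * r / 4, by positivity, by linarith⟩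
  obtain ⟨M, hM⟩ := (χ.contDiff (n := 1)).continuous_fderiv one_ne_zero
    |>.bounded_above_of_compact_support (χ.hasCompactSupport.fderiv ℝ)
  refine ⟨χ, ⟨M, (norm_nonneg _).trans (hM y₀)⟩, χ.contDiff, ?_,
    fun y hy => χ.one_of_mem_closedBall (ball_subset_closedBall hy), fun y => ?_, hM⟩
  · rw [χ.tsupport_eq]
    exact closedBall_subset_ball (by change 3 * r / 4 < r; linarith)
  · rw [Real.norm_of_nonneg χ.nonneg]
    exact χ.le_one

theorem norm_fderiv_mul_le {χ u : E → ℝ} {M : ℝ≥0} {y : E} (hχ : DifferentiableAt ℝ χ y)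
    (hu : DifferentiableAt ℝ u y) (hχ1 : ‖χ y‖ ≤ 1) (hM : ‖fderiv ℝ χ y‖ ≤ M) :
    ‖fderiv ℝ (fun y => χ y * u y) y‖ ≤ ‖fderiv ℝ u y‖ + M * ‖u y‖ := by
  rw [fderiv_fun_mul hχ hu]
  refine (norm_add_le _ _).trans ?_
  rw [norm_smul, norm_smul, mul_comm (M : ℝ)]
  gcongr
  exact mul_le_of_le_one_left (norm_nonneg _) hχ1

variable [MeasurableSpace E] {μ : Measure E}

/-- Hardy's inequality on the part of `U` in `S`: the distance to the boundary is an admissible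
weight for compactly supported functions. -/
def HardyOn (U S : Set E) (μ : Measure E) : Prop :=
  ∃ C : ℝ≥0∞, C ≠ ⊤ ∧ ∀ u : E → ℝ, ContDiff ℝ 1 u → HasCompactSupport u → tsupport u ⊆ U →
    ∫⁻ y in S ∩ U, ‖u y / infDist y (frontier U)‖ₑ ^ (2 : ℝ) ∂μ ≤
      C * ∫⁻ y, ‖fderiv ℝ u y‖ₑ ^ (2 : ℝ) ∂μ

theorem HardyOn.mono {S T : Set E} (h : HardyOn U T μ) (hST : S ⊆ T) : HardyOn U S μ := by
  obtain ⟨C, hC, hle⟩ := h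
  exact ⟨C, hC, fun u hu huc hus =>
    (lintegral_mono_set (inter_subset_inter_left U hST)).trans (hle u hu huc hus)⟩

theorem HardyOn.union {S T : Set E} (hS : HardyOn U S μ) (hT : HardyOn U T μ) :
    HardyOn U (S ∪ T) μ := by
  obtain ⟨C, hC, hleS⟩ := hS
  obtain ⟨C', hC', hleT⟩ := hT
  refine ⟨C + C', by finiteness, fun u hu huc hus => ?_⟩
  rw [union_inter_distrib_right, add_mul]
  exact (lintegral_union_le _ _ _).trans (add_le_add (hleS u hu huc hus) (hleT u hu huc hus))

variable [BorelSpace E]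

theorem lintegral_fderiv_mul_le {χ u : E → ℝ} {M : ℝ≥0} (hχ : Differentiable ℝ χ)
    (hu : ContDiff ℝ 1 u) (hχ1 : ∀ y, ‖χ y‖ ≤ 1) (hM : ∀ y, ‖fderiv ℝ χ y‖ ≤ M) :
    ∫⁻ y, ‖fderiv ℝ (fun y => χ y * u y) y‖ₑ ^ (2 : ℝ) ∂μ ≤
      2 * (∫⁻ y, ‖fderiv ℝ u y‖ₑ ^ (2 : ℝ) ∂μ + M ^ (2 : ℝ) * ∫⁻ y, ‖u y‖ₑ ^ (2 : ℝ) ∂μ) := by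
  have hmeas : Measurable fun y => ‖fderiv ℝ u y‖ₑ :=
    (hu.continuous_fderiv one_ne_zero).measurable.enorm
  have hle : ∀ y, ‖fderiv ℝ (fun y => χ y * u y) y‖ₑ ≤ ‖fderiv ℝ u y‖ₑ + M * ‖u y‖ₑ := fun y => by
    have := norm_fderiv_mul_le (hχ y) (hu.differentiable one_ne_zero y) (hχ1 y) (hM y)
    simp only [enorm_eq_nnnorm]
    exact_mod_cast this
  refine (lintegral_mono fun y => ENNReal.rpow_le_rpow (hle y) zero_le_two).trans
    ((lintegral_add_rpow_le hmeas one_le_two).trans_eq ?_)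
  simp only [ENNReal.mul_rpow_of_nonneg _ _ (zero_le_two (α := ℝ))]
  rw [lintegral_const_mul' _ _ (by finiteness)]
  norm_num

variable [FiniteDimensional ℝ E] [μ.IsAddHaarMeasure]

theorem integral_fderiv_apply_eq_zero {q : E → ℝ} (hq : ContDiff ℝ 1 q) (hc : HasCompactSupport q)
    (z : E) : ∫ y, fderiv ℝ q y z ∂μ = 0 := by
  have hderiv : Integrable (fun y => fderiv ℝ q y z) μ :=
    ((hq.continuous_fderiv one_ne_zero).clm_apply
      continuous_const).integrable_of_hasCompactSupport (hc.fderiv_apply ℝ z)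
  have hInt : Integrable q μ := hq.continuous.integrable_of_hasCompactSupport hc
  have hparts := integral_mul_fderiv_eq_neg_fderiv_mul_of_integrable (μ := μ)
    (f := fun _ => (1 : ℝ)) (g := q) (v := z) (by simp) (by simpa using hderiv)
    (by simpa using hInt) (fun _ _ => differentiableAt_const _)
    (fun x _ => hq.differentiable one_ne_zero x)
  simpa using hparts

theorem LocalDefining.lintegral_div_le (P : LocalDefining U y₀) {v : E → ℝ} (hv : ContDiff ℝ 1 v)
    (hc : HasCompactSupport v) (hs : tsupport v ⊆ U ∩ ball y₀ P.R) :
    ∫⁻ y, ‖v y / P.h y‖ₑ ^ (2 : ℝ) ∂μ ≤ 4 * ∫⁻ y, ‖fderiv ℝ v y P.z₀‖ₑ ^ (2 : ℝ) ∂μ := by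
  have hh : ∀ y ∈ tsupport v, ContDiffAt ℝ 1 P.h y := fun y hy => P.contDiffAt y (hs hy)
  have h0 : ∀ y ∈ tsupport v, P.h y ≠ 0 := fun y hy => (P.pos y (hs hy)).ne'
  have hsq : tsupport (fun y => v y ^ 2) ⊆ tsupport v := closure_mono fun y hy => by simpa using hy
  have hquot : ContDiff ℝ 1 fun y => v y / P.h y := contDiff_div_of_tsupport hv hh h0
  have hsqQuot : ContDiff ℝ 1 fun y => v y ^ 2 / P.h y :=
    contDiff_div_of_tsupport (hv.pow 2) (fun y hy => hh y (hsq hy)) fun y hy => h0 y (hsq hy)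
  have hquot_supp : HasCompactSupport fun y => v y / P.h y := hc.mono fun y hy => by
    rw [Function.mem_support, div_ne_zero_iff] at hy
    exact hy.1
  have hsqQuot_supp : HasCompactSupport fun y => v y ^ 2 / P.h y := hc.mono fun y hy => by
    rw [Function.mem_support, div_ne_zero_iff] at hy
    exact (pow_ne_zero_iff two_ne_zero).1 hy.1
  have hdv : Continuous fun y => fderiv ℝ v y P.z₀ :=
    (hv.continuous_fderiv one_ne_zero).clm_apply continuous_const
  have hdv_int : Integrable (fun y => 4 * ‖fderiv ℝ v y P.z₀‖ ^ 2) μ :=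
    (integrable_norm_sq_of_hasCompactSupport hdv (hc.fderiv_apply ℝ P.z₀)).const_mul 4
  have hdq_int : Integrable (fun y => 2 * fderiv ℝ (fun y => v y ^ 2 / P.h y) y P.z₀) μ :=
    (((hsqQuot.continuous_fderiv one_ne_zero).clm_apply
      continuous_const).integrable_of_hasCompactSupport
        (hsqQuot_supp.fderiv_apply ℝ P.z₀)).const_mul 2
  rw [lintegral_enorm_rpow_two_eq hquot.continuous hquot_supp,
    lintegral_enorm_rpow_two_eq hdv (hc.fderiv_apply ℝ P.z₀), ← ENNReal.ofReal_ofNat 4,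
    ← ENNReal.ofReal_mul (by positivity)]
  refine ENNReal.ofReal_le_ofReal ?_
  calc ∫ y, ‖v y / P.h y‖ ^ 2 ∂μ
      ≤ ∫ y, (4 * ‖fderiv ℝ v y P.z₀‖ ^ 2 -
          2 * fderiv ℝ (fun y => v y ^ 2 / P.h y) y P.z₀) ∂μ :=
        integral_mono (integrable_norm_sq_of_hasCompactSupport hquot.continuous hquot_supp)
          (hdv_int.sub hdq_int) (P.sq_div_le hv hs)
    _ = 4 * ∫ y, ‖fderiv ℝ v y P.z₀‖ ^ 2 ∂μ := by
        rw [integral_sub hdv_int hdq_int, integral_const_mul, integral_const_mul,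
          integral_fderiv_apply_eq_zero hsqQuot hsqQuot_supp, mul_zero, sub_zero]

theorem exists_lintegral_rpow_two_le_fderiv (hE : 2 < Module.finrank ℝ E)
    (hb : Bornology.IsBounded U) :
    ∃ C : ℝ≥0∞, C ≠ ⊤ ∧ ∀ u : E → ℝ, ContDiff ℝ 1 u → tsupport u ⊆ U →
      ∫⁻ y, ‖u y‖ₑ ^ (2 : ℝ) ∂μ ≤ C * ∫⁻ y, ‖fderiv ℝ u y‖ₑ ^ (2 : ℝ) ∂μ := by
  refine ⟨(eLpNormLESNormFDerivOfLeConst ℝ μ U 2 2 : ℝ≥0∞) ^ (2 : ℝ), by finiteness,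
    fun u hu hs => ?_⟩
  have hle := eLpNorm_le_eLpNorm_fderiv μ (p := 2) hu ((subset_tsupport u).trans hs) (by norm_num)
    (by exact_mod_cast hE) hb
  have hsq := ENNReal.rpow_le_rpow hle (z := 2) (by norm_num)
  have hu2 := eLpNorm_nnreal_pow_eq_lintegral (f := u) (μ := μ) (p := 2) (by norm_num)
  have hdu2 := eLpNorm_nnreal_pow_eq_lintegral (f := fderiv ℝ u) (μ := μ) (p := 2) (by norm_num)
  simp only [NNReal.coe_ofNat] at hu2 hdu2
  rwa [ENNReal.mul_rpow_of_nonneg _ _ (by norm_num), hu2, hdu2] at hsq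

theorem exists_lintegral_rpow_six_le_fderiv (hE : Module.finrank ℝ E = 3) :
    ∃ C : ℝ≥0∞, C ≠ ⊤ ∧ ∀ u : E → ℝ, ContDiff ℝ 1 u → HasCompactSupport u →
      ∫⁻ y, ‖u y‖ₑ ^ (6 : ℝ) ∂μ ≤ C * (∫⁻ y, ‖fderiv ℝ u y‖ₑ ^ (2 : ℝ) ∂μ) ^ (3 : ℝ) := by
  refine ⟨(SNormLESNormFDerivOfEqConst ℝ μ (2 : ℝ≥0) : ℝ≥0∞) ^ (6 : ℝ), by finiteness,
    fun u hu hc => ?_⟩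
  have hle := eLpNorm_le_eLpNorm_fderiv_of_eq μ (p := 2) (p' := 6) hu hc (by norm_num)
    (by rw [hE]; norm_num) (by rw [hE]; norm_num)
  have hpow := ENNReal.rpow_le_rpow hle (z := 6) (by norm_num)
  have h6 := eLpNorm_nnreal_pow_eq_lintegral (f := u) (μ := μ) (p := 6) (by norm_num)
  have h2 := eLpNorm_nnreal_pow_eq_lintegral (f := fderiv ℝ u) (μ := μ) (p := 2) (by norm_num)
  simp only [NNReal.coe_ofNat] at h6 h2
  rw [ENNReal.mul_rpow_of_nonneg _ _ (by norm_num), h6, show (6 : ℝ) = 2 * 3 by norm_num,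
    ENNReal.rpow_mul (eLpNorm _ _ _), h2] at hpow
  convert hpow using 3
  all_goals norm_num

theorem hardyOn_setOf_lt (hE : 2 < Module.finrank ℝ E) (hU : IsOpen U)
    (hb : Bornology.IsBounded U) {δ : ℝ≥0} (hδ : 0 < δ) :
    HardyOn U {y | δ < infDist y (frontier U)} μ := by
  obtain ⟨K, hK, hpoincare⟩ := exists_lintegral_rpow_two_le_fderiv (μ := μ) hE hb
  have hmeas : MeasurableSet ({y | (δ : ℝ) < infDist y (frontier U)} ∩ U) :=
    ((isOpen_lt continuous_const (continuous_infDist_pt _)).inter hU).measurableSet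
  refine ⟨(δ⁻¹ : ℝ≥0) ^ (2 : ℝ) * K, by finiteness, fun u hu _ hs => ?_⟩
  refine (setLIntegral_div_rpow_two_le (h := fun _ => 1) (C := δ⁻¹) hmeas (fun _ _ => rfl)
    (fun _ _ => one_pos) fun y hy => ?_).trans ?_
  · rw [NNReal.coe_inv, ← div_eq_inv_mul, one_le_div (by exact_mod_cast hδ)]
    exact hy.1.le
  · simp only [div_one, mul_assoc]
    gcongr
    exact hpoincare u hu hs

theorem LocalDefining.hardyOn_ball (P : LocalDefining U y₀) (hE : 2 < Module.finrank ℝ E)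
    (hU : IsOpen U) (hb : Bornology.IsBounded U) (hy₀ : y₀ ∈ frontier U) :
    HardyOn U (ball y₀ (P.R / 4)) μ := by
  obtain ⟨K, hK, hpoincare⟩ := exists_lintegral_rpow_two_le_fderiv (μ := μ) hE hb
  obtain ⟨χ, M, hχ, hχs, hχ1, hχle, hM⟩ := exists_bump_fderiv_bound y₀ (half_pos P.R_pos)
  have hR := P.R_pos
  refine ⟨P.C ^ (2 : ℝ) * (4 * (‖P.z₀‖ₑ ^ (2 : ℝ) * (2 * (1 + M ^ (2 : ℝ) * K)))), by finiteness,
    fun u hu huc hus => ?_⟩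
  have hsub : tsupport (fun y => χ y * u y) ⊆ U ∩ ball y₀ P.R := fun y hy =>
    ⟨hus (tsupport_mul_subset_right hy),
      ball_subset_ball (half_le_self hR.le) (hχs (tsupport_mul_subset_left hy))⟩
  have hquot : ∫⁻ y in ball y₀ (P.R / 4) ∩ U, ‖u y / infDist y (frontier U)‖ₑ ^ (2 : ℝ) ∂μ ≤
      P.C ^ (2 : ℝ) * ∫⁻ y, ‖χ y * u y / P.h y‖ₑ ^ (2 : ℝ) ∂μ := by
    refine setLIntegral_div_rpow_two_le (isOpen_ball.inter hU).measurableSet (fun y hy => ?_)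
      (fun y hy => P.pos y ⟨hy.2, ball_subset_ball (by linarith) hy.1⟩)
      fun y hy => P.le_mul_infDist hU hy₀ ⟨hy.2, ball_subset_ball (by linarith) hy.1⟩
    rw [hχ1 y (ball_subset_ball (by linarith) hy.1), one_mul]
  have happly : ∫⁻ y, ‖fderiv ℝ (fun y => χ y * u y) y P.z₀‖ₑ ^ (2 : ℝ) ∂μ ≤
      ‖P.z₀‖ₑ ^ (2 : ℝ) * ∫⁻ y, ‖fderiv ℝ (fun y => χ y * u y) y‖ₑ ^ (2 : ℝ) ∂μ := by
    rw [← lintegral_const_mul' _ _ (by finiteness)]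
    refine lintegral_mono fun y => ?_
    rw [← ENNReal.mul_rpow_of_nonneg _ _ zero_le_two, mul_comm]
    exact ENNReal.rpow_le_rpow (ContinuousLinearMap.le_opENorm _ _) zero_le_two
  refine hquot.trans ?_
  simp only [mul_assoc]
  gcongr
  refine (P.lintegral_div_le (hχ.mul hu) huc.mul_left hsub).trans ?_
  gcongr
  refine happly.trans ?_
  gcongr
  refine (lintegral_fderiv_mul_le (hχ.differentiable one_ne_zero) hu hχle hM).trans ?_
  rw [add_mul, one_mul, mul_assoc]
  gcongr
  exact hpoincare u hu hus

theorem exists_hardy (hE : 2 < Module.finrank ℝ E) (hU : IsOpen U) (hb : Bornology.IsBounded U)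
    (hfr : (frontier U).Nonempty) (hP : ∀ y ∈ frontier U, Nonempty (LocalDefining U y)) :
    ∃ C : ℝ≥0∞, C ≠ ⊤ ∧ ∀ u : E → ℝ, ContDiff ℝ 1 u → HasCompactSupport u → tsupport u ⊆ U →
      ∫⁻ y in U, ‖u y / infDist y (frontier U)‖ₑ ^ (2 : ℝ) ∂μ ≤
        C * ∫⁻ y, ‖fderiv ℝ u y‖ₑ ^ (2 : ℝ) ∂μ := by
  suffices h : HardyOn U (closure U) μ by
    rwa [HardyOn, inter_eq_right.2 subset_closure] at h
  refine hb.isCompact_closure.induction_on (p := fun S => HardyOn U S μ) ⟨0, by simp, by simp⟩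
    (fun S T hST hT => hT.mono hST) (fun S T => HardyOn.union) fun x hx => ?_
  by_cases hxU : x ∈ U
  · have hpos := infDist_frontier_pos hU hfr hxU
    have hδ : (0 : ℝ) < infDist x (frontier U) / 2 := half_pos hpos
    refine ⟨_, mem_nhdsWithin_of_mem_nhds ?_, hardyOn_setOf_lt (δ := ⟨_, hδ.le⟩) hE hU hb hδ⟩
    exact (isOpen_lt continuous_const (continuous_infDist_pt _)).mem_nhds (half_lt_self hpos)
  · have hxf : x ∈ frontier U := hU.frontier_eq ▸ ⟨hx, hxU⟩
    obtain ⟨P⟩ := hP x hxf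
    exact ⟨_, mem_nhdsWithin_of_mem_nhds (ball_mem_nhds x (by linarith [P.R_pos])),
      P.hardyOn_ball hE hU hb hxf⟩

end Hardy

/-! ### Slicewise derivatives up to the boundary -/

section Slices

variable {E F G : Type*} [NormedAddCommGroup E] [NormedSpace ℝ E] [NormedAddCommGroup F]
  [NormedSpace ℝ F] [NormedAddCommGroup G] [NormedSpace ℝ G] {Q : Set (E × G)}

theorem exists_slice_fderiv (hQ : ∀ t, IsOpen {x | (x, t) ∈ Q}) {f : E × G → F} {p : E × G}
    (hp : p ∈ closure Q) {n : ℕ} (hf : ContDiffWithinAt ℝ (n + 1) f (closure Q) p) :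
    ∃ g : E × G → E →L[ℝ] F, ContDiffWithinAt ℝ n g (closure Q) p ∧
      ∃ V, IsOpen V ∧ p ∈ V ∧ ∀ q ∈ V ∩ Q, HasFDerivAt (fun z => f (z, q.2)) (g q) q.1 := by
  obtain ⟨u, hu, -, -, f', hf', hf'_smooth⟩ :=
    (contDiffWithinAt_succ_iff_hasFDerivWithinAt' (by simp)).1 hf
  rw [insert_eq_of_mem hp] at hu
  obtain ⟨V, hV, hpV, hVu⟩ := mem_nhdsWithin.1 hu
  refine ⟨fun q => (f' q).comp (ContinuousLinearMap.inl ℝ E G),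
    hf'_smooth.clm_comp contDiffWithinAt_const, V, hV, hpV, fun q hq => ?_⟩
  have hslice : HasFDerivWithinAt (fun z => f (z, q.2))
      ((f' q).comp (ContinuousLinearMap.inl ℝ E G)) {x | (x, q.2) ∈ Q} q.1 :=
    HasFDerivWithinAt.comp q.1 (t := closure Q) (hf' q (hVu ⟨hq.1, subset_closure hq.2⟩))
      (hasFDerivAt_prodMk_left q.1 q.2).hasFDerivWithinAt fun x hx => subset_closure hx
  exact hslice.hasFDerivAt ((hQ q.2).mem_nhds hq.2)

theorem exists_tendsto_slice_fderiv (hQ : ∀ t, IsOpen {x | (x, t) ∈ Q}) {f : E × G → F} {x₀ : E}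
    {t : G} (hp : (x₀, t) ∈ closure Q) (hf : ContDiffWithinAt ℝ 1 f (closure Q) (x₀, t)) :
    ∃ L : E →L[ℝ] F,
      Tendsto (fderiv ℝ fun z => f (z, t)) (𝓝[{x | (x, t) ∈ Q}] x₀) (𝓝 L) := by
  obtain ⟨g, hg, V, hV, hpV, hgV⟩ := exists_slice_fderiv (n := 0) hQ hp (by simpa using hf)
  have hslice : Tendsto (fun x : E => (x, t)) (𝓝[{x | (x, t) ∈ Q}] x₀) (𝓝[closure Q] (x₀, t)) :=
    tendsto_nhdsWithin_iff.2 ⟨(Continuous.tendsto (by fun_prop) _).mono_left nhdsWithin_le_nhds,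
      eventually_nhdsWithin_of_forall fun x hx => subset_closure hx⟩
  refine ⟨g (x₀, t), (hg.continuousWithinAt.tendsto.comp hslice).congr' ?_⟩
  filter_upwards [(hslice.mono_right nhdsWithin_le_nhds).eventually (hV.mem_nhds hpV),
    self_mem_nhdsWithin] with x hxV hx
  exact (hgV (x, t) ⟨hxV, hx⟩).fderiv.symm

theorem exists_slice_fderiv_bound_nhds (hQ : ∀ t, IsOpen {x | (x, t) ∈ Q}) {f : E × G → F}
    {p : E × G} (hp : p ∈ closure Q) (hf : ContDiffWithinAt ℝ 2 f (closure Q) p) :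
    ∃ V ∈ 𝓝 p, ∃ C : ℝ, ∀ q ∈ V ∩ Q, ‖fderiv ℝ (fun z => f (z, q.2)) q.1‖ ≤ C ∧
      ‖fderiv ℝ (fderiv ℝ fun z => f (z, q.2)) q.1‖ ≤ C := by
  obtain ⟨g, hg, V, hV, hpV, hgV⟩ := exists_slice_fderiv (n := 1) hQ hp (by norm_num; exact hf)
  obtain ⟨g', hg', V', hV', hpV', hgV'⟩ := exists_slice_fderiv (n := 0) hQ hp (f := g)
    (by simpa using hg)
  have hbound : ∀ᶠ q in 𝓝[closure Q] p, ‖g q‖ < ‖g p‖ + 1 ∧ ‖g' q‖ < ‖g' p‖ + 1 :=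
    (hg.continuousWithinAt.norm.eventually_lt_const (lt_add_one _)).and
      (hg'.continuousWithinAt.norm.eventually_lt_const (lt_add_one _))
  obtain ⟨W, hW, hpW, hWb⟩ := mem_nhdsWithin.1 hbound
  refine ⟨V ∩ V' ∩ W, ((hV.inter hV').inter hW).mem_nhds ⟨⟨hpV, hpV'⟩, hpW⟩,
    max (‖g p‖ + 1) (‖g' p‖ + 1), fun q hq => ?_⟩
  obtain ⟨hgq, hg'q⟩ := hWb ⟨hq.1.2, subset_closure hq.2⟩
  have hqV : q ∈ V ∩ Q := ⟨hq.1.1.1, hq.2⟩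
  have hfderiv : (fderiv ℝ fun z => f (z, q.2)) =ᶠ[𝓝 q.1] fun z => g (z, q.2) := by
    have hopen : IsOpen {z : E | (z, q.2) ∈ V ∩ Q} :=
      (hV.preimage (by fun_prop : Continuous fun z : E => (z, q.2))).inter (hQ q.2)
    filter_upwards [hopen.mem_nhds hqV] with z hz
    exact (hgV (z, q.2) hz).fderiv
  rw [hfderiv.fderiv_eq, (hgV q hqV).fderiv, (hgV' q ⟨hq.1.1.2, hq.2⟩).fderiv]
  exact ⟨hgq.le.trans (le_max_left _ _), hg'q.le.trans (le_max_right _ _)⟩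

theorem exists_slice_fderiv_bound (hQ : ∀ t, IsOpen {x | (x, t) ∈ Q}) {f : E × G → F}
    (hf : ContDiffOn ℝ 2 f (closure Q)) {K : Set (E × G)} (hK : IsCompact K)
    (hKQ : K ⊆ closure Q) :
    ∃ C : ℝ, ∀ q ∈ K ∩ Q, ‖fderiv ℝ (fun z => f (z, q.2)) q.1‖ ≤ C ∧
      ‖fderiv ℝ (fderiv ℝ fun z => f (z, q.2)) q.1‖ ≤ C := by
  refine hK.induction_on (p := fun S => ∃ C : ℝ, ∀ q ∈ S ∩ Q,
    ‖fderiv ℝ (fun z => f (z, q.2)) q.1‖ ≤ C ∧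
      ‖fderiv ℝ (fderiv ℝ fun z => f (z, q.2)) q.1‖ ≤ C) ⟨0, by simp⟩ ?_ ?_ fun p hp => ?_
  · rintro s t hst ⟨C, hC⟩
    exact ⟨C, fun q hq => hC q ⟨hst hq.1, hq.2⟩⟩
  · rintro s t ⟨C, hC⟩ ⟨C', hC'⟩
    refine ⟨max C C', fun q hq => ?_⟩
    rcases hq.1 with h | h
    · exact (hC q ⟨h, hq.2⟩).imp (le_max_of_le_left ·) (le_max_of_le_left ·)
    · exact (hC' q ⟨h, hq.2⟩).imp (le_max_of_le_right ·) (le_max_of_le_right ·)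
  · obtain ⟨V, hV, C, hC⟩ := exists_slice_fderiv_bound_nhds hQ (hKQ hp) (hf p (hKQ hp))
    exact ⟨V, mem_nhdsWithin_of_mem_nhds hV, C, hC⟩

theorem fderiv_comp_fderiv_eq_id {f : F → E} {g : E → F} {x : E}
    (hf : DifferentiableAt ℝ f (g x)) (hg : DifferentiableAt ℝ g x)
    (hfg : ∀ᶠ z in 𝓝 x, f (g z) = z) :
    (fderiv ℝ f (g x)).comp (fderiv ℝ g x) = ContinuousLinearMap.id ℝ E :=
  (hf.hasFDerivAt.comp x hg.hasFDerivAt).unique ((hasFDerivAt_id x).congr_of_eventuallyEq hfg)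

theorem tendsto_clm_comp {α : Type*} {l : Filter α} {A : α → F →L[ℝ] G} {B : α → E →L[ℝ] F}
    {A₀ : F →L[ℝ] G} {B₀ : E →L[ℝ] F} (hA : Tendsto A l (𝓝 A₀)) (hB : Tendsto B l (𝓝 B₀)) :
    Tendsto (fun a => (A a).comp (B a)) l (𝓝 (A₀.comp B₀)) :=
  ((continuous_fst.clm_comp continuous_snd).tendsto (A₀, B₀)).comp (hA.prodMk_nhds hB)

end Slices

namespace Family

variable (D : Family)

theorem isOpen_spaceTime_slice (t : ℝ) : IsOpen {x | (x, t) ∈ spaceTime D.Ω} := (D.domain t).isOpen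

theorem isOpen_ref_slice (t : ℝ) : IsOpen {x | (x, t) ∈ D.Ωref ×ˢ (univ : Set ℝ)} := by
  simpa using D.isOpen_ref

theorem mem_closure_ref_prod {y : E3} (t : ℝ) (hy : y ∈ closure D.Ωref) :
    (y, t) ∈ closure (D.Ωref ×ˢ (univ : Set ℝ)) := by
  rw [closure_prod_eq, closure_univ]
  exact ⟨hy, mem_univ _⟩

theorem mem_closure_spaceTime {x : E3} {t : ℝ} (hx : x ∈ closure (D.Ω t)) :
    (x, t) ∈ closure (spaceTime D.Ω) := by
  have hcont : ContinuousWithinAt (fun x : E3 => (x, t)) (D.Ω t) x := by fun_prop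
  exact hcont.mem_closure hx fun z hz => hz

theorem φ_mem {x : E3} {t : ℝ} (hx : x ∈ D.Ω t) : D.φ x t ∈ D.Ωref :=
  D.φ_image t ▸ mem_image_of_mem _ hx

theorem ψ_mem {y : E3} (t : ℝ) (hy : y ∈ D.Ωref) : D.ψ y t ∈ D.Ω t := by
  rw [← D.φ_image t] at hy
  obtain ⟨x, hx, rfl⟩ := hy
  rwa [D.ψ_φ x t (D.mem_closure_spaceTime (subset_closure hx))]

theorem φ_ψ_of_mem_closure {y : E3} (t : ℝ) (hy : y ∈ closure D.Ωref) : D.φ (D.ψ y t) t = y :=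
  D.φ_ψ y t (D.mem_closure_ref_prod t hy)

theorem ψ_mem_iff {y : E3} (t : ℝ) (hy : y ∈ closure D.Ωref) : D.ψ y t ∈ D.Ω t ↔ y ∈ D.Ωref :=
  ⟨fun h => D.φ_ψ_of_mem_closure t hy ▸ D.φ_mem h, D.ψ_mem t⟩

theorem ψ_contDiffOn (t : ℝ) : ContDiffOn ℝ ∞ (fun y => D.ψ y t) (closure D.Ωref) :=
  D.ψ_smooth.comp (f := fun y : E3 => (y, t)) (by fun_prop) fun _ hy => D.mem_closure_ref_prod t hy

theorem φ_contDiffOn (t : ℝ) : ContDiffOn ℝ ∞ (fun x => D.φ x t) (closure (D.Ω t)) :=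
  D.φ_smooth.comp (f := fun y : E3 => (y, t)) (by fun_prop) fun _ hy => D.mem_closure_spaceTime hy

theorem ψ_contDiffAt {y : E3} (t : ℝ) (hy : y ∈ D.Ωref) : ContDiffAt ℝ ∞ (fun y => D.ψ y t) y :=
  (D.ψ_contDiffOn t).contDiffAt (mem_of_superset (D.isOpen_ref.mem_nhds hy) subset_closure)

theorem φ_contDiffAt {x : E3} {t : ℝ} (hx : x ∈ D.Ω t) : ContDiffAt ℝ ∞ (fun x => D.φ x t) x :=
  (D.φ_contDiffOn t).contDiffAt
    (mem_of_superset ((D.domain t).isOpen.mem_nhds hx) subset_closure)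

theorem ψ_mem_closure {y : E3} (t : ℝ) (hy : y ∈ closure D.Ωref) : D.ψ y t ∈ closure (D.Ω t) :=
  (((D.ψ_contDiffOn t).continuousOn y hy).mono subset_closure).mem_closure hy
    fun _ hz => D.ψ_mem t hz

theorem ψ_mem_frontier {y : E3} (t : ℝ) (hy : y ∈ frontier D.Ωref) :
    D.ψ y t ∈ frontier (D.Ω t) := by
  rw [D.isOpen_ref.frontier_eq] at hy
  rw [(D.domain t).isOpen.frontier_eq]
  exact ⟨D.ψ_mem_closure t hy.1, fun h => hy.2 ((D.ψ_mem_iff t hy.1).1 h)⟩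

theorem isBounded_ref : Bornology.IsBounded D.Ωref := by
  have hc : IsCompact (closure (D.Ω 0)) := (D.domain 0).isBounded.isCompact_closure
  refine (hc.image_of_continuousOn (D.φ_contDiffOn 0).continuousOn).isBounded.subset ?_
  rw [← D.φ_image 0]
  exact image_mono subset_closure

theorem frontier_ref_nonempty : (frontier D.Ωref).Nonempty := by
  refine nonempty_frontier_iff.2
    ⟨?_, fun h => NormedSpace.unbounded_univ ℝ E3 (h ▸ D.isBounded_ref)⟩
  rw [← D.φ_image 0]
  exact (D.domain 0).isConnected.nonempty.image _

theorem fderiv_φ_comp_fderiv_ψ {y : E3} (t : ℝ) (hy : y ∈ D.Ωref) :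
    (fderiv ℝ (fun x => D.φ x t) (D.ψ y t)).comp (fderiv ℝ (fun y => D.ψ y t) y) =
      ContinuousLinearMap.id ℝ E3 := by
  refine fderiv_comp_fderiv_eq_id (f := fun x => D.φ x t)
    ((D.φ_contDiffAt (D.ψ_mem t hy)).differentiableAt (by simp))
    ((D.ψ_contDiffAt t hy).differentiableAt (by simp)) ?_
  filter_upwards [D.isOpen_ref.mem_nhds hy] with z hz
  exact D.φ_ψ_of_mem_closure t (subset_closure hz)

/-! ### The boundary of the reference domain -/

theorem exists_surjective_tendsto_fderiv_ψ {y₀ : E3} (t : ℝ) (hy₀ : y₀ ∈ closure D.Ωref) :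
    ∃ L : E3 →L[ℝ] E3, Function.Surjective L ∧
      Tendsto (fderiv ℝ fun y => D.ψ y t) (𝓝[D.Ωref] y₀) (𝓝 L) := by
  have hψt : Tendsto (fun y => D.ψ y t) (𝓝[D.Ωref] y₀) (𝓝[D.Ω t] (D.ψ y₀ t)) :=
    tendsto_nhdsWithin_iff.2 ⟨((D.ψ_contDiffOn t).continuousOn y₀ hy₀).mono subset_closure,
      eventually_nhdsWithin_of_forall fun y hy => D.ψ_mem t hy⟩
  have hpψ := D.mem_closure_ref_prod t hy₀
  have hpφ := D.mem_closure_spaceTime (D.ψ_mem_closure t hy₀)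
  obtain ⟨L, hL⟩ := exists_tendsto_slice_fderiv D.isOpen_ref_slice hpψ
    ((D.ψ_smooth _ hpψ).of_le (by simp))
  obtain ⟨L', hL'⟩ := exists_tendsto_slice_fderiv D.isOpen_spaceTime_slice hpφ
    ((D.φ_smooth _ hpφ).of_le (by simp))
  simp only [prodMk_mem_set_prod_eq, mem_univ, and_true, ofPred_mem_eq] at hL
  have : (𝓝[D.Ωref] y₀).NeBot := mem_closure_iff_nhdsWithin_neBot.1 hy₀
  have hcomp : L'.comp L = ContinuousLinearMap.id ℝ E3 :=
    tendsto_nhds_unique (tendsto_clm_comp (hL'.comp hψt) hL) (tendsto_const_nhds.congr'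
      (eventually_nhdsWithin_of_forall fun y hy => (D.fderiv_φ_comp_fderiv_ψ t hy).symm))
  refine ⟨L, (LinearMap.injective_iff_surjective (f := L.toLinearMap)).1 ?_, hL⟩
  exact Function.LeftInverse.injective (g := L') fun v => DFunLike.congr_fun hcomp v

end Family

theorem surjective_fderiv_of_openPartialHomeomorph {E F : Type*} [NormedAddCommGroup E]
    [NormedSpace ℝ E] [NormedAddCommGroup F] [NormedSpace ℝ F] {e : OpenPartialHomeomorph E F}
    {x : E} (hx : x ∈ e.source) (he : DifferentiableAt ℝ e x)
    (he' : DifferentiableAt ℝ e.symm (e x)) : Function.Surjective (fderiv ℝ e x) := by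
  have hcomp := fderiv_comp_fderiv_eq_id (f := e) (g := e.symm) (x := e x)
    (by rwa [e.left_inv hx]) he' (e.eventually_right_inverse' hx)
  rw [e.left_inv hx] at hcomp
  exact fun v => ⟨fderiv ℝ e.symm (e x) v, DFunLike.congr_fun hcomp v⟩

theorem eq_zero_of_mem_frontier {X : Type*} [TopologicalSpace X] {U W : Set X} {h : X → ℝ}
    (hU : IsOpen U) (hW : IsOpen W) (hcont : ContinuousOn h (closure U ∩ W))
    (hside : ∀ y ∈ closure U ∩ W, y ∈ U ↔ 0 < h y) {y : X} (hy : y ∈ frontier U ∩ W) : h y = 0 := by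
  have hyc : y ∈ closure U ∩ W := ⟨frontier_subset_closure hy.1, hy.2⟩
  have hmem : y ∈ closure (U ∩ W) := by
    rw [inter_comm]
    exact hW.inter_closure ⟨hyc.2, hyc.1⟩
  have hnonneg : h y ∈ closure (Ici 0) :=
    ((hcont y hyc).mono (inter_subset_inter_left _ subset_closure)).mem_closure hmem
      fun z hz => ((hside z ⟨subset_closure hz.1, hz.2⟩).1 hz.1).le
  rw [isClosed_Ici.closure_eq] at hnonneg
  refine le_antisymm (not_lt.1 fun hpos => ?_) hnonneg
  rw [hU.frontier_eq] at hy
  exact hy.1.2 ((hside y hyc).2 hpos)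

theorem nonempty_localDefining_of_tendsto {E : Type*} [NormedAddCommGroup E] [NormedSpace ℝ E]
    {U W : Set E} {y₀ : E} {h : E → ℝ} (hU : IsOpen U) (hW : IsOpen W) (hy₀ : y₀ ∈ W)
    (hcont : ContinuousOn h (closure U ∩ W)) (hsmooth : ∀ y ∈ U ∩ W, ContDiffAt ℝ 1 h y)
    (hside : ∀ y ∈ closure U ∩ W, y ∈ U ↔ 0 < h y) {Λ : E →L[ℝ] ℝ} (hΛ : Λ ≠ 0)
    (hlim : Tendsto (fderiv ℝ h) (𝓝[U] y₀) (𝓝 Λ)) : Nonempty (LocalDefining U y₀) := by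
  obtain ⟨v, hv⟩ := DFunLike.ne_iff.1 hΛ
  obtain ⟨z₀, hz₀⟩ : ∃ z₀, Λ z₀ = 2 := ⟨(2 / Λ v) • v, by
    rw [map_smul, smul_eq_mul, div_mul_cancel₀ _ hv]⟩
  have hnear : ∀ᶠ y in 𝓝[U] y₀, ‖fderiv ℝ h y‖ < ‖Λ‖ + 1 ∧ 1 < fderiv ℝ h y z₀ := by
    have hlim₀ : Tendsto (fun y => fderiv ℝ h y z₀) (𝓝[U] y₀) (𝓝 (Λ z₀)) :=
      ((ContinuousLinearMap.apply ℝ ℝ z₀).continuous.tendsto Λ).comp hlim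
    rw [hz₀] at hlim₀
    exact (hlim.norm.eventually_lt_const (lt_add_one _)).and
      (hlim₀.eventually_const_lt one_lt_two)
  obtain ⟨R₁, hR₁, hball₁⟩ := Metric.isOpen_iff.1 hW y₀ hy₀
  obtain ⟨R₂, hR₂, hball₂⟩ := Metric.mem_nhdsWithin_iff.1 hnear
  have hsubW : ball y₀ (min R₁ R₂) ⊆ W := (ball_subset_ball (min_le_left _ _)).trans hball₁
  have hbound : ∀ y ∈ U ∩ ball y₀ (min R₁ R₂), ‖fderiv ℝ h y‖ < ‖Λ‖ + 1 ∧ 1 < fderiv ℝ h y z₀ :=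
    fun y hy => hball₂ ⟨ball_subset_ball (min_le_right _ _) hy.2, hy.1⟩
  exact ⟨{
    R := min R₁ R₂
    R_pos := lt_min hR₁ hR₂
    h := h
    z₀ := z₀
    C := ‖Λ‖₊ + 1
    continuousOn := hcont.mono (inter_subset_inter_right _ hsubW)
    contDiffAt := fun y hy => hsmooth y ⟨hy.1, hsubW hy.2⟩
    pos := fun y hy => (hside y ⟨subset_closure hy.1, hsubW hy.2⟩).1 hy.1
    eq_zero := fun y hy => eq_zero_of_mem_frontier hU hW hcont hside ⟨hy.1, hsubW hy.2⟩
    norm_fderiv_le := fun y hy => (hbound y hy).1.le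
    one_le_fderiv := fun y hy => (hbound y hy).2.le }⟩

namespace Family

variable (D : Family)

theorem exists_ne_zero_tendsto_fderiv_comp_ψ {y₀ : E3} {t : ℝ} (hy₀ : y₀ ∈ closure D.Ωref)
    {f : E3 → ℝ} (hf : ContDiffAt ℝ 1 f (D.ψ y₀ t)) (hf0 : fderiv ℝ f (D.ψ y₀ t) ≠ 0) :
    ∃ Λ : E3 →L[ℝ] ℝ, Λ ≠ 0 ∧ Tendsto (fderiv ℝ fun y => f (D.ψ y t)) (𝓝[D.Ωref] y₀) (𝓝 Λ) := by
  obtain ⟨L, hLsurj, hL⟩ := D.exists_surjective_tendsto_fderiv_ψ t hy₀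
  have hψt : Tendsto (fun y => D.ψ y t) (𝓝[D.Ωref] y₀) (𝓝 (D.ψ y₀ t)) :=
    ((D.ψ_contDiffOn t).continuousOn y₀ hy₀).mono subset_closure
  refine ⟨(fderiv ℝ f (D.ψ y₀ t)).comp L, fun h => hf0 ?_, ?_⟩
  · ext v
    obtain ⟨z, rfl⟩ := hLsurj v
    exact DFunLike.congr_fun h z
  · refine (tendsto_clm_comp ((hf.continuousAt_fderiv one_ne_zero).tendsto.comp hψt) hL).congr' ?_
    filter_upwards [hψt.eventually (hf.eventually (by simp)), self_mem_nhdsWithin] with y hfy hy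
    exact (fderiv_comp y (hfy.differentiableAt one_ne_zero)
      ((D.ψ_contDiffAt t hy).differentiableAt (by simp))).symm

theorem nonempty_localDefining {y₀ : E3} (hy₀ : y₀ ∈ frontier D.Ωref) :
    Nonempty (LocalDefining D.Ωref y₀) := by
  have hy₀c : y₀ ∈ closure D.Ωref := frontier_subset_closure hy₀
  have hψ := (D.ψ_contDiffOn 0).continuousOn
  obtain ⟨e, hxe, he, he', hside⟩ := (D.domain 0).smoothBoundary _ (D.ψ_mem_frontier 0 hy₀)
  have heAt : ∀ x ∈ e.source, ContDiffAt ℝ ∞ e x := fun x hx =>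
    he.contDiffAt (e.open_source.mem_nhds hx)
  have heAt₀ : ∀ x ∈ e.source, ContDiffAt ℝ 1 (fun x => e x 0) x := fun x hx =>
    ((EuclideanSpace.proj (0 : Fin 3)).contDiff.contDiffAt.comp x (heAt x hx)).of_le (by simp)
  have hesurj : Function.Surjective (fderiv ℝ e (D.ψ y₀ 0)) :=
    surjective_fderiv_of_openPartialHomeomorph hxe ((heAt _ hxe).differentiableAt (by simp))
      ((he'.contDiffAt (e.open_target.mem_nhds (e.map_source hxe))).differentiableAt (by simp))
  have hd0 : fderiv ℝ (fun x => e x 0) (D.ψ y₀ 0) ≠ 0 := fun h0 => by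
    have hproj := ((EuclideanSpace.proj (𝕜 := ℝ) (0 : Fin 3)).hasFDerivAt.comp _
      ((heAt _ hxe).differentiableAt (by simp)).hasFDerivAt).fderiv
    obtain ⟨v, hv⟩ := hesurj (EuclideanSpace.single 0 1)
    simpa [hv] using DFunLike.congr_fun (hproj.symm.trans h0) v
  obtain ⟨Λ, hΛ, hlim⟩ := D.exists_ne_zero_tendsto_fderiv_comp_ψ hy₀c (heAt₀ _ hxe) hd0
  obtain ⟨W, hW, hy₀W, hsub⟩ := mem_nhdsWithin.1 ((hψ y₀ hy₀c).eventually
    (e.open_source.mem_nhds hxe))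
  have hsource : ∀ y ∈ closure D.Ωref ∩ W, D.ψ y 0 ∈ e.source := fun y hy => hsub ⟨hy.2, hy.1⟩
  refine nonempty_localDefining_of_tendsto (h := fun y => e (D.ψ y 0) 0) D.isOpen_ref hW hy₀W
    ?_ (fun y hy => ?_) (fun y hy => ?_) hΛ hlim
  · exact (EuclideanSpace.proj (𝕜 := ℝ) (0 : Fin 3)).continuous.comp_continuousOn
      (e.continuousOn.comp (hψ.mono inter_subset_left) hsource)
  · exact (heAt₀ _ (hsource y ⟨subset_closure hy.1, hy.2⟩)).comp y
      ((D.ψ_contDiffAt 0 hy.1).of_le (by simp))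
  · exact (D.ψ_mem_iff 0 hy.1).symm.trans (hside _ (hsource y hy))

theorem hasCone_ref : HasCone D.Ωref :=
  hasCone_of_localDefining D.isOpen_ref fun _ hy => D.nonempty_localDefining hy

end Family

/-! ### Bounds for the coefficients -/

theorem measurable_pd (j : Fin 3) (f : E3 → ℝ) : Measurable (pd j f) :=
  measurable_fderiv_apply_const ℝ f _

theorem pd_apply {f : E3 → E3} {y : E3} (hf : DifferentiableAt ℝ f y) (i k : Fin 3) :
    pd i (fun z => f z k) y = fderiv ℝ f y (EuclideanSpace.single i 1) k := by
  have h := (EuclideanSpace.proj k : E3 →L[ℝ] ℝ).hasFDerivAt.comp y hf.hasFDerivAt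
  exact DFunLike.congr_fun h.fderiv _

theorem norm_clm_single_apply_le (L : E3 →L[ℝ] E3) (i k : Fin 3) :
    ‖L (EuclideanSpace.single i 1) k‖ ≤ ‖L‖ :=
  (PiLp.norm_apply_le _ _).trans (by simpa using L.le_opNorm (EuclideanSpace.single i 1))

section BigO

open Asymptotics

variable {α E F : Type*} [NormedAddCommGroup E] [NormedAddCommGroup F] {s : Set α}

theorem isBigO_one_principal_iff {f : α → E} : f =O[𝓟 s] (fun _ => (1 : ℝ)) ↔
    ∃ C : ℝ, ∀ x ∈ s, ‖f x‖ ≤ C := by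
  simp [isBigO_iff]

theorem isBigO_one_of_norm_le {f : α → E} {g : α → F} (hg : g =O[𝓟 s] fun _ => (1 : ℝ))
    (hfg : ∀ x ∈ s, ‖f x‖ ≤ ‖g x‖) : f =O[𝓟 s] fun _ => (1 : ℝ) :=
  (IsBigO.of_bound' (eventually_principal.2 hfg)).trans hg

theorem isBigO_one_mul {l : Filter α} {f g : α → ℝ} (hf : f =O[l] fun _ => (1 : ℝ))
    (hg : g =O[l] fun _ => (1 : ℝ)) : (fun x => f x * g x) =O[l] fun _ => (1 : ℝ) := by
  simpa using hf.mul hg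

theorem eventually_enorm_le_of_isBigO_one {f : α → E} (hf : f =O[𝓟 s] fun _ => (1 : ℝ)) :
    ∀ᶠ m : ℝ≥0 in atTop, ∀ x ∈ s, ‖f x‖ₑ ≤ m := by
  obtain ⟨C, hC⟩ := isBigO_one_principal_iff.1 hf
  filter_upwards [eventually_ge_atTop C.toNNReal] with m hm x hx
  exact ENNReal.coe_le_coe.2 ((NNReal.le_toNNReal_of_coe_le (hC x hx)).trans hm)

end BigO

namespace Family

variable (D : Family)

theorem dx_eq {y : E3} (t : ℝ) (hy : y ∈ D.Ωref) (k i : Fin 3) :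
    D.dx t k i y = fderiv ℝ (fun z => D.ψ z t) y (EuclideanSpace.single i 1) k :=
  pd_apply ((D.ψ_contDiffAt t hy).differentiableAt (by simp)) i k

theorem dy_eq {y : E3} (t : ℝ) (hy : y ∈ D.Ωref) (i k : Fin 3) :
    D.dy t i k y = fderiv ℝ (fun x => D.φ x t) (D.ψ y t) (EuclideanSpace.single k 1) i :=
  pd_apply ((D.φ_contDiffAt (D.ψ_mem t hy)).differentiableAt (by simp)) k i

theorem hasFDerivAt_dx {y : E3} (t : ℝ) (hy : y ∈ D.Ωref) (k i : Fin 3) :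
    HasFDerivAt (D.dx t k i) (((EuclideanSpace.proj k : E3 →L[ℝ] ℝ).comp
      (ContinuousLinearMap.apply ℝ E3 (EuclideanSpace.single i (1 : ℝ)))).comp
        (fderiv ℝ (fderiv ℝ fun y => D.ψ y t) y)) y := by
  have hψ : DifferentiableAt ℝ (fderiv ℝ fun y => D.ψ y t) y :=
    ((D.ψ_contDiffAt t hy).fderiv_right (m := 1) (by norm_cast)).differentiableAt one_ne_zero
  refine HasFDerivAt.congr_of_eventuallyEq ?_ (eventually_of_mem (D.isOpen_ref.mem_nhds hy)
    fun z hz => D.dx_eq t hz k i)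
  exact ((EuclideanSpace.proj k : E3 →L[ℝ] ℝ).comp
    (ContinuousLinearMap.apply ℝ E3 (EuclideanSpace.single i (1 : ℝ)))).hasFDerivAt.comp y
      hψ.hasFDerivAt

theorem ddx_eq {y : E3} (t : ℝ) (hy : y ∈ D.Ωref) (k i j : Fin 3) :
    D.ddx t k i j y = fderiv ℝ (fderiv ℝ fun z => D.ψ z t) y (EuclideanSpace.single i 1)
      (EuclideanSpace.single j 1) k :=
  DFunLike.congr_fun (D.hasFDerivAt_dx t hy k j).fderiv _

theorem pd_gLow {y : E3} (t : ℝ) (hy : y ∈ D.Ωref) (l i j : Fin 3) :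
    pd l (D.gLow t i j) y =
      ∑ k, (D.ddx t k l i y * D.dx t k j y + D.dx t k i y * D.ddx t k l j y) := by
  have hd : ∀ k i, HasFDerivAt (D.dx t k i) (fderiv ℝ (D.dx t k i) y) y := fun k i =>
    (D.hasFDerivAt_dx t hy k i).differentiableAt.hasFDerivAt
  have hg : HasFDerivAt (D.gLow t i j) (∑ k, (D.dx t k i y • fderiv ℝ (D.dx t k j) y +
      D.dx t k j y • fderiv ℝ (D.dx t k i) y)) y :=
    HasFDerivAt.fun_sum fun k _ => (hd k i).mul (hd k j)
  rw [pd, hg.fderiv]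
  simp only [_root_.sum_apply, _root_.add_apply, _root_.smul_apply, smul_eq_mul]
  refine Finset.sum_congr rfl fun k _ => ?_
  simp only [ddx, pd]
  ring

theorem dy_mul_dx {y : E3} (t : ℝ) (hy : y ∈ D.Ωref) :
    (Matrix.of fun i k => D.dy t i k y) * (Matrix.of fun k j => D.dx t k j y) = 1 := by
  ext i j
  have hsum := clm_apply_eq_sum_single ((EuclideanSpace.proj i : E3 →L[ℝ] ℝ).comp
    (fderiv ℝ (fun x => D.φ x t) (D.ψ y t)))
    (fderiv ℝ (fun y => D.ψ y t) y (EuclideanSpace.single j 1))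
  have hid := congrArg (fun M : E3 →L[ℝ] E3 => M (EuclideanSpace.single j 1) i)
    (D.fderiv_φ_comp_fderiv_ψ t hy)
  simp only [Matrix.mul_apply, Matrix.of_apply, D.dx_eq t hy, D.dy_eq t hy]
  simp only [mul_comm (fderiv ℝ (fun x => D.φ x t) (D.ψ y t) _ i)]
  refine (hsum.symm.trans hid).trans ?_
  simp [Matrix.one_apply]

theorem J_eq_det {y : E3} (t : ℝ) (hy : y ∈ D.Ωref) :
    D.J t = Matrix.det (Matrix.of fun k j => D.dx t k j y) := by
  have hdet := congrArg Matrix.det (D.dy_mul_dx t hy)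
  have hdy : Matrix.det (Matrix.of fun i k => D.dy t i k y) = (D.J t)⁻¹ :=
    D.det_eq t _ (D.ψ_mem t hy)
  rwa [Matrix.det_mul, Matrix.det_one, hdy, inv_mul_eq_one₀ (D.J_pos t).ne'] at hdet

section Bounds

open Asymptotics

variable {D} {K : Set ℝ}

theorem isBigO_fderiv_ψ (hK : IsCompact K) :
    ((fun p : E3 × ℝ => fderiv ℝ (fun z => D.ψ z p.2) p.1) =O[𝓟 (D.Ωref ×ˢ K)] fun _ => (1 : ℝ)) ∧
      (fun p : E3 × ℝ => fderiv ℝ (fderiv ℝ fun z => D.ψ z p.2) p.1) =O[𝓟 (D.Ωref ×ˢ K)]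
        fun _ => (1 : ℝ) := by
  obtain ⟨C, hC⟩ := exists_slice_fderiv_bound D.isOpen_ref_slice (contDiffOn_infty.1 D.ψ_smooth 2)
    (D.isBounded_ref.isCompact_closure.prod hK) fun p hp => D.mem_closure_ref_prod p.2 hp.1
  have hS : ∀ p ∈ D.Ωref ×ˢ K, p ∈ closure D.Ωref ×ˢ K ∩ D.Ωref ×ˢ univ := fun p hp =>
    ⟨⟨subset_closure hp.1, hp.2⟩, hp.1, mem_univ _⟩
  exact ⟨isBigO_one_principal_iff.2 ⟨C, fun p hp => (hC p (hS p hp)).1⟩,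
    isBigO_one_principal_iff.2 ⟨C, fun p hp => (hC p (hS p hp)).2⟩⟩

theorem isBigO_fderiv_φ (hK : IsCompact K) :
    (fun p : E3 × ℝ => fderiv ℝ (fun x => D.φ x p.2) (D.ψ p.1 p.2)) =O[𝓟 (D.Ωref ×ˢ K)]
      fun _ => (1 : ℝ) := by
  have hcpt : IsCompact ((fun p : E3 × ℝ => (D.ψ p.1 p.2, p.2)) '' (closure D.Ωref ×ˢ K)) :=
    (D.isBounded_ref.isCompact_closure.prod hK).image_of_continuousOn
      ((D.ψ_smooth.continuousOn.mono fun p hp => D.mem_closure_ref_prod p.2 hp.1).prodMk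
        continuousOn_snd)
  obtain ⟨C, hC⟩ := exists_slice_fderiv_bound D.isOpen_spaceTime_slice
    (contDiffOn_infty.1 D.φ_smooth 2) hcpt (image_subset_iff.2 fun p hp =>
      D.ψ_mapsTo p.1 p.2 (D.mem_closure_ref_prod p.2 hp.1))
  exact isBigO_one_principal_iff.2 ⟨C, fun p hp => (hC (D.ψ p.1 p.2, p.2)
    ⟨⟨p, ⟨subset_closure hp.1, hp.2⟩, rfl⟩, D.ψ_mem p.2 hp.1⟩).1⟩

theorem isBigO_dx (hK : IsCompact K) (k i : Fin 3) :
    (fun p : E3 × ℝ => D.dx p.2 k i p.1) =O[𝓟 (D.Ωref ×ˢ K)] fun _ => (1 : ℝ) :=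
  isBigO_one_of_norm_le (isBigO_fderiv_ψ hK).1 fun p hp => by
    rw [D.dx_eq p.2 hp.1]
    exact norm_clm_single_apply_le _ _ _

theorem isBigO_ddx (hK : IsCompact K) (k i j : Fin 3) :
    (fun p : E3 × ℝ => D.ddx p.2 k i j p.1) =O[𝓟 (D.Ωref ×ˢ K)] fun _ => (1 : ℝ) :=
  isBigO_one_of_norm_le (g := fun p : E3 × ℝ => fderiv ℝ (fderiv ℝ fun z => D.ψ z p.2) p.1)
      (isBigO_fderiv_ψ hK).2 fun p hp => by
    rw [D.ddx_eq p.2 hp.1]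
    refine (norm_clm_single_apply_le _ _ _).trans ?_
    simpa using (fderiv ℝ (fderiv ℝ fun z => D.ψ z p.2) p.1).le_opNorm
      (EuclideanSpace.single i 1)

theorem isBigO_dy (hK : IsCompact K) (i k : Fin 3) :
    (fun p : E3 × ℝ => D.dy p.2 i k p.1) =O[𝓟 (D.Ωref ×ˢ K)] fun _ => (1 : ℝ) :=
  isBigO_one_of_norm_le (isBigO_fderiv_φ hK) fun p hp => by
    rw [D.dy_eq p.2 hp.1]
    exact norm_clm_single_apply_le _ _ _

theorem isBigO_gLow (hK : IsCompact K) (i j : Fin 3) :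
    (fun p : E3 × ℝ => D.gLow p.2 i j p.1) =O[𝓟 (D.Ωref ×ˢ K)] fun _ => (1 : ℝ) :=
  .fun_sum fun k _ => isBigO_one_mul (isBigO_dx hK k i) (isBigO_dx hK k j)

theorem isBigO_gUp (hK : IsCompact K) (i j : Fin 3) :
    (fun p : E3 × ℝ => D.gUp p.2 i j p.1) =O[𝓟 (D.Ωref ×ˢ K)] fun _ => (1 : ℝ) :=
  .fun_sum fun k _ => isBigO_one_mul (isBigO_dy hK i k) (isBigO_dy hK j k)

theorem isBigO_pd_gLow (hK : IsCompact K) (l i j : Fin 3) :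
    (fun p : E3 × ℝ => pd l (D.gLow p.2 i j) p.1) =O[𝓟 (D.Ωref ×ˢ K)] fun _ => (1 : ℝ) := by
  refine IsBigO.congr' ?_ (f₁ := fun p : E3 × ℝ => ∑ k, (D.ddx p.2 k l i p.1 * D.dx p.2 k j p.1 +
    D.dx p.2 k i p.1 * D.ddx p.2 k l j p.1)) (eventually_principal.2 fun p hp =>
      (D.pd_gLow p.2 hp.1 l i j).symm) .rfl
  exact .fun_sum fun k _ => (isBigO_one_mul (isBigO_ddx hK k l i) (isBigO_dx hK k j)).add
    (isBigO_one_mul (isBigO_dx hK k i) (isBigO_ddx hK k l j))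

theorem isBigO_Γ (hK : IsCompact K) (k i j : Fin 3) :
    (fun p : E3 × ℝ => D.Γ p.2 k i j p.1) =O[𝓟 (D.Ωref ×ˢ K)] fun _ => (1 : ℝ) :=
  (IsBigO.fun_sum fun l _ => isBigO_one_mul (isBigO_gUp hK k l)
    (((isBigO_pd_gLow hK j i l).add (isBigO_pd_gLow hK i j l)).sub
      (isBigO_pd_gLow hK l i j))).const_mul_left _

theorem isBigO_R1 (hK : IsCompact K) (i j k l : Fin 3) :
    (fun p : E3 × ℝ => D.R1 p.2 i j k l p.1) =O[𝓟 (D.Ωref ×ˢ K)] fun _ => (1 : ℝ) :=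
  isBigO_one_mul (isBigO_dy hK i j)
    ((isBigO_one_mul (isBigO_dy hK k _) (isBigO_ddx hK _ k l)).sub
      (isBigO_one_mul (isBigO_dy hK k _) (isBigO_ddx hK _ k l)))

theorem isBigO_R2 (hK : IsCompact K) (i j k l : Fin 3) :
    (fun p : E3 × ℝ => D.R2 p.2 i j k l p.1) =O[𝓟 (D.Ωref ×ˢ K)] fun _ => (1 : ℝ) :=
  isBigO_one_mul (isBigO_dy hK i j)
    ((isBigO_one_mul (isBigO_dy hK k _) (isBigO_dx hK _ l)).sub
      (isBigO_one_mul (isBigO_dy hK k _) (isBigO_dx hK _ l)))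

theorem isBigO_J (hK : IsCompact K) :
    (fun p : E3 × ℝ => D.J p.2) =O[𝓟 (D.Ωref ×ˢ K)] fun _ => (1 : ℝ) := by
  refine IsBigO.congr' ?_ (f₁ := fun p : E3 × ℝ => Matrix.det (Matrix.of fun k j =>
    D.dx p.2 k j p.1)) (eventually_principal.2 fun p hp => (D.J_eq_det p.2 hp.1).symm) .rfl
  simp only [Matrix.det_fin_three, Matrix.of_apply]
  have hdx := isBigO_dx (D := D) hK
  have hprod : ∀ i j k l m n, (fun p : E3 × ℝ => D.dx p.2 i j p.1 * D.dx p.2 k l p.1 *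
      D.dx p.2 m n p.1) =O[𝓟 (D.Ωref ×ˢ K)] fun _ => (1 : ℝ) := fun i j k l m n =>
    isBigO_one_mul (isBigO_one_mul (hdx i j) (hdx k l)) (hdx m n)
  exact (((((hprod ..).sub (hprod ..)).sub (hprod ..)).add (hprod ..)).add (hprod ..)).sub
    (hprod ..)

end Bounds

/-- `m` bounds all coefficients that occur in the integrand `⟨N[u,u], Rot(t)[θ,w]⟩_t` at the point
`(y,t)`. -/
structure CoeffBound (t : ℝ) (y : E3) (m : ℝ≥0) : Prop where
  J_le : ‖D.J t‖ₑ ≤ m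
  gLow_le : ∀ i j, ‖D.gLow t i j y‖ₑ ≤ m
  Γ_le : ∀ k i j, ‖D.Γ t k i j y‖ₑ ≤ m
  R1_le : ∀ i j k l, ‖D.R1 t i j k l y‖ₑ ≤ m
  R2_le : ∀ i j k l, ‖D.R2 t i j k l y‖ₑ ≤ m

theorem exists_coeffBound {K : Set ℝ} (hK : IsCompact K) :
    ∃ m : ℝ≥0, ∀ t ∈ K, ∀ y ∈ D.Ωref, D.CoeffBound t y m := by
  obtain ⟨m, hJ, hg, hΓ, hR1, hR2⟩ :=
    ((eventually_enorm_le_of_isBigO_one (isBigO_J hK)).and <|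
    (eventually_all.2 fun i => eventually_all.2 fun j =>
      eventually_enorm_le_of_isBigO_one (isBigO_gLow hK i j)).and <|
    (eventually_all.2 fun k => eventually_all.2 fun i => eventually_all.2 fun j =>
      eventually_enorm_le_of_isBigO_one (isBigO_Γ hK k i j)).and <|
    (eventually_all.2 fun i => eventually_all.2 fun j => eventually_all.2 fun k =>
      eventually_all.2 fun l => eventually_enorm_le_of_isBigO_one (isBigO_R1 hK i j k l)).and <|
    (eventually_all.2 fun i => eventually_all.2 fun j => eventually_all.2 fun k =>
      eventually_all.2 fun l => eventually_enorm_le_of_isBigO_one (isBigO_R2 hK i j k l))).exists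
  exact ⟨m, fun t ht y hy => ⟨hJ (y, t) ⟨hy, ht⟩, fun i j => hg i j (y, t) ⟨hy, ht⟩,
    fun k i j => hΓ k i j (y, t) ⟨hy, ht⟩, fun i j k l => hR1 i j k l (y, t) ⟨hy, ht⟩,
    fun i j k l => hR2 i j k l (y, t) ⟨hy, ht⟩⟩⟩

/-! ### Measurability of the coefficients -/

theorem measurable_dx (t : ℝ) (k i : Fin 3) : Measurable (D.dx t k i) := measurable_pd _ _

theorem measurable_ddx (t : ℝ) (k i j : Fin 3) : Measurable (D.ddx t k i j) := measurable_pd _ _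

theorem measurable_gLow (t : ℝ) (i j : Fin 3) : Measurable (D.gLow t i j) :=
  Finset.measurable_fun_sum _ fun k _ => (D.measurable_dx t k i).mul (D.measurable_dx t k j)

theorem aemeasurable_dy (t : ℝ) (i k : Fin 3) :
    AEMeasurable (D.dy t i k) (volume.restrict D.Ωref) :=
  (measurable_pd k fun x => D.φ x t i).comp_aemeasurable
    (((D.ψ_contDiffOn t).continuousOn.mono subset_closure).aemeasurable D.isOpen_ref.measurableSet)

theorem aemeasurable_gUp (t : ℝ) (i j : Fin 3) :
    AEMeasurable (D.gUp t i j) (volume.restrict D.Ωref) :=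
  Finset.aemeasurable_fun_sum _ fun k _ => (D.aemeasurable_dy t i k).mul (D.aemeasurable_dy t j k)

theorem aemeasurable_Γ (t : ℝ) (k i j : Fin 3) :
    AEMeasurable (D.Γ t k i j) (volume.restrict D.Ωref) :=
  (Finset.aemeasurable_fun_sum _ fun l _ => (D.aemeasurable_gUp t k l).mul
    (((measurable_pd j (D.gLow t i l)).add (measurable_pd i (D.gLow t j l))).sub
      (measurable_pd l (D.gLow t i j))).aemeasurable).const_mul _

theorem aemeasurable_R1 (t : ℝ) (i j k l : Fin 3) :
    AEMeasurable (D.R1 t i j k l) (volume.restrict D.Ωref) :=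
  (D.aemeasurable_dy t i j).mul
    (((D.aemeasurable_dy t k (j + 1)).mul (D.measurable_ddx t (j + 2) k l).aemeasurable).sub
      ((D.aemeasurable_dy t k (j + 2)).mul (D.measurable_ddx t (j + 1) k l).aemeasurable))

theorem aemeasurable_R2 (t : ℝ) (i j k l : Fin 3) :
    AEMeasurable (D.R2 t i j k l) (volume.restrict D.Ωref) :=
  (D.aemeasurable_dy t i j).mul
    (((D.aemeasurable_dy t k (j + 1)).mul (D.measurable_dx t (j + 2) l).aemeasurable).sub
      ((D.aemeasurable_dy t k (j + 2)).mul (D.measurable_dx t (j + 1) l).aemeasurable))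

end Family

/-! ### Fields of class `H¹` vanishing on the boundary -/

theorem norm_clm_sq_eq_sum {ι : Type*} [Fintype ι] [DecidableEq ι]
    (L : EuclideanSpace ℝ ι →L[ℝ] ℝ) : ‖L‖ ^ 2 = ∑ j, ‖L (EuclideanSpace.single j 1)‖ ^ 2 := by
  obtain ⟨x, rfl⟩ := (InnerProductSpace.toDual ℝ (EuclideanSpace ℝ ι)).surjective L
  simp [EuclideanSpace.norm_sq_eq, EuclideanSpace.inner_single_right]

theorem enorm_fderiv_rpow_two_eq_sum (v : E3 → ℝ) (y : E3) :
    ‖fderiv ℝ v y‖ₑ ^ (2 : ℝ) = ∑ j, ‖pd j v y‖ₑ ^ (2 : ℝ) := by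
  simp only [ENNReal.rpow_two, ← ofReal_norm, ← ENNReal.ofReal_pow (norm_nonneg _), pd]
  rw [norm_clm_sq_eq_sum, ENNReal.ofReal_sum_of_nonneg fun j _ => by positivity]

theorem ofReal_norm_L2_sq {α : Type*} [MeasurableSpace α] {μ : Measure α} (f : Lp ℝ 2 μ) :
    ENNReal.ofReal (‖f‖ ^ 2) = ∫⁻ y, ‖f y‖ₑ ^ (2 : ℝ) ∂μ := by
  have h := eLpNorm_nnreal_pow_eq_lintegral (f := f) (μ := μ) (p := 2) (by norm_num)
  simp only [NNReal.coe_ofNat] at h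
  rw [← h, ENNReal.ofReal_pow (norm_nonneg _), ENNReal.rpow_two, ofReal_norm, Lp.enorm_def]
  rfl

theorem lintegral_sum_rpow_le {α ι : Type*} [Fintype ι] [MeasurableSpace α] {μ : Measure α}
    {f : ι → α → ℝ≥0∞} (hf : ∀ i, Measurable (f i)) {p : ℝ} (hp : 1 ≤ p) :
    ∫⁻ y, (∑ i, f i y) ^ p ∂μ ≤ (Fintype.card ι : ℝ≥0∞) ^ (p - 1) * ∑ i, ∫⁻ y, f i y ^ p ∂μ := by
  rw [← lintegral_finsetSum _ fun i _ => (hf i).pow_const p,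
    ← lintegral_const_mul' _ _ (by finiteness)]
  exact lintegral_mono fun y => ENNReal.rpow_sum_le_const_mul_sum_rpow _ _ hp

theorem lintegral_le_of_tendsto_Lp {α : Type*} [MeasurableSpace α] {μ : Measure α} {r : ℝ≥0∞}
    [Fact (1 ≤ r)] {f : Lp ℝ r μ} {fn : ℕ → Lp ℝ r μ} (hlim : Tendsto fn atTop (𝓝 f))
    {m : α → ℝ} (hm : Measurable m) {p : ℝ} {G : ℕ → ℝ≥0∞} {G₀ : ℝ≥0∞}
    (hG : Tendsto G atTop (𝓝 G₀)) (h : ∀ n, ∫⁻ y, ‖fn n y * m y‖ₑ ^ p ∂μ ≤ G n) :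
    ∫⁻ y, ‖f y * m y‖ₑ ^ p ∂μ ≤ G₀ := by
  obtain ⟨ns, hns, hae⟩ := (tendstoInMeasure_of_tendsto_Lp hlim).exists_seq_tendsto_ae
  have hmeas : ∀ n, Measurable fun y => ‖fn (ns n) y * m y‖ₑ ^ p := fun n =>
    ((Lp.stronglyMeasurable (fn (ns n))).measurable.mul hm).enorm.pow_const _
  calc ∫⁻ y, ‖f y * m y‖ₑ ^ p ∂μ
      = ∫⁻ y, liminf (fun n => ‖fn (ns n) y * m y‖ₑ ^ p) atTop ∂μ := by
        refine lintegral_congr_ae ?_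
        filter_upwards [hae] with y hy
        have hpow : Tendsto (fun n => ‖fn (ns n) y * m y‖ₑ ^ p) atTop (𝓝 (‖f y * m y‖ₑ ^ p)) :=
          (ENNReal.continuous_rpow_const.tendsto _).comp (hy.mul_const (m y)).enorm
        exact hpow.liminf_eq.symm
    _ ≤ liminf (fun n => ∫⁻ y, ‖fn (ns n) y * m y‖ₑ ^ p ∂μ) atTop := lintegral_liminf_le hmeas
    _ ≤ liminf (fun n => G (ns n)) atTop := liminf_le_liminf (Eventually.of_forall fun n => h _)
    _ = G₀ := (hG.comp hns.tendsto_atTop).liminf_eq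

section WeakPartial

variable {U : Set E3} {j : Fin 3}

theorem IsWeakPartial.unique (hU : IsOpen U) {f g g' : L2 U} (h : IsWeakPartial U j f g)
    (h' : IsWeakPartial U j f g') : g = g' := by
  have hzero : IsWeakPartial U j (f + (-1 : ℝ) • f) (g + (-1 : ℝ) • g') := h.add (h'.smul _)
  simp only [neg_smul, one_smul, ← sub_eq_add_neg, sub_self] at hzero
  have hloc : LocallyIntegrableOn (g - g' : L2 U) U volume :=
    locallyIntegrableOn_of_locallyIntegrable_restrict
      ((Lp.memLp (g - g')).locallyIntegrable one_le_two)
  have hae := hU.ae_eq_zero_of_integral_contDiff_smul_eq_zero hloc fun η hη hc hs => by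
    have hInt := hzero η hη hc hs
    rw [integral_congr_ae (g := fun _ => (0 : ℝ)) (by
      filter_upwards [Lp.coeFn_zero ℝ 2 (volume.restrict U)] with y hy
      rw [hy, Pi.zero_apply, zero_mul]), integral_zero, eq_comm, neg_eq_zero,
      setIntegral_eq_integral_of_forall_compl_eq_zero fun y hy => by
        rw [image_eq_zero_of_notMem_tsupport fun hy' => hy (hs hy'), mul_zero]] at hInt
    simpa only [smul_eq_mul, mul_comm] using hInt
  exact sub_eq_zero.1 ((Lp.eq_zero_iff_ae_eq_zero).2 ((ae_restrict_iff' hU.measurableSet).2 hae))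

theorem isWeakPartial_toLp {v : E3 → ℝ} (hv : ContDiff ℝ ∞ v) (hc : HasCompactSupport v) :
    IsWeakPartial U j ((memLp_test hv.continuous hc).toLp v)
      ((memLp_pd_test j hv hc).toLp (pd j v)) := by
  intro η hη hηc hηs
  have hpd {f : E3 → ℝ} (hf : ContDiff ℝ ∞ f) : Continuous (pd j f) :=
    (hf.continuous_fderiv (by simp)).clm_apply continuous_const
  have hcη : HasCompactSupport (pd j η) := hηc.fderiv_apply ℝ _
  have hout : ∀ y, y ∉ U → η =ᶠ[𝓝 y] 0 := fun y hy =>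
    notMem_tsupport_iff_eventuallyEq.1 fun hy' => hy (hηs hy')
  calc ∫ y in U, (memLp_test hv.continuous hc).toLp v y * pd j η y
      = ∫ y in U, v y * pd j η y := integral_congr_ae <| by
        filter_upwards [(memLp_test (U := U) hv.continuous hc).coeFn_toLp] with y hy
        rw [hy]
    _ = ∫ y, v y * pd j η y := setIntegral_eq_integral_of_forall_compl_eq_zero fun y hy => by
        simp [pd, (hout y hy).fderiv_eq]
    _ = - ∫ y, pd j v y * η y := integral_mul_fderiv_eq_neg_fderiv_mul_of_integrable
        (((hpd hv).mul hη.continuous).integrable_of_hasCompactSupport hηc.mul_left)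
        ((hv.continuous.mul (hpd hη)).integrable_of_hasCompactSupport hcη.mul_left)
        ((hv.continuous.mul hη.continuous).integrable_of_hasCompactSupport hηc.mul_left)
        (fun y _ => hv.differentiable (by simp) y) fun y _ => hη.differentiable (by simp) y
    _ = - ∫ y in U, pd j v y * η y := by
        rw [setIntegral_eq_integral_of_forall_compl_eq_zero fun y hy => by
          simp [(hout y hy).eq_of_nhds]]
    _ = - ∫ y in U, (memLp_pd_test j hv hc).toLp (pd j v) y * η y := by
        congr 1
        refine integral_congr_ae ?_
        filter_upwards [(memLp_pd_test (U := U) j hv hc).coeFn_toLp] with y hy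
        rw [hy]

end WeakPartial

/-- `C_c^∞(U)`, viewed inside the space `H¹(U)` of vector fields. -/
def testField (U : Set E3) : Set (VH1 U) :=
  {u | ∃ v : E3 → E3, ContDiff ℝ ∞ v ∧ HasCompactSupport v ∧ tsupport v ⊆ U ∧
    ∀ i, u.val i =ᵐ[volume.restrict U] fun y => v y i}

/-- `H¹₀(U)` for vector fields: the closure of `C_c^∞(U)` in the `H¹`-norm. -/
def H10 (U : Set E3) : Set (VH1 U) := closure (testField U)

theorem H10σ_subset_H10 (U : Set E3) : H10σ U ⊆ H10 U :=
  closure_mono fun _ ⟨v, hv, hc, hs, _, hu⟩ => ⟨v, hv, hc, hs, hu⟩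

/-- The sum of the moduli of the components of a field. -/
def VH1.absSum {U : Set E3} (u : VH1 U) (y : E3) : ℝ≥0∞ := ∑ i, ‖u.val i y‖ₑ

/-- The sum of the moduli of the weak partial derivatives of a field. -/
def VH1.absGrad {U : Set E3} (u : VH1 U) (y : E3) : ℝ≥0∞ := ∑ i, ∑ j, ‖u.wd i j y‖ₑ

namespace VH1

variable {U : Set E3} (u : VH1 U)

theorem measurable_val (i : Fin 3) : Measurable (u.val i) :=
  (Lp.stronglyMeasurable (u i).1.1).measurable

theorem measurable_wd (i j : Fin 3) : Measurable (u.wd i j) :=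
  (Lp.stronglyMeasurable ((u i).1.2 j)).measurable

theorem measurable_absSum : Measurable u.absSum :=
  Finset.measurable_fun_sum _ fun i _ => (u.measurable_val i).enorm

theorem measurable_absGrad : Measurable u.absGrad :=
  Finset.measurable_fun_sum _ fun i _ => Finset.measurable_fun_sum _ fun j _ =>
    (u.measurable_wd i j).enorm

theorem enorm_val_le_absSum (i : Fin 3) (y : E3) : ‖u.val i y‖ₑ ≤ u.absSum y :=
  Finset.single_le_sum (f := fun i => ‖u.val i y‖ₑ) (fun _ _ => zero_le) (Finset.mem_univ i)

theorem enorm_wd_le_absGrad (i j : Fin 3) (y : E3) : ‖u.wd i j y‖ₑ ≤ u.absGrad y :=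
  (Finset.single_le_sum (f := fun j => ‖u.wd i j y‖ₑ) (fun _ _ => zero_le)
    (Finset.mem_univ j)).trans (Finset.single_le_sum (f := fun i => ∑ j, ‖u.wd i j y‖ₑ)
      (fun _ _ => zero_le) (Finset.mem_univ i))

theorem ofReal_gradNormSq :
    ENNReal.ofReal u.gradNormSq = ∑ i, ∑ j, ∫⁻ y in U, ‖u.wd i j y‖ₑ ^ (2 : ℝ) := by
  rw [gradNormSq, ENNReal.ofReal_sum_of_nonneg fun i _ => by positivity]
  refine Finset.sum_congr rfl fun i _ => ?_
  rw [ENNReal.ofReal_sum_of_nonneg fun j _ => by positivity]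
  exact Finset.sum_congr rfl fun j _ => ofReal_norm_L2_sq _

theorem continuous_gradNormSq : Continuous (gradNormSq (U := U)) := by
  unfold gradNormSq
  fun_prop

theorem lintegral_absGrad_rpow_two_le :
    ∫⁻ y in U, u.absGrad y ^ (2 : ℝ) ≤ 9 * ENNReal.ofReal u.gradNormSq := by
  have h := lintegral_sum_rpow_le (μ := volume.restrict U)
    (f := fun (p : Fin 3 × Fin 3) y => ‖u.wd p.1 p.2 y‖ₑ)
    (fun p => (u.measurable_wd p.1 p.2).enorm) one_le_two
  norm_num [Fintype.sum_prod_type] at h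
  simpa only [absGrad, ofReal_gradNormSq, ENNReal.rpow_two] using h

theorem gradNormSq_nonneg : 0 ≤ u.gradNormSq := by
  unfold gradNormSq
  positivity

theorem gradNormSq_pos {C : ℝ≥0∞} {u : VH1 U} (hu : u ≠ 0)
    (hC : ∫⁻ y in U, u.absSum y ^ (2 : ℝ) ≤ C * ENNReal.ofReal u.gradNormSq) :
    0 < u.gradNormSq := by
  refine u.gradNormSq_nonneg.lt_of_ne' fun h0 => hu ?_
  have hval (i : Fin 3) : (u i).1.1 = 0 := by
    have hle : ENNReal.ofReal (‖(u i).1.1‖ ^ 2) ≤ 0 := by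
      calc ENNReal.ofReal (‖(u i).1.1‖ ^ 2)
          = ∫⁻ y in U, ‖u.val i y‖ₑ ^ (2 : ℝ) := ofReal_norm_L2_sq _
        _ ≤ ∫⁻ y in U, u.absSum y ^ (2 : ℝ) := by gcongr; exact u.enorm_val_le_absSum i _
        _ ≤ 0 := by simpa [h0] using hC
    simpa using (ENNReal.ofReal_eq_zero.1 (le_zero_iff.1 hle)).antisymm (by positivity)
  have hwd (i j : Fin 3) : (u i).1.2 j = 0 := by
    have hi : ∑ j, ‖(u i).1.2 j‖ ^ 2 = 0 :=
      (Finset.sum_eq_zero_iff_of_nonneg fun _ _ => by positivity).1 h0 i (Finset.mem_univ i)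
    simpa using
      (Finset.sum_eq_zero_iff_of_nonneg fun _ _ => by positivity).1 hi j (Finset.mem_univ j)
  exact funext fun i => Subtype.ext (Prod.ext (hval i) (funext (hwd i)))

end VH1

section H10

variable {U : Set E3}

theorem exists_component_of_mem_testField (hU : IsOpen U) {u : VH1 U} (hu : u ∈ testField U)
    (i : Fin 3) :
    ∃ v : E3 → ℝ, ContDiff ℝ 1 v ∧ HasCompactSupport v ∧ tsupport v ⊆ U ∧
      u.val i =ᵐ[volume.restrict U] v ∧
      ∫⁻ y, ‖fderiv ℝ v y‖ₑ ^ (2 : ℝ) ≤ ENNReal.ofReal u.gradNormSq := by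
  obtain ⟨V, hV, hVc, hVs, hVu⟩ := hu
  set v : E3 → ℝ := fun y => V y i
  have hv : ContDiff ℝ ∞ v := (EuclideanSpace.proj i : E3 →L[ℝ] ℝ).contDiff.comp hV
  have hc : HasCompactSupport v := hVc.comp_left (g := fun x : E3 => x i) rfl
  have hs : tsupport v ⊆ U := (tsupport_comp_subset (g := fun x : E3 => x i) rfl V).trans hVs
  have hval : (u i).1.1 = (memLp_test hv.continuous hc).toLp v :=
    Lp.ext ((hVu i).trans (MemLp.coeFn_toLp _).symm)
  have hwd (j : Fin 3) : u.wd i j =ᵐ[volume.restrict U] pd j v := by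
    have hj : (u i).1.2 j = (memLp_pd_test j hv hc).toLp (pd j v) :=
      ((u i).2 j).unique hU (hval ▸ isWeakPartial_toLp hv hc)
    exact (congrArg (fun f : L2 U => (f : E3 → ℝ)) hj).eventuallyEq.trans (MemLp.coeFn_toLp _)
  have hsupp : Function.support (fun y => ‖fderiv ℝ v y‖ₑ ^ (2 : ℝ)) ⊆ U := fun y hy =>
    hs (support_fderiv_subset ℝ fun h0 => hy (by simp [h0, ← ofReal_norm]))
  refine ⟨v, hv.of_le (by simp), hc, hs, hVu i, ?_⟩
  calc ∫⁻ y, ‖fderiv ℝ v y‖ₑ ^ (2 : ℝ)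
      = ∫⁻ y in U, ∑ j, ‖pd j v y‖ₑ ^ (2 : ℝ) := by
        rw [← setLIntegral_eq_of_support_subset hsupp]
        simp only [enorm_fderiv_rpow_two_eq_sum]
    _ = ∑ j, ∫⁻ y in U, ‖u.wd i j y‖ₑ ^ (2 : ℝ) := by
        rw [lintegral_finsetSum _ fun j _ => (measurable_pd j v).enorm.pow_const _]
        refine Finset.sum_congr rfl fun j _ => lintegral_congr_ae ?_
        filter_upwards [hwd j] with y hy
        rw [hy]
    _ ≤ ENNReal.ofReal u.gradNormSq := by
        rw [u.ofReal_gradNormSq]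
        exact Finset.single_le_sum (f := fun i => ∑ j, ∫⁻ y in U, ‖u.wd i j y‖ₑ ^ (2 : ℝ))
          (fun _ _ => zero_le) (Finset.mem_univ i)

theorem lintegral_val_mul_le_of_mem_H10 {m : E3 → ℝ} (hU : IsOpen U) (hm : Measurable m)
    {p q : ℝ} (hq : 0 ≤ q) {C : ℝ≥0∞} (hC : C ≠ ⊤)
    (h : ∀ v : E3 → ℝ, ContDiff ℝ 1 v → HasCompactSupport v → tsupport v ⊆ U →
      ∫⁻ y in U, ‖v y * m y‖ₑ ^ p ≤ C * (∫⁻ y, ‖fderiv ℝ v y‖ₑ ^ (2 : ℝ)) ^ q)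
    {u : VH1 U} (hu : u ∈ H10 U) (i : Fin 3) :
    ∫⁻ y in U, ‖u.val i y * m y‖ₑ ^ p ≤ C * ENNReal.ofReal u.gradNormSq ^ q := by
  obtain ⟨un, hun, hlim⟩ := mem_closure_iff_seq_limit.1 hu
  have hcont : Continuous fun u : VH1 U => (u i).1.1 := by fun_prop
  have hG : Continuous fun u : VH1 U => C * ENNReal.ofReal u.gradNormSq ^ q :=
    (ENNReal.continuous_const_mul hC).comp (ENNReal.continuous_rpow_const.comp
      (ENNReal.continuous_ofReal.comp VH1.continuous_gradNormSq))
  refine lintegral_le_of_tendsto_Lp ((hcont.tendsto u).comp hlim) hm ((hG.tendsto u).comp hlim)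
    fun n => ?_
  obtain ⟨v, hv, hc, hs, huv, hle⟩ := exists_component_of_mem_testField hU (hun n) i
  calc ∫⁻ y in U, ‖(un n).val i y * m y‖ₑ ^ p
      = ∫⁻ y in U, ‖v y * m y‖ₑ ^ p := lintegral_congr_ae <| by
        filter_upwards [huv] with y hy
        rw [hy]
    _ ≤ C * (∫⁻ y, ‖fderiv ℝ v y‖ₑ ^ (2 : ℝ)) ^ q := h v hv hc hs
    _ ≤ C * ENNReal.ofReal (un n).gradNormSq ^ q := by gcongr

theorem exists_lintegral_absSum_mul_le {m : E3 → ℝ} (hU : IsOpen U) (hm : Measurable m)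
    {p q : ℝ} (hp : 1 ≤ p) (hq : 0 ≤ q)
    (h : ∃ C : ℝ≥0∞, C ≠ ⊤ ∧ ∀ v : E3 → ℝ, ContDiff ℝ 1 v → HasCompactSupport v →
      tsupport v ⊆ U →
        ∫⁻ y in U, ‖v y * m y‖ₑ ^ p ≤ C * (∫⁻ y, ‖fderiv ℝ v y‖ₑ ^ (2 : ℝ)) ^ q) :
    ∃ C : ℝ≥0∞, C ≠ ⊤ ∧ ∀ u ∈ H10 U,
      ∫⁻ y in U, (u.absSum y * ‖m y‖ₑ) ^ p ≤ C * ENNReal.ofReal u.gradNormSq ^ q := by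
  obtain ⟨C, hC, h⟩ := h
  refine ⟨3 ^ (p - 1) * 3 * C, by finiteness, fun u hu => ?_⟩
  calc ∫⁻ y in U, (u.absSum y * ‖m y‖ₑ) ^ p
      = ∫⁻ y in U, (∑ i, ‖u.val i y * m y‖ₑ) ^ p := by
        simp only [VH1.absSum, Finset.sum_mul, enorm_mul]
    _ ≤ 3 ^ (p - 1) * ∑ i, ∫⁻ y in U, ‖u.val i y * m y‖ₑ ^ p := by
        simpa using lintegral_sum_rpow_le (fun i => ((u.measurable_val i).mul hm).enorm) hp
    _ ≤ 3 ^ (p - 1) * ∑ _i : Fin 3, C * ENNReal.ofReal u.gradNormSq ^ q := by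
        gcongr with i
        exact lintegral_val_mul_le_of_mem_H10 hU hm hq hC h hu i
    _ = 3 ^ (p - 1) * 3 * C * ENNReal.ofReal u.gradNormSq ^ q := by
        simp only [Finset.sum_const, Finset.card_univ, Fintype.card_fin, nsmul_eq_mul,
          Nat.cast_ofNat, mul_assoc]

theorem exists_lintegral_absSum_rpow_two_le (hU : IsOpen U) (hb : Bornology.IsBounded U) :
    ∃ C : ℝ≥0∞, C ≠ ⊤ ∧ ∀ u ∈ H10 U,
      ∫⁻ y in U, u.absSum y ^ (2 : ℝ) ≤ C * ENNReal.ofReal u.gradNormSq := by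
  obtain ⟨C, hC, h⟩ := exists_lintegral_rpow_two_le_fderiv (E := E3) (μ := volume)
    (by simp) hb
  simpa using exists_lintegral_absSum_mul_le hU (measurable_const (a := (1 : ℝ))) (p := 2) (q := 1)
    one_le_two zero_le_one ⟨C, hC, fun v hv _ hs => by
      simpa using (setLIntegral_le_lintegral U _).trans (h v hv hs)⟩

theorem exists_lintegral_absSum_rpow_six_le (hU : IsOpen U) :
    ∃ C : ℝ≥0∞, C ≠ ⊤ ∧ ∀ u ∈ H10 U,
      ∫⁻ y in U, u.absSum y ^ (6 : ℝ) ≤ C * ENNReal.ofReal u.gradNormSq ^ (3 : ℝ) := by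
  obtain ⟨C, hC, h⟩ := exists_lintegral_rpow_six_le_fderiv (E := E3) (μ := volume) (by simp)
  simpa using exists_lintegral_absSum_mul_le hU (measurable_const (a := (1 : ℝ))) (p := 6) (q := 3)
    (by norm_num) (by norm_num) ⟨C, hC, fun v hv hc _ => by
      simpa using (setLIntegral_le_lintegral U _).trans (h v hv hc)⟩

/-- The quotient `|u(y)| / d(y)` of Hardy's inequality, `d` being the distance to the boundary. -/
def VH1.hardyQuotient (u : VH1 U) (y : E3) : ℝ≥0∞ :=
  u.absSum y * ‖(infDist y (frontier U))⁻¹‖ₑ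

theorem measurable_inv_infDist_frontier : Measurable fun y => (infDist y (frontier U))⁻¹ :=
  (continuous_infDist_pt _).measurable.inv

theorem VH1.measurable_hardyQuotient (u : VH1 U) : Measurable u.hardyQuotient :=
  u.measurable_absSum.mul measurable_inv_infDist_frontier.enorm

theorem exists_lintegral_hardyQuotient_rpow_two_le (hU : IsOpen U) (hb : Bornology.IsBounded U)
    (hfr : (frontier U).Nonempty) (hP : ∀ y ∈ frontier U, Nonempty (LocalDefining U y)) :
    ∃ C : ℝ≥0∞, C ≠ ⊤ ∧ ∀ u ∈ H10 U,
      ∫⁻ y in U, u.hardyQuotient y ^ (2 : ℝ) ≤ C * ENNReal.ofReal u.gradNormSq := by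
  simpa only [VH1.hardyQuotient, ENNReal.rpow_one] using exists_lintegral_absSum_mul_le (q := 1) hU
    measurable_inv_infDist_frontier one_le_two zero_le_one
    (by simpa only [div_eq_mul_inv, ENNReal.rpow_one] using
      exists_hardy (μ := volume) (by simp) hU hb hfr hP)

end H10

/-! ### Fields of class `H²` -/

theorem lintegral_h1Density_rpow_le {U : Set E3} (hU : MeasurableSet U) {f : L2 U}
    {g : Fin 3 → L2 U} {p : ℝ} (hp : 1 ≤ p) {B : ℝ≥0∞} (hf : ∫⁻ y in U, ‖f y‖ₑ ^ p ≤ B)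
    (hg : ∀ j, ∫⁻ y in U, ‖g j y‖ₑ ^ p ≤ B) :
    ∫⁻ y, h1Density U f g y ^ p ≤ 2 ^ (p - 1) * (B + 3 ^ (p - 1) * ∑ _j : Fin 3, B) := by
  have hind (y : E3) : h1Density U f g y ^ p =
      U.indicator (fun y => (‖f y‖ₑ + ∑ j, ‖g j y‖ₑ) ^ p) y :=
    (congrFun (indicator_comp_of_zero (g := fun r : ℝ≥0∞ => r ^ p)
      (ENNReal.zero_rpow_of_pos (one_pos.trans_le hp))) y).symm
  calc ∫⁻ y, h1Density U f g y ^ p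
      = ∫⁻ y in U, (‖f y‖ₑ + ∑ j, ‖g j y‖ₑ) ^ p := by
        simp only [hind, lintegral_indicator hU]
    _ ≤ 2 ^ (p - 1) * ((∫⁻ y in U, ‖f y‖ₑ ^ p) + ∫⁻ y in U, (∑ j, ‖g j y‖ₑ) ^ p) :=
        lintegral_add_rpow_le (Lp.stronglyMeasurable f).enorm hp
    _ ≤ 2 ^ (p - 1) * (B + 3 ^ (p - 1) * ∑ j, ∫⁻ y in U, ‖g j y‖ₑ ^ p) := by
        gcongr
        simpa using lintegral_sum_rpow_le (fun j => (Lp.stronglyMeasurable (g j)).enorm) hp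
    _ ≤ 2 ^ (p - 1) * (B + 3 ^ (p - 1) * ∑ _j : Fin 3, B) := by
        gcongr with j
        exact hg j

namespace H2

variable {U : Set E3} (F : H2 U)

theorem norm_val_le : ‖F.1.1‖ ≤ ‖F‖ := norm_fst_le F.1

theorem norm_wd_le (j : Fin 3) : ‖F.1.2.1 j‖ ≤ ‖F‖ :=
  (norm_le_pi_norm F.1.2.1 j).trans ((norm_fst_le F.1.2).trans (norm_snd_le F.1))

theorem norm_wd_wd_le (j k : Fin 3) : ‖F.1.2.2 j k‖ ≤ ‖F‖ :=
  (norm_le_pi_norm (F.1.2.2 j) k).trans ((norm_le_pi_norm F.1.2.2 j).trans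
    ((norm_snd_le F.1.2).trans (norm_snd_le F.1)))

end H2

namespace HasCone

variable {U : Set E3}

theorem exists_lintegral_rpow_four_le (hc : HasCone U) (hU : IsOpen U)
    (hb : Bornology.IsBounded U) (R : ℝ) :
    ∃ M : ℝ≥0∞, M ≠ ⊤ ∧ ∀ (f : L2 U) (g : Fin 3 → L2 U), (∀ j, IsWeakPartial U j f (g j)) →
      ‖f‖ ≤ R → (∀ j, ‖g j‖ ≤ R) → ∫⁻ y in U, ‖f y‖ₑ ^ (4 : ℝ) ≤ M := by
  obtain ⟨C, hC, hfour⟩ := hc.lintegral_four_le hU hb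
  have htwo (f : L2 U) (hf : ‖f‖ ≤ R) :
      ∫⁻ y in U, ‖f y‖ₑ ^ (2 : ℝ) ≤ ENNReal.ofReal (R ^ 2) := by
    rw [← ofReal_norm_L2_sq]
    gcongr
  refine ⟨C * (2 ^ ((2 : ℝ) - 1) * (ENNReal.ofReal (R ^ 2) + 3 ^ ((2 : ℝ) - 1) *
    ∑ _j : Fin 3, ENNReal.ofReal (R ^ 2))) ^ (2 : ℝ), ?_, fun f g h hf hg => ?_⟩
  · rw [Finset.sum_const, nsmul_eq_mul]
    finiteness
  · refine (hfour f g h).trans ?_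
    gcongr
    exact lintegral_h1Density_rpow_le hU.measurableSet one_le_two (htwo f hf) fun j =>
      htwo (g j) (hg j)

theorem exists_lintegral_absGrad_rpow_four_le (hc : HasCone U) (hU : IsOpen U)
    (hb : Bornology.IsBounded U) (R : ℝ) :
    ∃ M : ℝ≥0∞, M ≠ ⊤ ∧ ∀ w : VH2 U, ‖w‖ ≤ R →
      ∫⁻ y in U, w.toVH1.absGrad y ^ (4 : ℝ) ≤ M := by
  obtain ⟨M, hM, h⟩ := hc.exists_lintegral_rpow_four_le hU hb R
  refine ⟨9 ^ ((4 : ℝ) - 1) * ∑ _p : Fin 3 × Fin 3, M, ?_, fun w hw => ?_⟩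
  · rw [Finset.sum_const, nsmul_eq_mul]
    finiteness
  · have hsum := lintegral_sum_rpow_le (μ := volume.restrict U) (p := 4)
      (f := fun (p : Fin 3 × Fin 3) y => ‖w.toVH1.wd p.1 p.2 y‖ₑ)
      (fun p => (w.toVH1.measurable_wd p.1 p.2).enorm) (by norm_num)
    have hcard : (Fintype.card (Fin 3 × Fin 3) : ℝ≥0∞) = 9 := by norm_num
    rw [hcard] at hsum
    simp only [VH1.absGrad, ← Fintype.sum_prod_type' fun i j => ‖w.toVH1.wd i j _‖ₑ]
    refine hsum.trans ?_
    gcongr with p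
    have hp : ‖w p.1‖ ≤ R := (norm_le_pi_norm w p.1).trans hw
    exact h _ _ ((w p.1).2.2 p.2) ((H2.norm_wd_le _ p.2).trans hp) fun k =>
      (H2.norm_wd_wd_le _ p.2 k).trans hp

theorem exists_ae_absSum_le (hc : HasCone U) (hU : IsOpen U)
    (hb : Bornology.IsBounded U) (R : ℝ) :
    ∃ M : ℝ≥0∞, M ≠ ⊤ ∧ ∀ w : VH2 U, ‖w‖ ≤ R →
      ∀ᵐ y ∂volume.restrict U, w.toVH1.absSum y ≤ M := by
  obtain ⟨M, hM, hfour⟩ := hc.exists_lintegral_rpow_four_le hU hb R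
  obtain ⟨C, hC, hsup⟩ := hc.enorm_le hU hb
  set B : ℝ≥0∞ := C * (2 ^ ((4 : ℝ) - 1) * (M + 3 ^ ((4 : ℝ) - 1) * ∑ _j : Fin 3, M)) ^ (1 / 4 : ℝ)
    with hB
  have hBt : B ≠ ⊤ := by
    rw [hB, Finset.sum_const, nsmul_eq_mul]
    finiteness
  refine ⟨3 * B, by finiteness, fun w hw => ?_⟩
  have hval (i : Fin 3) : ∀ᵐ y ∂volume.restrict U, ‖w.toVH1.val i y‖ₑ ≤ B := by
    have hi : ‖w i‖ ≤ R := (norm_le_pi_norm w i).trans hw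
    rw [ae_restrict_iff' hU.measurableSet]
    filter_upwards [hsup (w i).1.1 (w i).1.2.1 (w i).2.1] with y hy hyU
    refine (hy hyU).trans ?_
    rw [hB]
    gcongr
    exact lintegral_h1Density_rpow_le hU.measurableSet (by norm_num)
      (hfour _ _ (w i).2.1 ((H2.norm_val_le _).trans hi) fun j => (H2.norm_wd_le _ j).trans hi)
      fun j => hfour _ _ ((w i).2.2 j) ((H2.norm_wd_le _ j).trans hi) fun k =>
        (H2.norm_wd_wd_le _ j k).trans hi
  filter_upwards [ae_all_iff.2 hval] with y hy
  exact (Finset.sum_le_card_nsmul _ _ B fun i _ => hy i).trans_eq (by simp)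

end HasCone

/-! ### The trilinear estimate -/

section Trilinear

variable {α : Type*} [MeasurableSpace α] {μ : Measure α} {P A V F G : α → ℝ≥0∞}

theorem lintegral_mul_le_rpow_two (hF : Measurable F) (hG : Measurable G) :
    ∫⁻ y, F y * G y ∂μ ≤
      (∫⁻ y, F y ^ (2 : ℝ) ∂μ) ^ (1 / 2 : ℝ) * (∫⁻ y, G y ^ (2 : ℝ) ∂μ) ^ (1 / 2 : ℝ) :=
  ENNReal.lintegral_mul_le_Lp_mul_Lq μ Real.HolderConjugate.two_two hF.aemeasurable
    hG.aemeasurable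

theorem lintegral_mul_mul_le (hP : Measurable P) (hF : Measurable F) (hG : Measurable G) :
    ∫⁻ y, P y * (F y * G y) ∂μ ≤ (∫⁻ y, P y ^ (2 : ℝ) ∂μ) ^ (1 / 2 : ℝ) *
      ((∫⁻ y, F y ^ (4 : ℝ) ∂μ) ^ (1 / 4 : ℝ) * (∫⁻ y, G y ^ (4 : ℝ) ∂μ) ^ (1 / 4 : ℝ)) := by
  have hFG := lintegral_mul_le_rpow_two (μ := μ) (hF.pow_const (2 : ℝ)) (hG.pow_const (2 : ℝ))
  simp only [← ENNReal.mul_rpow_of_nonneg _ _ zero_le_two, ← ENNReal.rpow_mul] at hFG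
  calc ∫⁻ y, P y * (F y * G y) ∂μ
      ≤ (∫⁻ y, P y ^ (2 : ℝ) ∂μ) ^ (1 / 2 : ℝ) *
          (∫⁻ y, (F y * G y) ^ (2 : ℝ) ∂μ) ^ (1 / 2 : ℝ) :=
        lintegral_mul_le_rpow_two hP (hF.mul hG)
    _ ≤ (∫⁻ y, P y ^ (2 : ℝ) ∂μ) ^ (1 / 2 : ℝ) * ((∫⁻ y, F y ^ (2 * 2 : ℝ) ∂μ) ^ (1 / 2 : ℝ) *
          (∫⁻ y, G y ^ (2 * 2 : ℝ) ∂μ) ^ (1 / 2 : ℝ)) ^ (1 / 2 : ℝ) := by gcongr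
    _ = _ := by
        rw [ENNReal.mul_rpow_of_nonneg _ _ one_half_pos.le, ← ENNReal.rpow_mul, ← ENNReal.rpow_mul]
        norm_num

theorem lintegral_rpow_four_le_of_ae_le (hA : Measurable A) (hV : Measurable V) {δ : ℝ≥0∞}
    (hδ : δ ≠ ⊤) (hFV : ∀ᵐ y ∂μ, F y ≤ V y) (hFA : ∀ᵐ y ∂μ, F y ≤ δ * A y) :
    ∫⁻ y, F y ^ (4 : ℝ) ∂μ ≤
      δ * ((∫⁻ y, A y ^ (2 : ℝ) ∂μ) ^ (1 / 2 : ℝ) * (∫⁻ y, V y ^ (6 : ℝ) ∂μ) ^ (1 / 2 : ℝ)) := by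
  have hpow (y : α) : (V y ^ (3 : ℝ)) ^ (2 : ℝ) = V y ^ (6 : ℝ) := by
    rw [← ENNReal.rpow_mul]
    norm_num
  have hAV := lintegral_mul_le_rpow_two (μ := μ) hA (hV.pow_const (3 : ℝ))
  simp only [hpow] at hAV
  calc ∫⁻ y, F y ^ (4 : ℝ) ∂μ
      ≤ ∫⁻ y, δ * (A y * V y ^ (3 : ℝ)) ∂μ := by
        refine lintegral_mono_ae ?_
        filter_upwards [hFV, hFA] with y hV hA
        calc F y ^ (4 : ℝ) = F y ^ (1 : ℝ) * F y ^ (3 : ℝ) := by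
              rw [← ENNReal.rpow_add_of_nonneg _ _ zero_le_one zero_le_three]
              norm_num
          _ ≤ δ * A y * V y ^ (3 : ℝ) := by
              rw [ENNReal.rpow_one]
              gcongr
          _ = δ * (A y * V y ^ (3 : ℝ)) := mul_assoc _ _ _
    _ ≤ _ := by
        rw [lintegral_const_mul' _ _ hδ]
        gcongr

theorem rpow_half_mul_self (a : ℝ≥0∞) : a ^ (1 / 2 : ℝ) * a ^ (1 / 2 : ℝ) = a := by
  rw [← ENNReal.rpow_add_of_nonneg _ _ (by norm_num) (by norm_num)]
  norm_num

theorem lintegral_mul_mul_le_of_ae_le (hP : Measurable P) (hA : Measurable A) (hV : Measurable V)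
    (hF : Measurable F) (hG : Measurable G) {δ c N : ℝ≥0∞} (hδ : δ ≠ ⊤)
    (hFV : ∀ᵐ y ∂μ, F y ≤ V y) (hFA : ∀ᵐ y ∂μ, F y ≤ δ * A y)
    (hP2 : ∫⁻ y, P y ^ (2 : ℝ) ∂μ ≤ c * N) (hA2 : ∫⁻ y, A y ^ (2 : ℝ) ∂μ ≤ c * N)
    (hV6 : ∫⁻ y, V y ^ (6 : ℝ) ∂μ ≤ c * N ^ (3 : ℝ)) (hG4 : ∫⁻ y, G y ^ (4 : ℝ) ∂μ ≤ c) :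
    ∫⁻ y, P y * (F y * G y) ∂μ ≤ c * δ ^ (1 / 4 : ℝ) * N := by
  have hF4 : ∫⁻ y, F y ^ (4 : ℝ) ∂μ ≤ δ * (c * N ^ (2 : ℝ)) :=
    calc ∫⁻ y, F y ^ (4 : ℝ) ∂μ
        ≤ δ * ((c * N) ^ (1 / 2 : ℝ) * (c * N ^ (3 : ℝ)) ^ (1 / 2 : ℝ)) :=
          (lintegral_rpow_four_le_of_ae_le hA hV hδ hFV hFA).trans (by gcongr)
      _ = δ * ((c * N ^ (2 : ℝ)) ^ (1 / 2 : ℝ) * (c * N ^ (2 : ℝ)) ^ (1 / 2 : ℝ)) := by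
          simp only [← ENNReal.mul_rpow_of_nonneg _ _ one_half_pos.le]
          norm_cast
          ring_nf
      _ = δ * (c * N ^ (2 : ℝ)) := by rw [rpow_half_mul_self]
  calc ∫⁻ y, P y * (F y * G y) ∂μ
      ≤ (c * N) ^ (1 / 2 : ℝ) * ((δ * (c * N ^ (2 : ℝ))) ^ (1 / 4 : ℝ) * c ^ (1 / 4 : ℝ)) :=
        (lintegral_mul_mul_le hP hF hG).trans (by gcongr)
    _ = (c * N) ^ (1 / 2 : ℝ) * (δ * (c * N) ^ (2 : ℝ)) ^ (1 / 4 : ℝ) := by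
        rw [← ENNReal.mul_rpow_of_nonneg _ _ (by norm_num)]
        norm_cast
        ring_nf
    _ = (c * N) ^ (1 / 2 : ℝ) * (δ ^ (1 / 4 : ℝ) * (c * N) ^ (1 / 2 : ℝ)) := by
        rw [ENNReal.mul_rpow_of_nonneg δ _ (by norm_num), ← ENNReal.rpow_mul]
        norm_num
    _ = c * δ ^ (1 / 4 : ℝ) * N := by
        rw [mul_left_comm, rpow_half_mul_self]
        ring

theorem lintegral_mul_add_mul_le (hP : Measurable P) (hA : Measurable A) (hV : Measurable V)
    (hF : Measurable F) (hG : Measurable G) {τ δ c N : ℝ≥0∞} (hτ : τ ≠ ⊤) (hδ : δ ≠ ⊤)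
    (hFV : ∀ᵐ y ∂μ, F y ≤ V y) (hFA : ∀ᵐ y ∂μ, F y ≤ δ * A y)
    (hP2 : ∫⁻ y, P y ^ (2 : ℝ) ∂μ ≤ c * N) (hA2 : ∫⁻ y, A y ^ (2 : ℝ) ∂μ ≤ c * N)
    (hV6 : ∫⁻ y, V y ^ (6 : ℝ) ∂μ ≤ c * N ^ (3 : ℝ)) (hG4 : ∫⁻ y, G y ^ (4 : ℝ) ∂μ ≤ c) :
    ∫⁻ y, P y * (τ * A y + F y * G y) ∂μ ≤ c * (τ + δ ^ (1 / 4 : ℝ)) * N := by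
  have hPA : ∫⁻ y, P y * A y ∂μ ≤ c * N :=
    calc ∫⁻ y, P y * A y ∂μ ≤ (c * N) ^ (1 / 2 : ℝ) * (c * N) ^ (1 / 2 : ℝ) :=
          (lintegral_mul_le_rpow_two hP hA).trans (by gcongr)
      _ = c * N := rpow_half_mul_self _
  calc ∫⁻ y, P y * (τ * A y + F y * G y) ∂μ
      = τ * ∫⁻ y, P y * A y ∂μ + ∫⁻ y, P y * (F y * G y) ∂μ := by
        have hPAτ : Measurable fun y => τ * (P y * A y) := (hP.mul hA).const_mul τ
        rw [← lintegral_const_mul' _ _ hτ, ← lintegral_add_left hPAτ]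
        simp only [mul_add, mul_left_comm]
    _ ≤ τ * (c * N) + c * δ ^ (1 / 4 : ℝ) * N := by
        gcongr
        exact lintegral_mul_mul_le_of_ae_le hP hA hV hF hG hδ hFV hFA hP2 hA2 hV6 hG4
    _ = c * (τ + δ ^ (1 / 4 : ℝ)) * N := by ring

end Trilinear

/-! ### The integrand -/

theorem enorm_sum_fin_three_le {f : Fin 3 → ℝ} {B : ℝ≥0∞} (h : ∀ i, ‖f i‖ₑ ≤ B) :
    ‖∑ i, f i‖ₑ ≤ 3 * B :=
  (enorm_sum_le _ _).trans ((Finset.sum_le_card_nsmul _ _ B fun i _ => h i).trans_eq (by simp))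

theorem enorm_sum_mul_le {ι : Type*} [Fintype ι] (f g : ι → ℝ) :
    ‖∑ i, f i * g i‖ₑ ≤ ∑ i, ‖f i‖ₑ * ‖g i‖ₑ := by
  simpa only [enorm_mul] using enorm_sum_le Finset.univ fun i => f i * g i

theorem enorm_pd_le (k : Fin 3) (f : E3 → ℝ) (y : E3) : ‖pd k f y‖ₑ ≤ ‖fderiv ℝ f y‖ₑ := by
  rw [enorm_le_iff_norm_le]
  simpa [pd] using (fderiv ℝ f y).le_opNorm (EuclideanSpace.single k 1)

namespace Family

variable {D : Family} {t : ℝ} {y : E3}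

theorem enorm_cov_le {m : ℝ≥0∞} (hΓ : ∀ k i j, ‖D.Γ t k i j y‖ₑ ≤ m) (v : VH1 D.Ωref)
    (j i : Fin 3) : ‖D.cov t v j i y‖ₑ ≤ v.absGrad y + m * v.absSum y := by
  calc ‖D.cov t v j i y‖ₑ ≤ ‖v.wd i j y‖ₑ + ∑ k, ‖D.Γ t i j k y‖ₑ * ‖v.val k y‖ₑ :=
        (enorm_add_le _ _).trans (by gcongr; exact enorm_sum_mul_le _ _)
    _ ≤ v.absGrad y + ∑ k, m * ‖v.val k y‖ₑ := by
        gcongr with k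
        · exact v.enorm_wd_le_absGrad i j y
        · exact hΓ _ _ _
    _ = v.absGrad y + m * v.absSum y := by rw [VH1.absSum, Finset.mul_sum]

theorem enorm_N_le {m : ℝ≥0∞} (hΓ : ∀ k i j, ‖D.Γ t k i j y‖ₑ ≤ m) (u v : VH1 D.Ωref)
    (i : Fin 3) : ‖D.N t u v y i‖ₑ ≤ u.absSum y * (v.absGrad y + m * v.absSum y) := by
  calc ‖D.N t u v y i‖ₑ ≤ ∑ j, ‖u.val j y‖ₑ * ‖D.cov t v j i y‖ₑ := enorm_sum_mul_le _ _
    _ ≤ ∑ j, ‖u.val j y‖ₑ * (v.absGrad y + m * v.absSum y) := by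
        gcongr with j
        exact enorm_cov_le hΓ v j i
    _ = u.absSum y * (v.absGrad y + m * v.absSum y) := (Finset.sum_mul ..).symm

theorem enorm_Rot_le {m : ℝ≥0∞} (hR1 : ∀ i j k l, ‖D.R1 t i j k l y‖ₑ ≤ m)
    (hR2 : ∀ i j k l, ‖D.R2 t i j k l y‖ₑ ≤ m) (θ : E3 → ℝ) (w : VH1 D.Ωref) (i : Fin 3) :
    ‖D.Rot t θ w y i‖ₑ ≤
      27 * m * ((‖θ y‖ₑ + ‖fderiv ℝ θ y‖ₑ) * w.absSum y + ‖θ y‖ₑ * w.absGrad y) := by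
  calc ‖D.Rot t θ w y i‖ₑ ≤ 3 * (3 * (3 * (m * (‖θ y‖ₑ * w.absSum y)))) +
        3 * (3 * (3 * (m * (‖fderiv ℝ θ y‖ₑ * w.absSum y + ‖θ y‖ₑ * w.absGrad y)))) := by
        refine (enorm_add_le _ _).trans ?_
        gcongr <;> refine enorm_sum_fin_three_le fun j => enorm_sum_fin_three_le fun k =>
          enorm_sum_fin_three_le fun l => ?_
        · rw [enorm_mul, enorm_mul]
          gcongr
          · exact hR1 i j k l
          · exact w.enorm_val_le_absSum l y
        · rw [enorm_mul]
          gcongr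
          · exact hR2 i j k l
          · refine (enorm_add_le _ _).trans ?_
            rw [enorm_mul, enorm_mul]
            gcongr
            · exact enorm_pd_le k θ y
            · exact w.enorm_val_le_absSum l y
            · exact w.enorm_wd_le_absGrad l k y
    _ = _ := by ring

theorem enorm_pairingDensity_le {m A B : ℝ≥0∞} (hJ : ‖D.J t‖ₑ ≤ m)
    (hg : ∀ i j, ‖D.gLow t i j y‖ₑ ≤ m) {a b : E3 → Fin 3 → ℝ} (ha : ∀ i, ‖a y i‖ₑ ≤ A)
    (hb : ∀ i, ‖b y i‖ₑ ≤ B) : ‖D.pairingDensity t a b y‖ₑ ≤ 9 * m ^ 2 * (A * B) := by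
  calc ‖D.pairingDensity t a b y‖ₑ ≤ 3 * (3 * (m * A * B)) * m := by
        rw [pairingDensity, enorm_mul]
        gcongr
        refine enorm_sum_fin_three_le fun i => enorm_sum_fin_three_le fun j => ?_
        rw [enorm_mul, enorm_mul]
        gcongr
        · exact hg i j
        · exact ha i
        · exact hb j
    _ = 9 * m ^ 2 * (A * B) := by ring

theorem CoeffBound.enorm_pairingDensity_N_Rot_le {m : ℝ≥0} (h : D.CoeffBound t y m)
    (θ : E3 → ℝ) (u w : VH1 D.Ωref) :
    ‖D.pairingDensity t (D.N t u u) (D.Rot t θ w) y‖ₑ ≤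
      243 * m ^ 3 * (1 + m) * ((u.absGrad y + u.absSum y) *
        (u.absSum y * ((‖θ y‖ₑ + ‖fderiv ℝ θ y‖ₑ) * w.absSum y + ‖θ y‖ₑ * w.absGrad y))) := by
  have hsum : u.absGrad y + m * u.absSum y ≤ (1 + m) * (u.absGrad y + u.absSum y) :=
    calc u.absGrad y + m * u.absSum y
        ≤ u.absGrad y + m * u.absSum y + (m * u.absGrad y + u.absSum y) := le_self_add
      _ = (1 + m) * (u.absGrad y + u.absSum y) := by ring
  refine (enorm_pairingDensity_le h.J_le h.gLow_le (enorm_N_le h.Γ_le u u)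
    (enorm_Rot_le h.R1_le h.R2_le θ w)).trans ?_
  calc _ ≤ 9 * m ^ 2 * (u.absSum y * ((1 + m) * (u.absGrad y + u.absSum y)) *
        (27 * m * ((‖θ y‖ₑ + ‖fderiv ℝ θ y‖ₑ) * w.absSum y + ‖θ y‖ₑ * w.absGrad y))) := by gcongr
    _ = _ := by ring

variable (D)

theorem aemeasurable_N (t : ℝ) (u v : VH1 D.Ωref) (i : Fin 3) :
    AEMeasurable (fun y => D.N t u v y i) (volume.restrict D.Ωref) :=
  Finset.aemeasurable_fun_sum _ fun j _ => (u.measurable_val j).aemeasurable.mul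
    ((v.measurable_wd i j).aemeasurable.add (Finset.aemeasurable_fun_sum _ fun k _ =>
      (D.aemeasurable_Γ t i j k).mul (v.measurable_val k).aemeasurable))

theorem aemeasurable_Rot (t : ℝ) {θ : E3 → ℝ} (hθ : Measurable θ) (w : VH1 D.Ωref) (i : Fin 3) :
    AEMeasurable (fun y => D.Rot t θ w y i) (volume.restrict D.Ωref) :=
  (Finset.aemeasurable_fun_sum _ fun j _ => Finset.aemeasurable_fun_sum _ fun k _ =>
    Finset.aemeasurable_fun_sum _ fun l _ => (D.aemeasurable_R1 t i j k l).mul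
      (hθ.mul (w.measurable_val l)).aemeasurable).add
  (Finset.aemeasurable_fun_sum _ fun j _ => Finset.aemeasurable_fun_sum _ fun k _ =>
    Finset.aemeasurable_fun_sum _ fun l _ => (D.aemeasurable_R2 t i j k l).mul
      (((measurable_pd k θ).mul (w.measurable_val l)).add
        (hθ.mul (w.measurable_wd l k))).aemeasurable)

theorem aemeasurable_pairingDensity (t : ℝ) {a b : E3 → Fin 3 → ℝ}
    (ha : ∀ i, AEMeasurable (fun y => a y i) (volume.restrict D.Ωref))
    (hb : ∀ i, AEMeasurable (fun y => b y i) (volume.restrict D.Ωref)) :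
    AEMeasurable (D.pairingDensity t a b) (volume.restrict D.Ωref) :=
  (Finset.aemeasurable_fun_sum _ fun i _ => Finset.aemeasurable_fun_sum _ fun j _ =>
    ((D.measurable_gLow t i j).aemeasurable.mul (ha i)).mul (hb j)).mul_const _

end Family

/-! ### Smallness of the form for thin cut-offs -/

theorem exp_neg_one_div_le {ρ : ℝ} (hρ : 0 < ρ) : Real.exp (-1 / ρ) ≤ ρ := by
  have hle : ρ⁻¹ ≤ Real.exp ρ⁻¹ := by linarith [Real.add_one_le_exp ρ⁻¹]
  rw [neg_div, one_div, Real.exp_neg]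
  exact inv_le_of_inv_le₀ hρ hle

namespace IsBoundaryCutoff

variable {U : Set E3} {ρ : ℝ} {θ : E3 → ℝ}

theorem enorm_le_one (h : IsBoundaryCutoff U ρ θ) (y : E3) : ‖θ y‖ₑ ≤ 1 := by
  rw [Real.enorm_eq_ofReal (h.mem_Icc y).1]
  exact ENNReal.ofReal_le_one.2 (h.mem_Icc y).2

theorem enorm_le (h : IsBoundaryCutoff U ρ θ) (hρ : 0 < ρ) {y : E3} (hy : y ∈ U)
    (hd : 0 < infDist y (frontier U)) :
    ‖θ y‖ₑ ≤ ENNReal.ofReal (2 * ρ) * ‖(infDist y (frontier U))⁻¹‖ₑ := by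
  rcases lt_or_ge (2 * Real.exp (-1 / ρ)) (infDist y (frontier U)) with hfar | hnear
  · simp [h.eq_zero y (subset_closure hy) hfar]
  · refine (h.enorm_le_one y).trans ?_
    rw [Real.enorm_eq_ofReal (by positivity), ← ENNReal.ofReal_mul (by positivity),
      ENNReal.one_le_ofReal, ← div_eq_mul_inv, one_le_div hd]
    linarith [exp_neg_one_div_le hρ]

theorem enorm_fderiv_le (h : IsBoundaryCutoff U ρ θ) (hρ : 0 < ρ) {y : E3} (hy : y ∈ U) :
    ‖fderiv ℝ θ y‖ₑ ≤ ENNReal.ofReal (4 * ρ) * ‖(infDist y (frontier U))⁻¹‖ₑ := by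
  have hinv : 0 ≤ (infDist y (frontier U))⁻¹ := inv_nonneg.2 infDist_nonneg
  have hsqrt : Real.sqrt 3 ≤ 2 := Real.sqrt_le_iff.2 (by norm_num)
  rw [Real.enorm_eq_ofReal hinv, ← ENNReal.ofReal_mul (by positivity), ← ofReal_norm]
  refine ENNReal.ofReal_le_ofReal ((h.grad_le y hy).trans ?_)
  rw [div_eq_mul_inv]
  gcongr
  linarith

theorem absSum_mul_le (h : IsBoundaryCutoff U ρ θ) (hρ : 0 < ρ) {y : E3} (hy : y ∈ U)
    (hd : 0 < infDist y (frontier U)) (u : VH1 U) (B G : ℝ≥0∞) :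
    u.absSum y * ((‖θ y‖ₑ + ‖fderiv ℝ θ y‖ₑ) * B + ‖θ y‖ₑ * G) ≤
      ENNReal.ofReal (6 * ρ) * B * u.hardyQuotient y + ‖θ y‖ₑ * u.absSum y * G := by
  have hsum : ‖θ y‖ₑ + ‖fderiv ℝ θ y‖ₑ ≤
      ENNReal.ofReal (6 * ρ) * ‖(infDist y (frontier U))⁻¹‖ₑ := by
    refine (add_le_add (h.enorm_le hρ hy hd) (h.enorm_fderiv_le hρ hy)).trans_eq ?_
    rw [← add_mul, ← ENNReal.ofReal_add (by positivity) (by positivity)]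
    ring_nf
  calc _ ≤ u.absSum y * (ENNReal.ofReal (6 * ρ) * ‖(infDist y (frontier U))⁻¹‖ₑ * B +
        ‖θ y‖ₑ * G) := by gcongr
    _ = _ := by
        rw [VH1.hardyQuotient]
        ring

end IsBoundaryCutoff

theorem gradNormSq_pos_of_mem_H10 {U : Set E3} (hU : IsOpen U) (hb : Bornology.IsBounded U)
    {u : VH1 U} (hu : u ∈ H10 U) (hne : u ≠ 0) : 0 < u.gradNormSq := by
  obtain ⟨C, -, hC⟩ := exists_lintegral_absSum_rpow_two_le hU hb
  exact VH1.gradNormSq_pos hne (hC u hu)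

theorem exists_lintegral_absGrad_add_absSum_rpow_two_le {U : Set E3} (hU : IsOpen U)
    (hb : Bornology.IsBounded U) :
    ∃ C : ℝ≥0∞, C ≠ ⊤ ∧ ∀ u ∈ H10 U,
      ∫⁻ y in U, (u.absGrad y + u.absSum y) ^ (2 : ℝ) ≤ C * ENNReal.ofReal u.gradNormSq := by
  obtain ⟨C, hC, hpoincare⟩ := exists_lintegral_absSum_rpow_two_le hU hb
  refine ⟨2 ^ ((2 : ℝ) - 1) * (9 + C), by finiteness, fun u hu => ?_⟩
  rw [mul_assoc, add_mul]
  refine (lintegral_add_rpow_le u.measurable_absGrad one_le_two).trans ?_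
  gcongr
  · exact u.lintegral_absGrad_rpow_two_le
  · exact hpoincare u hu

theorem exists_cutoff_parameter {K c B : ℝ≥0∞} (hK : K ≠ ⊤) (hc : c ≠ ⊤) (hB : B ≠ ⊤) {ε ρ₀ : ℝ}
    (hε : 0 < ε) (hρ₀ : 0 < ρ₀) : ∃ ρ : ℝ, 0 < ρ ∧ ρ < ρ₀ ∧
      K * (c * (ENNReal.ofReal (6 * ρ) * B + ENNReal.ofReal (2 * ρ) ^ (1 / 4 : ℝ))) <
        ENNReal.ofReal ε := by
  have hlin (a : ℝ) : Tendsto (fun ρ : ℝ => ENNReal.ofReal (a * ρ)) (𝓝 0) (𝓝 0) := by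
    simpa using ENNReal.tendsto_ofReal ((continuous_const_mul a).tendsto 0)
  have hrpow : Tendsto (fun ρ : ℝ => ENNReal.ofReal (2 * ρ) ^ (1 / 4 : ℝ)) (𝓝 0) (𝓝 0) := by
    simpa using (hlin 2).ennrpow_const (1 / 4 : ℝ)
  have htendsto := ENNReal.Tendsto.const_mul (ENNReal.Tendsto.const_mul
    ((ENNReal.Tendsto.mul_const (hlin 6) (Or.inr hB)).add hrpow) (Or.inr hc)) (Or.inr hK)
  simp only [zero_mul, add_zero, mul_zero] at htendsto
  have hsmall := (htendsto.mono_left (nhdsWithin_le_nhds (s := Ioi 0))).eventually_lt_const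
    (ENNReal.ofReal_pos.2 hε)
  obtain ⟨ρ, hlt, hρ, hρρ₀⟩ := (hsmall.and (Ioo_mem_nhdsGT hρ₀)).exists
  exact ⟨ρ, hρ, hρρ₀, hlt⟩

namespace Family

variable (D : Family) {K : Set ℝ}

theorem ae_enorm_pairingDensity_le {t : ℝ} {m : ℝ≥0} (hm : ∀ y ∈ D.Ωref, D.CoeffBound t y m)
    {ρ : ℝ} (hρ : 0 < ρ) {θ : E3 → ℝ} (hθ : IsBoundaryCutoff D.Ωref ρ θ) (u w : VH1 D.Ωref)
    {B : ℝ≥0∞} (hw : ∀ᵐ y ∂volume.restrict D.Ωref, w.absSum y ≤ B) :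
    ∀ᵐ y ∂volume.restrict D.Ωref, ‖D.pairingDensity t (D.N t u u) (D.Rot t θ w) y‖ₑ ≤
      243 * m ^ 3 * (1 + m) * ((u.absGrad y + u.absSum y) *
        (ENNReal.ofReal (6 * ρ) * B * u.hardyQuotient y + ‖θ y‖ₑ * u.absSum y * w.absGrad y)) := by
  filter_upwards [hw, ae_restrict_mem D.isOpen_ref.measurableSet] with y hwy hy
  have hd := infDist_frontier_pos D.isOpen_ref D.frontier_ref_nonempty hy
  refine ((hm y hy).enorm_pairingDensity_N_Rot_le θ u w).trans ?_
  gcongr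
  refine le_trans ?_ (hθ.absSum_mul_le hρ hy hd u B (w.absGrad y))
  gcongr

theorem exists_lintegral_pairingDensity_le (hK : IsCompact K) (R : ℝ) :
    ∃ L c B : ℝ≥0∞, L ≠ ⊤ ∧ c ≠ ⊤ ∧ B ≠ ⊤ ∧ ∀ ρ : ℝ, 0 < ρ → ∀ θ, IsBoundaryCutoff D.Ωref ρ θ →
      ∀ t ∈ K, ∀ w : VH2 D.Ωref, ‖w‖ ≤ R → ∀ u ∈ H10 D.Ωref,
        ∫⁻ y in D.Ωref, ‖D.pairingDensity t (D.N t u u) (D.Rot t θ w.toVH1) y‖ₑ ≤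
          L * (c * (ENNReal.ofReal (6 * ρ) * B + ENNReal.ofReal (2 * ρ) ^ (1 / 4 : ℝ))) *
            ENNReal.ofReal u.gradNormSq := by
  have hU := D.isOpen_ref
  have hb := D.isBounded_ref
  have hfr := D.frontier_ref_nonempty
  obtain ⟨m, hm⟩ := D.exists_coeffBound hK
  obtain ⟨B, hB, hw⟩ := D.hasCone_ref.exists_ae_absSum_le hU hb R
  obtain ⟨c₁, hc₁, hP⟩ := exists_lintegral_absGrad_add_absSum_rpow_two_le hU hb
  obtain ⟨c₂, hc₂, hA⟩ := exists_lintegral_hardyQuotient_rpow_two_le hU hb hfr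
    fun y hy => D.nonempty_localDefining hy
  obtain ⟨c₃, hc₃, hV⟩ := exists_lintegral_absSum_rpow_six_le hU
  obtain ⟨c₄, hc₄, hG⟩ := D.hasCone_ref.exists_lintegral_absGrad_rpow_four_le hU hb R
  set c := c₁ ⊔ c₂ ⊔ (c₃ ⊔ c₄)
  have h₁ : c₁ ≤ c := le_sup_left.trans le_sup_left
  have h₂ : c₂ ≤ c := le_sup_right.trans le_sup_left
  have h₃ : c₃ ≤ c := le_sup_left.trans le_sup_right
  have h₄ : c₄ ≤ c := le_sup_right.trans le_sup_right
  refine ⟨243 * m ^ 3 * (1 + m), c, B, by finiteness, by finiteness, hB,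
    fun ρ hρ θ hθ t ht w hwR u hu => ?_⟩
  refine (lintegral_mono_ae (D.ae_enorm_pairingDensity_le (hm t ht) hρ hθ u _ (hw w hwR))).trans ?_
  rw [lintegral_const_mul' _ _ (by finiteness), mul_assoc (243 * (m : ℝ≥0∞) ^ 3 * (1 + m))]
  gcongr
  refine lintegral_mul_add_mul_le (u.measurable_absGrad.add u.measurable_absSum)
    u.measurable_hardyQuotient u.measurable_absSum
    (hθ.smooth.continuous.measurable.enorm.mul u.measurable_absSum) w.toVH1.measurable_absGrad
    (by finiteness) (by finiteness) (.of_forall fun y => mul_le_of_le_one_left' (hθ.enorm_le_one y))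
    ?_ ((hP u hu).trans (by gcongr)) ((hA u hu).trans (by gcongr)) ((hV u hu).trans (by gcongr))
    ((hG w hwR).trans h₄)
  filter_upwards [ae_restrict_mem hU.measurableSet] with y hy
  have hθy := hθ.enorm_le hρ hy (infDist_frontier_pos hU hfr hy)
  calc ‖θ y‖ₑ * u.absSum y
      ≤ ENNReal.ofReal (2 * ρ) * ‖(infDist y (frontier D.Ωref))⁻¹‖ₑ * u.absSum y := by gcongr
    _ = ENNReal.ofReal (2 * ρ) * u.hardyQuotient y := by rw [VH1.hardyQuotient]; ring

theorem pairing_le_of_lintegral_le {t r : ℝ} {a b : E3 → Fin 3 → ℝ} (hr : 0 ≤ r)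
    (h : ∫⁻ y in D.Ωref, ‖D.pairingDensity t a b y‖ₑ ≤ ENNReal.ofReal r) :
    D.pairing t a b ≤ r := by
  refine (le_abs_self _).trans ((ENNReal.ofReal_le_ofReal_iff hr).1 ?_)
  rw [← Real.enorm_eq_ofReal_abs]
  exact (enorm_integral_le_lintegral_enorm _).trans h

end Family

end MovingDomain

end

theorem mainTheorem8_general (D : MovingDomain.Family) {K : Set ℝ} (hK : IsCompact K) (R : ℝ)
    {ε : ℝ} (hε : 0 < ε) {ρ₀ : ℝ} (hρ₀ : 0 < ρ₀) :
    ∃ ρ : ℝ, 0 < ρ ∧ ρ < ρ₀ ∧ ∃ θ : EuclideanSpace ℝ (Fin 3) → ℝ,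
      MovingDomain.IsBoundaryCutoff D.Ωref ρ θ ∧
      ∀ u ∈ MovingDomain.H10 D.Ωref, ∀ t ∈ K, ∀ w : MovingDomain.VH2 D.Ωref, ‖w‖ ≤ R →
        MeasureTheory.IntegrableOn
          (D.pairingDensity t (D.N t u u) (D.Rot t θ w.toVH1)) D.Ωref ∧
        (u ≠ 0 → D.pairing t (D.N t u u) (D.Rot t θ w.toVH1) < ε * u.gradNormSq) := by
  obtain ⟨L, c, B, hL, hc, hB, hbound⟩ := D.exists_lintegral_pairingDensity_le hK R
  obtain ⟨ρ, hρ, hρρ₀, hsmall⟩ :=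
    MovingDomain.exists_cutoff_parameter hL hc hB (half_pos hε) hρ₀
  obtain ⟨θ, hθ⟩ := MovingDomain.exists_isBoundaryCutoff D.Ωref hρ
  refine ⟨ρ, hρ, hρρ₀, θ, hθ, fun u hu t ht w hw => ?_⟩
  have hle : ∫⁻ y in D.Ωref, ‖D.pairingDensity t (D.N t u u) (D.Rot t θ w.toVH1) y‖ₑ ≤
      ENNReal.ofReal (ε / 2 * u.gradNormSq) := by
    rw [ENNReal.ofReal_mul (half_pos hε).le]
    exact (hbound ρ hρ θ hθ t ht w hw u hu).trans (by gcongr)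
  refine ⟨⟨(D.aemeasurable_pairingDensity t (D.aemeasurable_N t u u) (D.aemeasurable_Rot t
    hθ.smooth.continuous.measurable w.toVH1)).aestronglyMeasurable,
      hle.trans_lt ENNReal.ofReal_lt_top⟩, fun hne => ?_⟩
  have hpos := MovingDomain.gradNormSq_pos_of_mem_H10 D.isOpen_ref D.isBounded_ref hu hne
  have hpair := D.pairing_le_of_lintegral_le (by positivity) hle
  nlinarith

theorem mainTheorem8 (D : MovingDomain.Family) (T : ℝ) (hT : 0 < T)
    (w : C(Set.Icc (0 : ℝ) T, MovingDomain.VH2 D.Ωref)) (ε : ℝ) (hε : 0 < ε)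
    (ρ₀ : ℝ) (hρ₀ : 0 < ρ₀) :
    ∃ ρ : ℝ, 0 < ρ ∧ ρ < ρ₀ ∧ ∃ θ : EuclideanSpace ℝ (Fin 3) → ℝ,
      MovingDomain.IsBoundaryCutoff D.Ωref ρ θ ∧
      ∀ u ∈ MovingDomain.H10σ D.Ωref, ∀ t : Set.Icc (0 : ℝ) T,
        MeasureTheory.IntegrableOn
          (D.pairingDensity t (D.N t u u) (D.Rot t θ (w t).toVH1)) D.Ωref ∧
        (u ≠ 0 →
          D.pairing t (D.N t u u) (D.Rot t θ (w t).toVH1) < ε * u.gradNormSq) := by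
  obtain ⟨ρ, hρ, hρρ₀, θ, hθ, h⟩ := mainTheorem8_general D isCompact_Icc ‖w‖ hε hρ₀
  exact ⟨ρ, hρ, hρρ₀, θ, hθ, fun u hu t =>
    h u (MovingDomain.H10σ_subset_H10 D.Ωref hu) t t.2 (w t) (w.norm_coe_le_norm t)⟩
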